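/- **Theorem 1.4.** Let $X$ and $B$ be two-sided standard Brownian motions on $\mathbb R$ and let $Y$ be a one-sided standard Brownian motion, with $X,Y,B$ mutually independent, and let $Z(t)=X(Y(t))$, $t\ge 0$, be the iterated Brownian motion. For $n\ge 1$ let $\mathscr D_n=\{j2^{-n/2}: j\in\mathbb Z\}$, $T_{0,n}=0$ and $$T_{k,n}=\inf\{s>T_{k-1,n}:\ Y(s)\in \mathscr D_n\setminus\{Y(T_{k-1,n})\}\},\qquad k\ge 1 .$$ For $f:\mathbb R\to\mathbb R$, an integer $\kappa\ge 2$ and $t\in[0,1]$ set $$S_n^{(\kappa)}(f,t)=\sum_{k=0}^{\lfloor \frac12(2^{n}t-1)\rfloor} f\big(Z(T_{2k+1,n})\big)\Big[\big(Z(T_{2k+2,n})-Z(T_{2k+1,n})\big)^{\kappa}+(-1)^{\kappa+1}\big(Z(T_{2k+1,n})-Z(T_{2k,n})\big)^{\kappa}\Big]$$ (an empty sum if the upper limit is $-1$). Let $\mu_q=E[G^q]$ with $G\sim\mathscr N(0,1)$. Let $f\in C^2(\mathbb R)$ with $f'$ and $f''$ bounded and let $\kappa\ge 2$ be an integer. Then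 the Wiener–Itô integral process $u\mapsto\int_0^u f(X_z)\,dB_z$ and the Stratonovich integral process $u\mapsto\int_0^u f(X_z)\,d^\circ X_z$, $u\in\mathbb R$, are well defined with continuous versions. (Here $\int_0^u=-\int_u^0$ for $u<0$. The two integrals are the limits in probability of the Riemann sums with increments weighted by $f(X_{z_i})$, respectively by $\frac12(f(X_{z_i})+f(X_{z_{i+1}}))$, as the mesh of the partition $(z_i)$ tends to $0$. The integrals up to $Y_t$ below are the values of the continuous versions at $u=Y_t$.) As $n\to\infty$: 1. if $\kappa$ is even, $\left\{X_x,\,2^{(\kappa-1)\frac n4}S_n^{(\kappa)}(f,t)\right\}_{x\in\mathbb R,\,t\in[0,1]}$ converges in the sense of finite dimensional distributions to $$\left\{X_x,\ \sqrt{\mu_{2\kappa}-\mu_\kappa^2}\int_0^{Y_t} f(X_z)\,dB_z\right\}_{x\in\mathbb R,\,t\in[0,1]};$$ 2. if $\kappa$ is odd, $\left\{X_x,\,2^{(\kappa-1)\frac n4}S_n^{(\kappa)}(f,t)\right\}_{x\in\mathbb R,\,t\in[0,1]}$ converges in the sense of finite dimensional distributions to $$\left\{X_x,\ \int_0^{Y_t}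 f(X_z)\big(\mu_{\kappa+1}\,d^\circ X_z+\sqrt{\mu_{2\kappa}-\mu_{\kappa+1}^2}\,dB_z\big)\right\}_{x\in\mathbb R,\,t\in[0,1]}.$$ -/

import Mathlib

open MeasureTheory ProbabilityTheory Filter Topology
open scoped NNReal

noncomputable section

namespace IteratedBM

/-- A two-sided standard Brownian motion: a real process indexed by `ℝ` whose restrictions to the
two half-lines, `(X_t)_{t ≥ 0}` and `(X_{-t})_{t ≥ 0}`, are independent standard Brownian motions
(a standard Brownian motion starts at `0` and has almost surely continuous paths). -/
structure IsTwoSidedBrownian {Ω : Type*} [MeasurableSpace Ω] (X : ℝ → Ω → ℝ) (P : Measure Ω) :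
    Prop where
  measurable : ∀ t, Measurable (X t)
  pos : IsBrownianReal (fun (t : ℝ≥0) ω => X (t : ℝ) ω) P
  neg : IsBrownianReal (fun (t : ℝ≥0) ω => X (-(t : ℝ)) ω) P
  indep : IndepFun (fun ω (t : ℝ≥0) => X (t : ℝ) ω) (fun ω (t : ℝ≥0) => X (-(t : ℝ)) ω) P

/-- The `q`-th moment `μ_q` of a standard Gaussian random variable. -/
def gaussMoment (q : ℕ) : ℝ := ∫ x, x ^ q ∂(gaussianReal 0 1)

/-- The iterated Brownian motion `Z(t) = X(Y(t))`. -/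
def ibm {Ω : Type*} (X : ℝ → Ω → ℝ) (Y : ℝ≥0 → Ω → ℝ) (t : ℝ≥0) (ω : Ω) : ℝ := X (Y t ω) ω

/-- The grid `𝒟_n = {j 2^{-n/2} : j ∈ ℤ}`. -/
def grid (n : ℕ) : Set ℝ := Set.range fun j : ℤ => (j : ℝ) * (2 : ℝ) ^ (-(n : ℝ) / 2)

/-- The times `T_{k,n}` of successive visits of `Y` to new points of the grid: `T_{0,n} = 0` and
`T_{k+1,n} = inf {s > T_{k,n} : Y(s) ∈ 𝒟_n \ {Y(T_{k,n})}}`. -/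
def skeletonTime {Ω : Type*} (Y : ℝ≥0 → Ω → ℝ) (n : ℕ) : ℕ → Ω → ℝ≥0
  | 0, _ => 0
  | k + 1, ω => sInf {s : ℝ≥0 | skeletonTime Y n k ω < s ∧
      Y s ω ∈ grid n \ {Y (skeletonTime Y n k ω) ω}}

/-- The signed weighted power variation
`S_n^{(κ)}(f,t) = ∑_{k=0}^{⌊(2^n t - 1)/2⌋} f(Z(T_{2k+1,n})) *
  [(Z(T_{2k+2,n}) - Z(T_{2k+1,n}))^κ + (-1)^{κ+1} (Z(T_{2k+1,n}) - Z(T_{2k,n}))^κ]`;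
the sum is empty if its upper limit is `-1`. -/
def signedVariation {Ω : Type*} (X : ℝ → Ω → ℝ) (Y : ℝ≥0 → Ω → ℝ) (κ : ℕ) (f : ℝ → ℝ) (n : ℕ)
    (t : ℝ≥0) (ω : Ω) : ℝ :=
  ∑ k ∈ Finset.range (⌊((2 : ℝ) ^ n * (t : ℝ) - 1) / 2⌋ + 1).toNat,
    f (ibm X Y (skeletonTime Y n (2 * k + 1) ω) ω) *
      ((ibm X Y (skeletonTime Y n (2 * k + 2) ω) ω
          - ibm X Y (skeletonTime Y n (2 * k + 1) ω) ω) ^ κ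
        + (-1) ^ (κ + 1) * (ibm X Y (skeletonTime Y n (2 * k + 1) ω) ω
          - ibm X Y (skeletonTime Y n (2 * k) ω) ω) ^ κ)

/-- `z 0 ≤ z 1 ≤ … ≤ z N` is a partition of `[a, b]` of mesh at most `δ`. -/
structure IsPartition (a b δ : ℝ) {N : ℕ} (z : Fin (N + 1) → ℝ) : Prop where
  mono : Monotone z
  first : z 0 = a
  last : z (Fin.last N) = b
  mesh : ∀ i : Fin N, z i.succ - z i.castSucc ≤ δ

/-- The sums `∑_i G(z_i, z_{i+1})` over partitions `a = z_0 ≤ … ≤ z_N = b` of `[a, b]` converge in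
probability to `L` as the mesh of the partition tends to `0`. -/
def TendstoRiemann {Ω : Type*} [MeasurableSpace Ω] (P : Measure Ω) (G : ℝ → ℝ → Ω → ℝ) (a b : ℝ)
    (L : Ω → ℝ) : Prop :=
  ∀ ε > (0 : ℝ), ∀ η > (0 : ℝ), ∃ δ > (0 : ℝ), ∀ (N : ℕ) (z : Fin (N + 1) → ℝ),
    IsPartition a b δ z →
      P {ω | ε ≤ |∑ i : Fin N, G (z i.castSucc) (z i.succ) ω - L ω|} ≤ ENNReal.ofReal η

/-- `I` is a continuous version of the oriented integral `u ↦ ∫_0^u`, `u ∈ ℝ`, that is built from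
the approximations `G(a, b)` of the integral over a short interval `[a, b]`; for `u < 0`, as usual,
`∫_0^u = -∫_u^0`. -/
structure IsIntegralProcess {Ω : Type*} [MeasurableSpace Ω] (P : Measure Ω) (G : ℝ → ℝ → Ω → ℝ)
    (I : ℝ → Ω → ℝ) : Prop where
  aemeasurable : ∀ u, AEMeasurable (I u) P
  cont : ∀ᵐ ω ∂P, Continuous fun u => I u ω
  of_nonneg : ∀ u, 0 ≤ u → TendstoRiemann P G 0 u (I u)
  of_nonpos : ∀ u, u ≤ 0 → TendstoRiemann P G u 0 fun ω => -I u ω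

/-- `I` is a continuous version of the Wiener–Itô integral process `u ↦ ∫_0^u H_z dW_z`, `u ∈ ℝ`
(non-anticipating Riemann sums; `H` has almost surely continuous paths and is independent of the
Brownian motion `W` whenever this is used). -/
def IsItoIntegral {Ω : Type*} [MeasurableSpace Ω] (P : Measure Ω) (H W : ℝ → Ω → ℝ)
    (I : ℝ → Ω → ℝ) : Prop :=
  IsIntegralProcess P (fun a b ω => H a ω * (W b ω - W a ω)) I

/-- `I` is a continuous version of the Stratonovich integral process `u ↦ ∫_0^u H_z d°W_z`,
`u ∈ ℝ` (symmetric Riemann sums). -/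
def IsStratonovichIntegral {Ω : Type*} [MeasurableSpace Ω] (P : Measure Ω) (H W : ℝ → Ω → ℝ)
    (I : ℝ → Ω → ℝ) : Prop :=
  IsIntegralProcess P (fun a b ω => (H a ω + H b ω) / 2 * (W b ω - W a ω)) I

/-- Convergence of processes in the sense of finite dimensional distributions: for every finite set
`F` of indices, the vector `(U^n_i)_{i ∈ F}` converges in distribution to `(V_i)_{i ∈ F}`. -/
def TendstoFDD {Ω T E : Type*} [MeasurableSpace Ω] (P : Measure Ω) [IsProbabilityMeasure P]
    [TopologicalSpace E] [SecondCountableTopology E] [MeasurableSpace E] [BorelSpace E]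
    (U : ℕ → T → Ω → E) (V : T → Ω → E) : Prop :=
  ∀ F : Finset T, TendstoInDistribution (fun n ω (i : F) => U n i ω) atTop
    (fun ω (i : F) => V i ω) (fun _ => P) P

end IteratedBM

end

namespace IteratedBM

/-- The mesh of the grid `𝒟_n`. -/
noncomputable def mesh (n : ℕ) : ℝ := (2 : ℝ) ^ (-(n : ℝ) / 2)

lemma mesh_pos (n : ℕ) : 0 < mesh n := by unfold mesh; positivity

lemma mesh_mul_self (n : ℕ) : mesh n * mesh n = ((2 : ℝ) ^ n)⁻¹ := by
  unfold mesh
  rw [← Real.rpow_add two_pos, ← Real.rpow_natCast, ← Real.rpow_neg two_pos.le]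
  congr 1; ring

lemma tendsto_mesh : Tendsto mesh atTop (𝓝 0) := by
  have h : Tendsto (fun n : ℕ => ((n : ℝ) / 2)) atTop atTop :=
    tendsto_natCast_atTop_atTop.atTop_div_const two_pos
  have h2 := (tendsto_rpow_neg_atTop' h)
  exact h2
where
  tendsto_rpow_neg_atTop' {u : ℕ → ℝ} (hu : Tendsto u atTop atTop) :
      Tendsto (fun n : ℕ => (2 : ℝ) ^ (-(n : ℝ) / 2)) atTop (𝓝 0) := by
    have : ∀ n : ℕ, (2 : ℝ) ^ (-(n : ℝ) / 2) = ((2 : ℝ) ^ (-(1 : ℝ) / 2)) ^ n := fun n => by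
      rw [← Real.rpow_natCast, ← Real.rpow_mul two_pos.le]; congr 1; ring
    simp_rw [this]
    refine tendsto_pow_atTop_nhds_zero_of_lt_one (by positivity) ?_
    exact Real.rpow_lt_one_of_one_lt_of_neg one_lt_two (by norm_num)

lemma mem_grid {n : ℕ} {x : ℝ} : x ∈ grid n ↔ ∃ j : ℤ, x = j * mesh n :=
  ⟨fun ⟨j, hj⟩ => ⟨j, hj.symm⟩, fun ⟨j, hj⟩ => ⟨j, hj.symm⟩⟩

/-- A continuous unbounded path started at `0`. -/
structure IsExcursive (y : ℝ≥0 → ℝ) : Prop where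
  cont : Continuous y
  zero : y 0 = 0
  unbounded : ∀ C, ∃ s, C < |y s|

lemma IsExcursive.exists_gt {y : ℝ≥0 → ℝ} (hy : IsExcursive y) (a : ℝ≥0) (h : ℝ) :
    ∃ s, a ≤ s ∧ h ≤ |y s - y a| := by
  obtain ⟨C, hC⟩ := (isCompact_Icc (a := (0 : ℝ≥0)) (b := a)).exists_bound_of_continuousOn
    hy.cont.continuousOn
  obtain ⟨s, hs⟩ := hy.unbounded (max C (|y a| + h))
  refine ⟨s, ?_, ?_⟩
  · by_contra hlt
    have := hC s ⟨zero_le, (not_le.1 hlt).le⟩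
    rw [Real.norm_eq_abs] at this
    exact absurd (lt_of_le_of_lt (le_max_left _ _) hs) (not_lt.2 this)
  · have h1 := lt_of_le_of_lt (le_max_right _ _) hs
    have h2 := abs_sub_abs_le_abs_sub (y s) (y a)
    linarith

/-- The first exit time from a grid cell is attained. -/
lemma IsExcursive.exists_exit {y : ℝ≥0 → ℝ} (hy : IsExcursive y) (n : ℕ) (a : ℝ≥0) (i : ℤ)
    (ha : y a = i * mesh n) :
    ∃ τ, IsLeast {s | a < s ∧ y s ∈ grid n \ {y a}} τ ∧ |y τ - y a| = mesh n ∧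
      ∀ s, a ≤ s → mesh n ≤ |y s - y a| → τ ≤ s := by
  set h := mesh n
  have hh : 0 < h := mesh_pos n
  set S : Set ℝ≥0 := {s | a ≤ s ∧ h ≤ |y s - y a|}
  have hScl : IsClosed S :=
    (isClosed_Ici (a := a)).inter
      (isClosed_le continuous_const ((hy.cont.sub continuous_const).abs))
  have hSne : S.Nonempty := hy.exists_gt a h
  have hbd : BddBelow S := ⟨0, fun _ _ => zero_le⟩
  set τ := sInf S
  have hτ : τ ∈ S := hScl.csInf_mem hSne hbd
  have hlt : ∀ s, a ≤ s → s < τ → |y s - y a| < h := fun s h1 h2 => by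
    by_contra h3
    exact absurd (csInf_le hbd ⟨h1, not_lt.1 h3⟩) (not_le.2 h2)
  have haτ : a < τ := by
    refine lt_of_le_of_ne hτ.1 fun e => ?_
    have := hτ.2
    rw [← e] at this; simp at this; linarith
  have hle : |y τ - y a| ≤ h := by
    have : (𝓝[<] τ).NeBot := nhdsLT_neBot_of_exists_lt ⟨a, haτ⟩
    refine le_of_tendsto (f := fun s => |y s - y a|) (x := 𝓝[<] τ)
      (((hy.cont.sub continuous_const).abs.tendsto τ).mono_left nhdsWithin_le_nhds) ?_
    filter_upwards [Ioo_mem_nhdsLT haτ] with s hs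
    exact (hlt s hs.1.le hs.2).le
  have heq : |y τ - y a| = h := le_antisymm hle hτ.2
  refine ⟨τ, ⟨⟨haτ, ?_, ?_⟩, ?_⟩, heq, fun s h1 h2 => csInf_le hbd ⟨h1, h2⟩⟩
  · rw [mem_grid]
    rcases abs_eq hh.le |>.1 heq with e | e
    · refine ⟨i + 1, ?_⟩; push_cast; linarith
    · refine ⟨i - 1, ?_⟩; push_cast; linarith
  · intro e
    rw [Set.mem_singleton_iff] at e
    rw [e] at heq; simp at heq; linarith
  · rintro s ⟨hs1, hs2, hs3⟩
    refine csInf_le hbd ⟨hs1.le, ?_⟩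
    obtain ⟨j, hj⟩ := mem_grid.1 hs2
    rw [Set.mem_singleton_iff] at hs3
    have hne : j - i ≠ 0 := by
      intro e
      apply hs3
      rw [hj, ha, sub_eq_zero.1 e]
    have h1 : (1 : ℝ) ≤ |((j - i : ℤ) : ℝ)| := by
      exact_mod_cast Int.one_le_abs hne
    rw [hj, ha, ← sub_mul, abs_mul, abs_of_pos (mesh_pos n)]
    push_cast at h1
    nlinarith

section Path

variable {Ω : Type*} {Y : ℝ≥0 → Ω → ℝ} {ω : Ω}

/-- The position, in units of the mesh, of `Y` at the time `T_{k,n}`. -/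
noncomputable def skeletonPos (Y : ℝ≥0 → Ω → ℝ) (n k : ℕ) (ω : Ω) : ℤ :=
  round (Y (skeletonTime Y n k ω) ω / mesh n)

lemma skeleton_spec (hy : IsExcursive fun t => Y t ω) (n k : ℕ) :
    Y (skeletonTime Y n k ω) ω = skeletonPos Y n k ω * mesh n ∧
    skeletonTime Y n k ω < skeletonTime Y n (k + 1) ω ∧
    |Y (skeletonTime Y n (k + 1) ω) ω - Y (skeletonTime Y n k ω) ω| = mesh n ∧
    ∀ s, skeletonTime Y n k ω ≤ s → mesh n ≤ |Y s ω - Y (skeletonTime Y n k ω) ω| →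
      skeletonTime Y n (k + 1) ω ≤ s := by
  have hh := mesh_pos n
  have key : ∀ k, (∃ i : ℤ, Y (skeletonTime Y n k ω) ω = i * mesh n) →
      skeletonTime Y n k ω < skeletonTime Y n (k + 1) ω ∧
      |Y (skeletonTime Y n (k + 1) ω) ω - Y (skeletonTime Y n k ω) ω| = mesh n ∧
      (∀ s, skeletonTime Y n k ω ≤ s → mesh n ≤ |Y s ω - Y (skeletonTime Y n k ω) ω| →
        skeletonTime Y n (k + 1) ω ≤ s) ∧
      ∃ i : ℤ, Y (skeletonTime Y n (k + 1) ω) ω = i * mesh n := by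
    rintro k ⟨i, hi⟩
    obtain ⟨τ, h1, h2, h3⟩ := hy.exists_exit n _ i hi
    have e : skeletonTime Y n (k + 1) ω = τ := h1.csInf_eq
    rw [e]
    exact ⟨h1.1.1, h2, h3, mem_grid.1 h1.1.2.1⟩
  have hgrid : ∀ k, ∃ i : ℤ, Y (skeletonTime Y n k ω) ω = i * mesh n := by
    intro k
    induction k with
    | zero => exact ⟨0, by simpa [skeletonTime] using hy.zero⟩
    | succ k ih => exact (key k ih).2.2.2
  obtain ⟨a, b, c, -⟩ := key k (hgrid k)
  refine ⟨?_, a, b, c⟩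
  obtain ⟨i, hi⟩ := hgrid k
  rw [skeletonPos, hi, mul_div_assoc, div_self hh.ne', mul_one, round_intCast]

lemma skeletonPos_zero (hy : IsExcursive fun t => Y t ω) (n : ℕ) : skeletonPos Y n 0 ω = 0 := by
  have h0 : Y 0 ω = 0 := hy.zero
  simp [skeletonPos, skeletonTime, h0]

lemma abs_skeletonPos_succ_sub (hy : IsExcursive fun t => Y t ω) (n k : ℕ) :
    |skeletonPos Y n (k + 1) ω - skeletonPos Y n k ω| = 1 := by
  have h1 := (skeleton_spec hy n k).1
  have h2 := (skeleton_spec hy n (k + 1)).1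
  have h3 := (skeleton_spec hy n k).2.2.1
  rw [h1, h2, ← sub_mul, abs_mul, abs_of_pos (mesh_pos n)] at h3
  have h4 := mul_right_cancel₀ (mesh_pos n).ne' (h3.trans (one_mul _).symm)
  exact_mod_cast h4

/-- `T_{k+1} ≤ t` iff `Y` has moved by a mesh after `T_k` and before `t`. -/
lemma skeletonTime_succ_le_iff (hy : IsExcursive fun t => Y t ω) (n k : ℕ) (t : ℝ≥0) :
    skeletonTime Y n (k + 1) ω ≤ t ↔
      ∃ s ≤ t, mesh n ≤ |Y s ω - Y (min (skeletonTime Y n k ω) s) ω| := by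
  obtain ⟨-, h1, h2, h3⟩ := skeleton_spec hy n k
  constructor
  · intro h
    exact ⟨_, h, by rw [min_eq_left h1.le, h2]⟩
  · rintro ⟨s, hs, h⟩
    have hle : skeletonTime Y n k ω ≤ s := by
      by_contra hlt
      rw [min_eq_right (not_le.1 hlt).le] at h
      simp at h; linarith [mesh_pos n]
    rw [min_eq_left hle] at h
    exact (h3 s hle h).trans hs

end Path

/-- The (unnormalised) weighted signed power variation along the grid values `x 0, x 1, …`. -/
def gridSum (κ : ℕ) (f : ℝ → ℝ) (x : ℕ → ℝ) (N : ℕ) : ℝ :=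
  ∑ l ∈ Finset.range N, f (x (2 * l + 1)) *
    ((x (2 * l + 2) - x (2 * l + 1)) ^ κ + (-1) ^ (κ + 1) * (x (2 * l + 1) - x (2 * l)) ^ κ)

lemma gridSum_succ (κ : ℕ) (f : ℝ → ℝ) (x : ℕ → ℝ) (N : ℕ) :
    gridSum κ f x (N + 1) = gridSum κ f x N + f (x (2 * N + 1)) *
    ((x (2 * N + 2) - x (2 * N + 1)) ^ κ + (-1) ^ (κ + 1) * (x (2 * N + 1) - x (2 * N)) ^ κ) :=
  Finset.sum_range_succ _ _

/-- The signed sum along a nearest neighbour path telescopes. -/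
lemma sum_walk_eq_gridSum (κ : ℕ) (f : ℝ → ℝ) (x : ℤ → ℝ) (p : ℕ → ℤ) (hp0 : p 0 = 0)
    (hp : ∀ k, |p (k + 1) - p k| = 1) (K : ℕ) :
    2 ∣ p (2 * K) ∧
    ∑ k ∈ Finset.range K, f (x (p (2 * k + 1))) *
      ((x (p (2 * k + 2)) - x (p (2 * k + 1))) ^ κ
        + (-1) ^ (κ + 1) * (x (p (2 * k + 1)) - x (p (2 * k))) ^ κ) =
    gridSum κ f (fun j => x j) (p (2 * K) / 2).toNat +
      gridSum κ f (fun j => x (-j)) (-(p (2 * K) / 2)).toNat := by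
  set g : ℤ → ℝ := fun m => f (x (2 * m + 1)) *
    ((x (2 * m + 2) - x (2 * m + 1)) ^ κ + (-1) ^ (κ + 1) * (x (2 * m + 1) - x (2 * m)) ^ κ)
  set W : ℤ → ℝ := fun m => gridSum κ f (fun j => x j) m.toNat +
      gridSum κ f (fun j => x (-j)) (-m).toNat
  have hs : ((-1 : ℝ) ^ κ) * (-1) ^ κ = 1 := by rw [← mul_pow]; simp
  have hW : ∀ m, W (m + 1) - W m = g m := by
    intro m
    rcases le_or_gt 0 m with hm | hm
    · lift m to ℕ using hm
      simp only [W, g]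
      have e1 : ((m : ℤ) + 1).toNat = m + 1 := by omega
      have e2 : (-((m : ℤ) + 1)).toNat = 0 := by omega
      have e3 : (-(m : ℤ)).toNat = 0 := by omega
      rw [e1, e2, e3, Int.toNat_natCast, gridSum_succ]
      push_cast
      ring
    · obtain ⟨l, rfl⟩ : ∃ l : ℕ, m = -((l : ℤ) + 1) := ⟨(-m - 1).toNat, by omega⟩
      simp only [W, g]
      have e1 : (-((l : ℤ) + 1) + 1).toNat = 0 := by omega
      have e2 : (-(-((l : ℤ) + 1) + 1)).toNat = l := by omega
      have e3 : (-((l : ℤ) + 1)).toNat = 0 := by omega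
      have e4 : (-(-((l : ℤ) + 1))).toNat = l + 1 := by omega
      rw [e1, e2, e3, e4]
      have : gridSum κ f (fun j => x (-j)) (l + 1) = gridSum κ f (fun j => x (-j)) l +
          f (x (-((2 * l + 1 : ℕ) : ℤ))) * ((x (-((2 * l + 2 : ℕ) : ℤ)) - x (-((2 * l + 1 : ℕ) : ℤ))) ^ κ
          + (-1) ^ (κ + 1) * (x (-((2 * l + 1 : ℕ) : ℤ)) - x (-((2 * l : ℕ) : ℤ))) ^ κ) := gridSum_succ _ _ _ _
      rw [this]
      have a1 : 2 * -((l : ℤ) + 1) + 1 = -((2 * l + 1 : ℕ) : ℤ) := by push_cast; ring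
      have a2 : 2 * -((l : ℤ) + 1) + 2 = -((2 * l : ℕ) : ℤ) := by push_cast; ring
      have a3 : 2 * -((l : ℤ) + 1) = -((2 * l + 2 : ℕ) : ℤ) := by push_cast; ring
      rw [a1, a2, a3]
      set a := x (-((2 * l + 1 : ℕ) : ℤ))
      set b := x (-((2 * l + 2 : ℕ) : ℤ))
      set c := x (-((2 * l : ℕ) : ℤ))
      have f1 : (a - c) ^ κ = (-1) ^ κ * (c - a) ^ κ := by rw [← mul_pow]; ring
      have f2 : (a - b) ^ κ = (-1) ^ κ * (b - a) ^ κ := by rw [← mul_pow]; ring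
      rw [f1, f2, pow_succ]
      linear_combination (f a * ((c - a) ^ κ + (b - a) ^ κ)) * hs
  have hgoal : ∀ K, 2 ∣ p (2 * K) ∧ ∑ k ∈ Finset.range K, f (x (p (2 * k + 1))) *
      ((x (p (2 * k + 2)) - x (p (2 * k + 1))) ^ κ
        + (-1) ^ (κ + 1) * (x (p (2 * k + 1)) - x (p (2 * k))) ^ κ) = W (p (2 * K) / 2) := by
    intro K
    induction K with
    | zero => simp [hp0, W, gridSum]
    | succ K ih =>
      obtain ⟨⟨m, hm⟩, ih⟩ := ih
      rw [Finset.sum_range_succ, ih]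
      have h1 := hp (2 * K)
      have h2 := hp (2 * K + 1)
      have e0 : p (2 * K) / 2 = m := by omega
      rw [e0]
      rw [show 2 * (K + 1) = 2 * K + 1 + 1 by ring, show 2 * K + 2 = 2 * K + 1 + 1 by ring]
      rw [abs_eq zero_le_one] at h1 h2
      rcases h1 with h1 | h1 <;> rcases h2 with h2 | h2
      · have q1 : p (2 * K + 1) = 2 * m + 1 := by omega
        have q2 : p (2 * K + 1 + 1) = 2 * m + 2 := by omega
        refine ⟨⟨m + 1, by omega⟩, ?_⟩
        have : (p (2 * K + 1 + 1)) / 2 = m + 1 := by omega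
        rw [this, q1, q2, hm]
        linarith [hW m]
      · have q1 : p (2 * K + 1) = 2 * m + 1 := by omega
        have q2 : p (2 * K + 1 + 1) = 2 * m := by omega
        refine ⟨⟨m, by omega⟩, ?_⟩
        have : (p (2 * K + 1 + 1)) / 2 = m := by omega
        rw [this, q1, q2, hm]
        have f1 : (x (2 * m) - x (2 * m + 1)) ^ κ = (-1) ^ κ * (x (2 * m + 1) - x (2 * m)) ^ κ := by
          rw [← mul_pow]; ring
        rw [f1, pow_succ]; ring
      · have q1 : p (2 * K + 1) = 2 * m - 1 := by omega
        have q2 : p (2 * K + 1 + 1) = 2 * m := by omega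
        refine ⟨⟨m, by omega⟩, ?_⟩
        have : (p (2 * K + 1 + 1)) / 2 = m := by omega
        rw [this, q1, q2, hm]
        have f1 : (x (2 * m) - x (2 * m - 1)) ^ κ = (-1) ^ κ * (x (2 * m - 1) - x (2 * m)) ^ κ := by
          rw [← mul_pow]; ring
        rw [f1, pow_succ]; ring
      · have q1 : p (2 * K + 1) = 2 * (m - 1) + 1 := by omega
        have q2 : p (2 * K + 1 + 1) = 2 * (m - 1) := by omega
        refine ⟨⟨m - 1, by omega⟩, ?_⟩
        have : (p (2 * K + 1 + 1)) / 2 = m - 1 := by omega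
        rw [this, q1, q2, hm]
        have q3 := hW (m - 1)
        simp only [sub_add_cancel, g] at q3
        have q4 : 2 * (m - 1) + 2 = 2 * m := by ring
        rw [q4] at q3
        rw [eq_comm, ← sub_eq_iff_eq_add']
        have f2 : (x (2 * (m - 1) + 1) - x (2 * (m - 1))) ^ κ
          = (-1) ^ κ * (x (2 * (m - 1)) - x (2 * (m - 1) + 1)) ^ κ := by
          rw [← mul_pow]; ring
        have f3 : (x (2 * m) - x (2 * (m - 1) + 1)) ^ κ
          = (-1) ^ κ * (x (2 * (m - 1) + 1) - x (2 * m)) ^ κ := by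
          rw [← mul_pow]; ring
        rw [f2, f3, pow_succ] at q3
        rw [pow_succ]
        linear_combination (-1 : ℝ) * q3 + (f (x (2 * (m - 1) + 1)) *
          (x (2 * (m - 1)) - x (2 * (m - 1) + 1)) ^ κ) * hs
  exact hgoal K

lemma signedVariation_eq {Ω : Type*} (X : ℝ → Ω → ℝ) {Y : ℝ≥0 → Ω → ℝ} {ω : Ω}
    (hy : IsExcursive fun t => Y t ω) (κ : ℕ) (f : ℝ → ℝ) (n : ℕ) (t : ℝ≥0) :
    2 ∣ skeletonPos Y n (2 * (⌊((2 : ℝ) ^ n * (t : ℝ) - 1) / 2⌋ + 1).toNat) ω ∧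
    signedVariation X Y κ f n t ω =
      gridSum κ f (fun j => X (j * mesh n) ω)
        (skeletonPos Y n (2 * (⌊((2 : ℝ) ^ n * (t : ℝ) - 1) / 2⌋ + 1).toNat) ω / 2).toNat +
      gridSum κ f (fun j => X (-(j * mesh n)) ω)
        (-(skeletonPos Y n (2 * (⌊((2 : ℝ) ^ n * (t : ℝ) - 1) / 2⌋ + 1).toNat) ω / 2)).toNat := by
  have key := sum_walk_eq_gridSum κ f (fun j : ℤ => X (j * mesh n) ω)
    (fun k => skeletonPos Y n k ω) (skeletonPos_zero hy n) (abs_skeletonPos_succ_sub hy n)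
    (⌊((2 : ℝ) ^ n * (t : ℝ) - 1) / 2⌋ + 1).toNat
  refine ⟨key.1, ?_⟩
  have e : ∀ k, X (skeletonPos Y n k ω * mesh n) ω = ibm X Y (skeletonTime Y n k ω) ω := fun k => by
    rw [ibm, (skeleton_spec hy n k).1]
  have key2 := key.2
  simp only [e, Int.cast_neg, Int.cast_natCast, neg_mul] at key2
  rw [← key2]
  rfl

end IteratedBM
namespace IteratedBM

section CharFun

lemma norm_exp_I_sub_taylor_le (x : ℝ) :
    ‖Complex.exp (x * Complex.I) - (1 + x * Complex.I - x ^ 2 / 2)‖ ≤ 4 * |x| ^ 3 := by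
  rcases le_or_gt |x| 1 with hx | hx
  · have hn : ‖(x * Complex.I : ℂ)‖ = |x| := by simp
    have h := Complex.exp_bound (x := x * Complex.I) (by rw [hn]; exact hx) (n := 3) (by norm_num)
    rw [hn] at h
    have e : ∑ m ∈ Finset.range 3, (x * Complex.I : ℂ) ^ m / (m.factorial : ℂ)
        = 1 + x * Complex.I - x ^ 2 / 2 := by
      simp [Finset.sum_range_succ, mul_pow, Nat.factorial]; ring
    rw [e] at h
    refine h.trans ?_
    norm_num [Nat.factorial]
    nlinarith [pow_nonneg (abs_nonneg x) 3]
  · have h1 : ‖Complex.exp (x * Complex.I)‖ = 1 := Complex.norm_exp_ofReal_mul_I x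
    have h2 : ‖(1 + x * Complex.I - x ^ 2 / 2 : ℂ)‖ ≤ 1 + |x| + |x| ^ 2 / 2 := by
      refine (norm_sub_le _ _).trans ?_
      refine add_le_add ((norm_add_le _ _).trans (by simp)) ?_
      simp
    refine (norm_sub_le _ _).trans ?_
    rw [h1]
    have h3 : |x| ≤ |x| ^ 3 := by nlinarith [abs_nonneg x, mul_pos (by linarith : 0 < |x|) (by linarith : 0 < |x|)]
    have h4 : |x| ^ 2 ≤ |x| ^ 3 := by nlinarith [abs_nonneg x, sq_nonneg |x|]
    linarith [one_le_pow₀ hx.le (n := 3)]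

lemma norm_prod_sub_prod_le {ι : Type*} (S : Finset ι) (a b : ι → ℂ) (ha : ∀ i ∈ S, ‖a i‖ ≤ 1)
    (hb : ∀ i ∈ S, ‖b i‖ ≤ 1) :
    ‖∏ i ∈ S, a i - ∏ i ∈ S, b i‖ ≤ ∑ i ∈ S, ‖a i - b i‖ := by
  classical
  induction S using Finset.induction_on with
  | empty => simp
  | insert j S hj ih =>
    rw [Finset.prod_insert hj, Finset.prod_insert hj, Finset.sum_insert hj]
    have ih' := ih (fun i hi => ha i (Finset.mem_insert_of_mem hi))
      (fun i hi => hb i (Finset.mem_insert_of_mem hi))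
    have hA : ‖∏ i ∈ S, a i‖ ≤ 1 := by
      rw [norm_prod]
      exact Finset.prod_le_one (fun _ _ => norm_nonneg _)
        (fun i hi => ha i (Finset.mem_insert_of_mem hi))
    calc ‖a j * ∏ i ∈ S, a i - b j * ∏ i ∈ S, b i‖
        = ‖(a j - b j) * ∏ i ∈ S, a i + b j * (∏ i ∈ S, a i - ∏ i ∈ S, b i)‖ := by ring_nf
      _ ≤ ‖a j - b j‖ * ‖∏ i ∈ S, a i‖ + ‖b j‖ * ‖∏ i ∈ S, a i - ∏ i ∈ S, b i‖ := by
          refine (norm_add_le _ _).trans ?_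
          rw [norm_mul, norm_mul]
      _ ≤ ‖a j - b j‖ * 1 + 1 * ∑ i ∈ S, ‖a i - b i‖ := by
          gcongr
          exact hb j (Finset.mem_insert_self _ _)
      _ = _ := by ring

lemma abs_exp_neg_sub_le {v : ℝ} (hv : 0 ≤ v) : |Real.exp (-(v / 2)) - (1 - v / 2)| ≤ v ^ 2 := by
  have h1 := Real.add_one_le_exp (-(v / 2))
  rw [abs_of_nonneg (by linarith)]
  rcases le_or_gt v 1 with h | h
  · have h2 := Real.exp_bound (x := -(v / 2)) (by rw [abs_neg, abs_of_nonneg (by linarith)]; linarith)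
      (n := 2) (by norm_num)
    rw [abs_neg, abs_of_nonneg (by linarith : 0 ≤ v / 2)] at h2
    have h3 := (le_abs_self _).trans h2
    norm_num [Finset.sum_range_succ, Nat.factorial] at h3
    nlinarith
  · have h2 : Real.exp (-(v / 2)) ≤ 1 := Real.exp_le_one_iff.2 (by linarith)
    nlinarith

lemma norm_prod_sub_exp_le {ι : Type*} (S : Finset ι) (a : ι → ℂ) (v r : ι → ℝ)
    (hv : ∀ i ∈ S, 0 ≤ v i) (ha : ∀ i ∈ S, ‖a i‖ ≤ 1) (har : ∀ i ∈ S, ‖a i - (1 - v i / 2)‖ ≤ r i) :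
    ‖∏ i ∈ S, a i - Complex.exp (-((∑ i ∈ S, v i : ℝ) / 2 : ℂ))‖ ≤ ∑ i ∈ S, (r i + v i ^ 2) := by
  have e : Complex.exp (-((∑ i ∈ S, v i : ℝ) / 2 : ℂ)) =
      ∏ i ∈ S, ((Real.exp (-(v i / 2)) : ℝ) : ℂ) := by
    rw [← Complex.ofReal_prod, ← Real.exp_sum, Finset.sum_neg_distrib, ← Finset.sum_div]
    push_cast
    rfl
  rw [e]
  refine (norm_prod_sub_prod_le S a _ ha fun i hi => ?_).trans (Finset.sum_le_sum fun i hi => ?_)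
  · rw [Complex.norm_real, Real.norm_eq_abs, abs_of_pos (Real.exp_pos _)]
    exact Real.exp_le_one_iff.2 (by linarith [hv i hi])
  · have h1 := har i hi
    have h2 := abs_exp_neg_sub_le (hv i hi)
    calc ‖a i - ((Real.exp (-(v i / 2)) : ℝ) : ℂ)‖
        = ‖(a i - (1 - v i / 2)) - ((Real.exp (-(v i / 2)) - (1 - v i / 2) : ℝ) : ℂ)‖ := by
          push_cast; ring_nf
      _ ≤ r i + v i ^ 2 := by
          refine (norm_sub_le _ _).trans (add_le_add h1 ?_)
          rwa [Complex.norm_real]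

variable {Ω : Type*} [MeasurableSpace Ω] {P : Measure Ω} [IsProbabilityMeasure P]

lemma norm_integral_exp_I_sub_le {Y : Ω → ℝ} (h3 : MemLp Y 3 P) (h0 : ∫ ω, Y ω ∂P = 0) :
    ‖∫ ω, Complex.exp (Y ω * Complex.I) ∂P - (1 - (∫ ω, Y ω ^ 2 ∂P : ℝ) / 2)‖ ≤
      4 * ∫ ω, |Y ω| ^ 3 ∂P := by
  have i1 : Integrable Y P := h3.integrable (by norm_num)
  have i2 : Integrable (fun ω => Y ω ^ 2) P :=
    (h3.mono_exponent (p := 2) (by norm_num)).integrable_sq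
  have i3 : Integrable (fun ω => |Y ω| ^ 3) P := by
    simpa using h3.integrable_norm_pow (p := 3) (by norm_num)
  have i1c : Integrable (fun ω => (Y ω : ℂ)) P := i1.ofReal
  have i2c : Integrable (fun ω => (Y ω : ℂ) ^ 2) P := by
    have := i2.ofReal (𝕜 := ℂ)
    simpa using this
  have ie : Integrable (fun ω => Complex.exp (Y ω * Complex.I)) P := by
    refine Integrable.of_bound (C := 1) ?_ (ae_of_all _ fun ω => ?_)
    · have := i1.1
      exact Complex.continuous_exp.comp_aestronglyMeasurable
        ((Complex.continuous_ofReal.comp_aestronglyMeasurable this).mul_const _)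
    · rw [Complex.norm_exp_ofReal_mul_I]
  have j1 : Integrable (fun ω => 1 + (Y ω : ℂ) * Complex.I) P :=
    (integrable_const _).add (i1c.mul_const _)
  have j2 : Integrable (fun ω => (Y ω : ℂ) ^ 2 / 2) P := i2c.div_const _
  have j3 : Integrable (fun ω => 1 + (Y ω : ℂ) * Complex.I - (Y ω : ℂ) ^ 2 / 2) P := j1.sub j2
  have ei : ∫ ω, (1 + Y ω * Complex.I - Y ω ^ 2 / 2 : ℂ) ∂P = 1 - (∫ ω, Y ω ^ 2 ∂P : ℝ) / 2 := by
    rw [integral_sub j1 j2,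
      integral_add (integrable_const _) (i1c.mul_const _), integral_mul_const, integral_div]
    have e1 : ∫ ω, (Y ω : ℂ) ∂P = 0 := by rw [integral_complex_ofReal, h0]; simp
    have e2 : ∫ ω, (Y ω : ℂ) ^ 2 ∂P = (∫ ω, Y ω ^ 2 ∂P : ℝ) := by
      rw [← integral_complex_ofReal]; simp
    rw [e1, e2]; simp
  rw [← ei, ← integral_sub ie j3,
    ← integral_const_mul]
  exact norm_integral_le_of_norm_le (i3.const_mul 4)
    (ae_of_all _ fun ω => norm_exp_I_sub_taylor_le _)

/-- Quantitative Lyapunov estimate for characteristic functions of sums of independent centred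
random variables. -/
theorem norm_integral_exp_sum_sub_le {ι : Type*} (S : Finset ι) {Y : ι → Ω → ℝ}
    (hind : iIndepFun Y P) (h3 : ∀ i, MemLp (Y i) 3 P) (h0 : ∀ i, ∫ ω, Y i ω ∂P = 0) :
    ‖∫ ω, Complex.exp ((∑ i ∈ S, Y i ω : ℝ) * Complex.I) ∂P -
        Complex.exp (-((∑ i ∈ S, ∫ ω, Y i ω ^ 2 ∂P : ℝ) / 2 : ℂ))‖ ≤
      ∑ i ∈ S, (4 * ∫ ω, |Y i ω| ^ 3 ∂P + (∫ ω, Y i ω ^ 2 ∂P) ^ 2) := by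
  have hmul : ∫ ω, Complex.exp ((∑ i ∈ S, Y i ω : ℝ) * Complex.I) ∂P =
      ∏ i ∈ S, ∫ ω, Complex.exp (Y i ω * Complex.I) ∂P := by
    have h := (hind.precomp (g := ((↑) : S → ι)) Subtype.val_injective).integral_fun_prod_comp
      (f := fun _ (x : ℝ) => Complex.exp (x * Complex.I))
      (fun i => (h3 i).1.aemeasurable)
      (fun i => (Measurable.aestronglyMeasurable (by fun_prop)))
    rw [Finset.prod_coe_sort S (fun i => ∫ ω, Complex.exp (Y i ω * Complex.I) ∂P)] at h
    rw [← h]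
    congr 1
    ext ω
    rw [Finset.prod_coe_sort S (fun i => Complex.exp (Y i ω * Complex.I)), ← Complex.exp_sum,
      ← Finset.sum_mul]
    push_cast
    rfl
  rw [hmul]
  refine norm_prod_sub_exp_le S _ _ _ (fun i _ => integral_nonneg fun ω => sq_nonneg _)
    (fun i _ => ?_) fun i _ => norm_integral_exp_I_sub_le (h3 i) (h0 i)
  refine (norm_integral_le_of_norm_le (integrable_const (1 : ℝ)) (ae_of_all _ fun ω => ?_)).trans
    (by simp)
  rw [Complex.norm_exp_ofReal_mul_I]

lemma charFun_map_toLp {ι Ω₁ : Type*} [Fintype ι] [MeasurableSpace Ω₁] {μ : Measure Ω₁}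
    {W : Ω₁ → ι → ℝ} (t : EuclideanSpace ℝ ι) (hW : AEMeasurable W μ) :
    charFun (μ.map fun ω => (WithLp.toLp 2 (W ω) : EuclideanSpace ℝ ι)) t =
      ∫ ω, Complex.exp ((∑ i, t i * W ω i : ℝ) * Complex.I) ∂μ := by
  have hm : Measurable (WithLp.toLp 2 : (ι → ℝ) → EuclideanSpace ℝ ι) := by fun_prop
  have hm' : AEMeasurable (fun ω => (WithLp.toLp 2 (W ω) : EuclideanSpace ℝ ι)) μ :=
    hm.comp_aemeasurable hW
  have hs : AEStronglyMeasurable (fun x : EuclideanSpace ℝ ι =>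
      Complex.exp ((inner ℝ x t : ℝ) * Complex.I))
      (μ.map fun ω => (WithLp.toLp 2 (W ω) : EuclideanSpace ℝ ι)) :=
    Measurable.aestronglyMeasurable (by fun_prop)
  rw [charFun_apply, integral_map hm' hs]
  rfl

/-- Lévy's theorem for random vectors indexed by a finite type. -/
theorem tendstoInDistribution_pi_of_charFun {ι : Type*} [Fintype ι] {Ω' : ℕ → Type*}
    {Ω'' : Type*} [∀ n, MeasurableSpace (Ω' n)] [MeasurableSpace Ω''] {μ : ∀ n, Measure (Ω' n)}
    {ν : Measure Ω''}
    [∀ n, IsProbabilityMeasure (μ n)] [IsProbabilityMeasure ν]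
    {U : ∀ n, Ω' n → ι → ℝ} {V : Ω'' → ι → ℝ} (hU : ∀ n, AEMeasurable (U n) (μ n))
    (hV : AEMeasurable V ν)
    (h : ∀ a : ι → ℝ, Tendsto
      (fun n => ∫ ω, Complex.exp ((∑ i, a i * U n ω i : ℝ) * Complex.I) ∂(μ n)) atTop
      (𝓝 (∫ ω, Complex.exp ((∑ i, a i * V ω i : ℝ) * Complex.I) ∂ν))) :
    TendstoInDistribution U atTop V μ ν := by
  have hm : Measurable (WithLp.toLp 2 : (ι → ℝ) → EuclideanSpace ℝ ι) := by fun_prop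
  have key : TendstoInDistribution (fun n ω => (WithLp.toLp 2 (U n ω) : EuclideanSpace ℝ ι)) atTop
      (fun ω => WithLp.toLp 2 (V ω)) μ ν := by
    refine ⟨fun n => hm.comp_aemeasurable (hU n), hm.comp_aemeasurable hV, ?_⟩
    refine ProbabilityMeasure.tendsto_of_tendsto_charFun fun t => ?_
    have h1 := h t
    rw [← charFun_map_toLp _ hV] at h1
    refine h1.congr fun n => ?_
    rw [← charFun_map_toLp _ (hU n)]
    rfl
  have := key.continuous_comp (g := fun x : EuclideanSpace ℝ ι => WithLp.ofLp x)
    (PiLp.continuous_ofLp 2 _)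
  exact this

end CharFun

section Transform

variable {Ω : Type*} [m : MeasurableSpace Ω] {P : Measure Ω}

/-- `A k` is known at time `k`, and `Q k` is a centred innovation, known at time `k + 1` and
independent of the information `G k` available at time `k`. -/
structure IsInnovation (P : Measure Ω) (G : ℕ → MeasurableSpace Ω) (A Q : ℕ → Ω → ℝ) : Prop where
  mono : Monotone G
  le : ∀ k, G k ≤ m
  measA : ∀ k, Measurable[G k] (A k)
  measQ : ∀ k, Measurable[G (k + 1)] (Q k)
  indep : ∀ k, Indep (MeasurableSpace.comap (Q k) inferInstance) (G k) P
  memA : ∀ k, MemLp (A k) 2 P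
  memQ : ∀ k, MemLp (Q k) 2 P
  mean : ∀ k, ∫ ω, Q k ω ∂P = 0

namespace IsInnovation

variable {G : ℕ → MeasurableSpace Ω} {A Q : ℕ → Ω → ℝ}

lemma indepFun (h : IsInnovation P G A Q) {k : ℕ} {U : Ω → ℝ} (hU : Measurable[G k] U) :
    IndepFun U (Q k) P := by
  rw [IndepFun_iff_Indep]
  exact (indep_of_indep_of_le_right (h.indep k) (measurable_iff_comap_le.1 hU)).symm

lemma measurable_sum (h : IsInnovation P G A Q) (N : ℕ) :
    Measurable[G N] (fun ω => ∑ k ∈ Finset.range N, A k ω * Q k ω) := by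
  refine Finset.measurable_sum _ fun k hk => ?_
  have hk := Finset.mem_range.1 hk
  exact ((h.measA k).mono (h.mono hk.le) le_rfl).mul ((h.measQ k).mono (h.mono hk) le_rfl)

lemma memLp_mul (h : IsInnovation P G A Q) (k : ℕ) {U : Ω → ℝ} (hU : Measurable[G k] U)
    (hU2 : MemLp U 2 P) : MemLp (fun ω => U ω * Q k ω) 2 P := by
  have hi := h.indepFun hU
  refine (memLp_two_iff_integrable_sq (hU2.1.mul (h.memQ k).1)).2 ?_
  have := (hi.comp (measurable_id.pow_const 2) (measurable_id.pow_const 2)).integrable_mul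
    hU2.integrable_sq (h.memQ k).integrable_sq
  refine this.congr (ae_of_all _ fun ω => ?_)
  simp [mul_pow]

lemma memLp_sum (h : IsInnovation P G A Q) (N : ℕ) :
    MemLp (fun ω => ∑ k ∈ Finset.range N, A k ω * Q k ω) 2 P :=
  memLp_finsetSum _ fun k _ => h.memLp_mul k (h.measA k) (h.memA k)

lemma integral_mul_sq (h : IsInnovation P G A Q) (k : ℕ) {U : Ω → ℝ} (hU : Measurable[G k] U)
    (hU2 : MemLp U 2 P) :
    ∫ ω, (U ω * Q k ω) ^ 2 ∂P = (∫ ω, U ω ^ 2 ∂P) * ∫ ω, Q k ω ^ 2 ∂P := by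
  have := ((h.indepFun hU).comp (measurable_id.pow_const 2)
    (measurable_id.pow_const 2)).integral_fun_mul_eq_mul_integral
    hU2.integrable_sq.1 (h.memQ k).integrable_sq.1
  simpa [mul_pow] using this

lemma integral_mul_eq_zero (h : IsInnovation P G A Q) (k : ℕ) {U : Ω → ℝ} (hU : Measurable[G k] U) :
    ∫ ω, U ω * Q k ω ∂P = 0 := by
  rw [(h.indepFun hU).integral_fun_mul_eq_mul_integral
    (hU.mono (h.le k) le_rfl).aestronglyMeasurable (h.memQ k).1, h.mean, mul_zero]

/-- Orthogonality of the terms of a martingale transform. -/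
theorem integral_sq_sum (h : IsInnovation P G A Q) (N : ℕ) :
    ∫ ω, (∑ k ∈ Finset.range N, A k ω * Q k ω) ^ 2 ∂P =
      ∑ k ∈ Finset.range N, (∫ ω, A k ω ^ 2 ∂P) * ∫ ω, Q k ω ^ 2 ∂P := by
  induction N with
  | zero => simp
  | succ N ih =>
    simp_rw [Finset.sum_range_succ, add_sq]
    have hM := h.memLp_sum N
    have hAQ := h.memLp_mul N (h.measA N) (h.memA N)
    have hx : ∀ ω, 2 * (∑ k ∈ Finset.range N, A k ω * Q k ω) * (A N ω * Q N ω) =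
        (2 * (∑ k ∈ Finset.range N, A k ω * Q k ω) * A N ω) * Q N ω := fun ω => by ring
    have hmeas : Measurable[G N] fun ω => 2 * (∑ k ∈ Finset.range N, A k ω * Q k ω) * A N ω :=
      ((h.measurable_sum N).const_mul 2).mul (h.measA N)
    have hint : Integrable
        (fun ω => 2 * (∑ k ∈ Finset.range N, A k ω * Q k ω) * (A N ω * Q N ω)) P := by
      have := (hM.integrable_mul hAQ).const_mul 2
      refine this.congr (ae_of_all _ fun ω => ?_)
      simp [mul_assoc]
    have j1 : Integrable (fun ω => (∑ k ∈ Finset.range N, A k ω * Q k ω) ^ 2 +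
        2 * (∑ k ∈ Finset.range N, A k ω * Q k ω) * (A N ω * Q N ω)) P := hM.integrable_sq.add hint
    rw [integral_add j1 hAQ.integrable_sq,
      integral_add hM.integrable_sq hint, ih]
    simp_rw [hx]
    rw [h.integral_mul_eq_zero N hmeas, h.integral_mul_sq N (h.measA N) (h.memA N), add_zero]

/-- A maximal inequality for martingale transforms. -/
theorem maximal [IsProbabilityMeasure P] (h : IsInnovation P G A Q) (N : ℕ) {ε : ℝ} (hε : 0 < ε) :
    P {ω | ∃ n ≤ N, ε ≤ |∑ k ∈ Finset.range n, A k ω * Q k ω|} ≤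
      ENNReal.ofReal ((∑ k ∈ Finset.range N, (∫ ω, A k ω ^ 2 ∂P) * ∫ ω, Q k ω ^ 2 ∂P) / ε ^ 2) := by
  let 𝓕 : Filtration ℕ m := ⟨G, h.mono, h.le⟩
  set M : ℕ → Ω → ℝ := fun n ω => ∑ k ∈ Finset.range n, A k ω * Q k ω
  have hM2 : ∀ n, Integrable (fun ω => M n ω ^ 2) P := fun n => (h.memLp_sum n).integrable_sq
  have hsub : Submartingale (fun n ω => M n ω ^ 2) 𝓕 P := by
    refine submartingale_of_setIntegral_le_succ ?_ hM2 ?_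
    · intro n
      exact ((h.measurable_sum n).pow_const 2).stronglyMeasurable
    · intro n s hs
      have hs' : MeasurableSet s := h.le n s hs
      have hAQ := h.memLp_mul n (h.measA n) (h.memA n)
      have hint : Integrable (fun ω => M n ω * (A n ω * Q n ω)) P :=
        (h.memLp_sum n).integrable_mul hAQ
      have e : ∀ ω, M (n + 1) ω ^ 2 = M n ω ^ 2 + (2 * (M n ω * (A n ω * Q n ω))
          + (A n ω * Q n ω) ^ 2) := fun ω => by
        simp only [M, Finset.sum_range_succ]; ring
      simp_rw [e]
      have j1 : Integrable (fun ω => 2 * (M n ω * (A n ω * Q n ω)) + (A n ω * Q n ω) ^ 2) P :=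
        (hint.const_mul 2).add hAQ.integrable_sq
      rw [integral_add (hM2 n).integrableOn j1.integrableOn,
        integral_add (hint.const_mul 2).integrableOn hAQ.integrable_sq.integrableOn,
        integral_const_mul]
      have z : ∫ ω in s, M n ω * (A n ω * Q n ω) ∂P = 0 := by
        rw [← integral_indicator hs']
        have : ∀ ω, s.indicator (fun ω => M n ω * (A n ω * Q n ω)) ω =
            (s.indicator (fun ω => M n ω * A n ω) ω) * Q n ω := fun ω => by
          by_cases hω : ω ∈ s <;> simp [hω, mul_assoc]
        simp_rw [this]
        exact h.integral_mul_eq_zero n (((h.measurable_sum n).mul (h.measA n)).indicator hs)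
      rw [z]
      have : 0 ≤ ∫ ω in s, (A n ω * Q n ω) ^ 2 ∂P := integral_nonneg fun ω => sq_nonneg _
      linarith
  have hmax := maximal_ineq hsub (fun n ω => sq_nonneg _) (ε := ⟨ε ^ 2, by positivity⟩) N
  have hset : {ω | ∃ n ≤ N, ε ≤ |M n ω|} ⊆ {ω | (((⟨ε ^ 2, by positivity⟩ : ℝ≥0)) : ℝ) ≤
      (Finset.range (N + 1)).sup' Finset.nonempty_range_add_one fun k => M k ω ^ 2} := by
    rintro ω ⟨n, hn, h1⟩
    refine le_trans ?_ (Finset.le_sup' (fun k => M k ω ^ 2) (Finset.mem_range.2 (Nat.lt_succ_of_le hn)))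
    change ε ^ 2 ≤ M n ω ^ 2
    rw [← sq_abs (M n ω)]
    gcongr
  refine (measure_mono hset).trans ?_
  have hint := setIntegral_le_integral (s := {ω | (((⟨ε ^ 2, by positivity⟩ : ℝ≥0)) : ℝ) ≤
      (Finset.range (N + 1)).sup' Finset.nonempty_range_add_one fun k => M k ω ^ 2}) (hM2 N)
      (ae_of_all _ fun ω => sq_nonneg _)
  rw [h.integral_sq_sum N] at hint
  have h2 := hmax.trans (ENNReal.ofReal_le_ofReal hint)
  rw [ENNReal.ofReal_div_of_pos (by positivity), ENNReal.le_div_iff_mul_le]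
  · rw [mul_comm]
    rw [ENNReal.ofReal_eq_coe_nnreal (by positivity)]
    exact h2
  · left; positivity
  · left; exact ENNReal.ofReal_ne_top

end IsInnovation

end Transform

end IteratedBM
namespace IteratedBM

section Embedding

variable {Ω : Type*} [m : MeasurableSpace Ω] {P : Measure Ω}

lemma abs_sub_clamp_le (x : ℝ) {R : ℝ} (hR : 0 < R) : |x - max (-R) (min x R)| ≤ x ^ 2 / R := by
  rw [le_div_iff₀ hR]
  rcases le_total x R with h1 | h1
  · rw [min_eq_left h1]
    rcases le_total (-R) x with h2 | h2
    · rw [max_eq_right h2]; simp; positivity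
    · rw [max_eq_left h2, abs_of_nonpos (by linarith)]; nlinarith
  · rw [min_eq_right h1, max_eq_right (by linarith), abs_of_nonneg (by linarith)]; nlinarith

/-- Means of an `L²`-bounded, almost surely convergent sequence pass to a bounded limit. -/
lemma integral_eq_zero_of_tendsto_of_sq_le [IsProbabilityMeasure P] {D : ℕ → Ω → ℝ} {D' : Ω → ℝ}
    {C b : ℝ} (h2 : ∀ k, MemLp (D k) 2 P) (hC : ∀ k, ∫ ω, D k ω ^ 2 ∂P ≤ C)
    (h0 : ∀ k, ∫ ω, D k ω ∂P = 0) (hb : ∀ᵐ ω ∂P, |D' ω| ≤ b)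
    (hlim : ∀ᵐ ω ∂P, Tendsto (fun k => D k ω) atTop (𝓝 (D' ω))) : ∫ ω, D' ω ∂P = 0 := by
  have hcl : ∀ R : ℝ, Continuous fun x : ℝ => max (-R) (min x R) := fun R => by fun_prop
  have key : ∀ R : ℝ, 0 < R → b ≤ R → |∫ ω, D' ω ∂P| ≤ C / R := by
    intro R hR hbR
    have hbd : ∀ x : ℝ, |max (-R) (min x R)| ≤ R := fun x => by
      rw [abs_le]; exact ⟨le_max_left _ _, max_le (by linarith) (min_le_right _ _)⟩
    have hT : Tendsto (fun k => ∫ ω, max (-R) (min (D k ω) R) ∂P) atTop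
        (𝓝 (∫ ω, max (-R) (min (D' ω) R) ∂P)) := by
      refine tendsto_integral_of_dominated_convergence (fun _ => R)
        (fun k => (hcl R).comp_aestronglyMeasurable (h2 k).1) (integrable_const _)
        (fun k => ae_of_all _ fun ω => hbd _) ?_
      filter_upwards [hlim] with ω hω
      exact ((hcl R).tendsto _).comp hω
    have e : ∫ ω, max (-R) (min (D' ω) R) ∂P = ∫ ω, D' ω ∂P := by
      refine integral_congr_ae ?_
      filter_upwards [hb] with ω hω
      have := abs_le.1 (hω.trans hbR)
      rw [min_eq_left this.2, max_eq_right this.1]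
    rw [e] at hT
    refine le_of_tendsto hT.abs (Eventually.of_forall fun k => ?_)
    have i1 : Integrable (D k) P := (h2 k).integrable (by norm_num)
    have i2 : Integrable (fun ω => max (-R) (min (D k ω) R)) P :=
      Integrable.of_bound ((hcl R).comp_aestronglyMeasurable (h2 k).1) R
        (ae_of_all _ fun ω => hbd _)
    have : ∫ ω, max (-R) (min (D k ω) R) ∂P = -∫ ω, (D k ω - max (-R) (min (D k ω) R)) ∂P := by
      rw [integral_sub i1 i2, h0 k]; ring
    rw [this, abs_neg]
    refine (abs_integral_le_integral_abs).trans ?_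
    calc ∫ ω, |D k ω - max (-R) (min (D k ω) R)| ∂P ≤ ∫ ω, D k ω ^ 2 / R ∂P :=
          integral_mono (i1.sub i2).abs ((h2 k).integrable_sq.div_const R)
            fun ω => abs_sub_clamp_le _ hR
      _ ≤ C / R := by rw [integral_div]; gcongr; exact hC k
  have hlim0 : Tendsto (fun R : ℝ => C / R) atTop (𝓝 0) := tendsto_const_nhds.div_atTop tendsto_id
  have : |∫ ω, D' ω ∂P| ≤ 0 := ge_of_tendsto hlim0 (by
    filter_upwards [eventually_gt_atTop 0, eventually_ge_atTop b] with R h1 h2 using key R h1 h2)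
  simpa using this

lemma sum_range_ite_telescope (y : ℕ → ℝ) (a b N : ℕ) (hab : a ≤ b) :
    ∑ j ∈ Finset.range N, (if a ≤ j ∧ j < b then y (j + 1) - y j else 0) =
      y (min b N) - y (min a N) := by
  induction N with
  | zero => simp
  | succ N ih =>
    rw [Finset.sum_range_succ, ih]
    rcases lt_or_ge N a with h1 | h1
    · rw [if_neg (by omega), min_eq_right (by omega), min_eq_right (by omega),
        min_eq_right (by omega), min_eq_right (by omega)]; ring
    · rcases lt_or_ge N b with h2 | h2
      · rw [if_pos ⟨h1, h2⟩, min_eq_right (by omega : N ≤ b), min_eq_left h1,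
          min_eq_right (by omega), min_eq_left (by omega)]; ring
      · rw [if_neg (by omega), min_eq_left h2, min_eq_left h1, min_eq_left (by omega),
          min_eq_left (by omega)]; ring

variable {Y : ℝ≥0 → Ω → ℝ} (hYm : ∀ t, Measurable (Y t)) (hex : ∀ ω, IsExcursive fun t => Y t ω)

lemma stoppedProcess_coe {Ω : Type*} (Y : ℝ≥0 → Ω → ℝ) (T : Ω → ℝ≥0) (s : ℝ≥0) (ω : Ω) :
    stoppedProcess Y (fun ω => (T ω : WithTop ℝ≥0)) s ω = Y (min (T ω) s) ω := by
  rcases le_total s (T ω) with h | h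
  · rw [stoppedProcess_eq_of_le (by exact_mod_cast h), min_eq_right h]
  · rw [stoppedProcess_eq_of_ge (by exact_mod_cast h), min_eq_left h]
    rfl

/-- The natural filtration of a measurable process. -/
noncomputable abbrev natFiltration (hYm : ∀ t, Measurable (Y t)) : Filtration ℝ≥0 m :=
  Filtration.natural Y fun t => (hYm t).stronglyMeasurable

include hex in
lemma isStoppingTime_skeletonTime (n k : ℕ) :
    IsStoppingTime (natFiltration hYm) fun ω => (skeletonTime Y n k ω : WithTop ℝ≥0) := by
  have hadap : StronglyAdapted (natFiltration hYm) Y := Filtration.stronglyAdapted_natural _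
  induction k with
  | zero => exact isStoppingTime_const _ 0
  | succ k ih =>
    have hs := hadap.stoppedProcess (fun ω => (hex ω).cont) ih
    intro t
    have hset : {ω | (skeletonTime Y n (k + 1) ω : WithTop ℝ≥0) ≤ t} =
        ⋂ p : ℕ, ⋃ q ∈ {q : ℚ | 0 ≤ q ∧ ((q : ℝ)).toNNReal ≤ t},
          {ω | mesh n - 1 / ((p : ℝ) + 1) < |Y (q : ℝ).toNNReal ω -
            stoppedProcess Y (fun ω => (skeletonTime Y n k ω : WithTop ℝ≥0)) (q : ℝ).toNNReal ω|} := by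
      ext ω
      simp only [Set.mem_ofPred_eq, Set.mem_iInter, Set.mem_iUnion, WithTop.coe_le_coe,
        stoppedProcess_coe]
      rw [skeletonTime_succ_le_iff (hex ω)]
      have hc : Continuous fun s : ℝ≥0 => |Y s ω - Y (min (skeletonTime Y n k ω) s) ω| := by
        have := (hex ω).cont
        exact (this.sub (this.comp (continuous_const.min continuous_id))).abs
      constructor
      · rintro ⟨s, hst, hs⟩ p
        have hp : mesh n - 1 / ((p : ℝ) + 1) < |Y s ω - Y (min (skeletonTime Y n k ω) s) ω| := by
          have : (0 : ℝ) < 1 / ((p : ℝ) + 1) := by positivity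
          linarith
        have h0 : 0 < s := by
          rcases eq_or_ne s 0 with rfl | h
          · simp at hs; linarith [mesh_pos n]
          · exact pos_iff_ne_zero.2 h
        have hev : ∀ᶠ r in 𝓝[<] s, mesh n - 1 / ((p : ℝ) + 1) <
            |Y r ω - Y (min (skeletonTime Y n k ω) r) ω| :=
          ((hc.tendsto s).mono_left nhdsWithin_le_nhds).eventually (lt_mem_nhds hp)
        obtain ⟨l, hl, hl2⟩ := (mem_nhdsLT_iff_exists_Ioo_subset' h0).1 hev
        obtain ⟨q, hq1, hq2⟩ := exists_rat_btwn (NNReal.coe_lt_coe.2 hl)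
        have hq0 : (0 : ℝ) ≤ q := l.coe_nonneg.trans hq1.le
        have hq3 : l < (q : ℝ).toNNReal := by
          rw [← NNReal.coe_lt_coe, Real.coe_toNNReal _ hq0]; exact hq1
        have hq4 : (q : ℝ).toNNReal < s := by
          rw [← NNReal.coe_lt_coe, Real.coe_toNNReal _ hq0]; exact hq2
        exact ⟨q, ⟨by exact_mod_cast hq0, hq4.le.trans hst⟩, hl2 ⟨hq3, hq4⟩⟩
      · intro h
        obtain ⟨s, hs, hmax⟩ := (isCompact_Icc (a := (0 : ℝ≥0)) (b := t)).exists_isMaxOn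
          ⟨0, by simp⟩ hc.continuousOn
        refine ⟨s, hs.2, le_of_forall_pos_lt_add fun ε hε => ?_⟩
        obtain ⟨p, hp⟩ := exists_nat_one_div_lt hε
        obtain ⟨q, hq, hq2⟩ := h p
        have := hmax (show (q : ℝ).toNNReal ∈ Set.Icc 0 t from ⟨zero_le, hq.2⟩)
        simp only [Set.mem_ofPred_eq] at this
        linarith
    rw [hset]
    refine MeasurableSet.iInter fun p => MeasurableSet.biUnion (Set.to_countable _) fun q hq => ?_
    have m1 : Measurable[natFiltration hYm t] (Y (q : ℝ).toNNReal) :=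
      ((hadap _).mono ((natFiltration hYm).mono hq.2)).measurable
    have m2 := ((hs (q : ℝ).toNNReal).mono ((natFiltration hYm).mono hq.2)).measurable
    exact measurableSet_lt measurable_const (continuous_abs.measurable.comp (m1.sub m2))

lemma isInnovation_of_preBrownian [IsProbabilityMeasure P] (hY : IsPreBrownianReal Y P)
    (t : ℕ → ℝ≥0) (ht : Monotone t) (A : ℕ → Ω → ℝ)
    (hA : ∀ k, Measurable[natFiltration hYm (t k)] (A k)) (hA2 : ∀ k, MemLp (A k) 2 P) :
    IsInnovation P (fun k => natFiltration hYm (t k)) A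
      (fun k ω => Y (t (k + 1)) ω - Y (t k) ω) where
  mono := fun i j hij => (natFiltration hYm).mono (ht hij)
  le := fun k => (natFiltration hYm).le _
  measA := hA
  measQ := fun k => by
    have hadap : StronglyAdapted (natFiltration hYm) Y := Filtration.stronglyAdapted_natural _
    exact (hadap _).measurable.sub
      (((hadap _).mono ((natFiltration hYm).mono (ht k.le_succ))).measurable)
  indep := fun k => by
    have h := hY.indepFun_shift (t k)
    rw [IndepFun_iff_Indep, ← Filtration.natural_eq_comap Y (fun t => (hYm t).stronglyMeasurable)]
      at h
    refine indep_of_indep_of_le_left h ?_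
    have e : (fun ω => Y (t (k + 1)) ω - Y (t k) ω) =
        (fun x : ℝ≥0 → ℝ => x (t (k + 1) - t k)) ∘ fun ω s => Y (t k + s) ω - Y (t k) ω := by
      ext ω; simp [add_tsub_cancel_of_le (ht k.le_succ)]
    rw [e, ← MeasurableSpace.comap_comp]
    exact MeasurableSpace.comap_mono (measurable_iff_comap_le.1 (measurable_pi_apply _))
  memA := hA2
  memQ := fun k => (hY.isGaussianProcess.hasGaussianLaw_fun_sub).memLp_two
  mean := fun k => by
    rw [integral_sub (hY.integrable_eval _) (hY.integrable_eval _), hY.integral_eval,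
      hY.integral_eval, sub_zero]

lemma integral_sub_sq_of_preBrownian (hY : IsPreBrownianReal Y P) {s t : ℝ≥0} (hst : s ≤ t) :
    ∫ ω, (Y t ω - Y s ω) ^ 2 ∂P = t - s := by
  have h : HasLaw (Y t - Y s) (gaussianReal 0 (nndist (t : ℝ) s)) P := hY.hasLaw_sub t s
  have : ∫ ω, (Y t ω - Y s ω) ^ 2 ∂P = ∫ x, x ^ 2 ∂(gaussianReal 0 (nndist (t : ℝ) s)) := by
    rw [← h.map_eq, integral_map h.aemeasurable (by fun_prop)]
    rfl
  rw [this]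
  have h2 := variance_eq_integral (X := fun x : ℝ => x) (μ := gaussianReal 0 (nndist (t : ℝ) s))
    (by fun_prop)
  rw [integral_id_gaussianReal, variance_fun_id_gaussianReal] at h2
  simp only [sub_zero] at h2
  rw [← h2, coe_nndist, Real.dist_eq, abs_of_nonneg (sub_nonneg.2 (by exact_mod_cast hst))]

include hex in
/-- The embedded walk is a martingale. -/
theorem integral_mul_skeleton_increment [IsProbabilityMeasure P] (hY : IsPreBrownianReal Y P)
    (n k : ℕ) {F : Ω → ℝ} (hF : ∀ ω, |F ω| ≤ 1)
    (hFm : ∀ t : ℝ≥0, Measurable[natFiltration hYm t]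
      ({ω | skeletonTime Y n k ω ≤ t}.indicator F)) :
    ∫ ω, F ω * (Y (skeletonTime Y n (k + 1) ω) ω - Y (skeletonTime Y n k ω) ω) ∂P = 0 := by
  set S := skeletonTime Y n k
  set T := skeletonTime Y n (k + 1)
  have hst : ∀ k, ∀ t : ℝ≥0, MeasurableSet[natFiltration hYm t] {ω | skeletonTime Y n k ω ≤ t} :=
    fun k t => by
      have h := isStoppingTime_skeletonTime hYm hex n k t
      simp only [WithTop.coe_le_coe] at h
      exact h
  have hST : ∀ ω, S ω < T ω := fun ω => (skeleton_spec (hex ω) n k).2.1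
  -- values of the increments stopped at a deterministic time
  have hbd : ∀ ω (M : ℝ≥0), |Y (min (T ω) M) ω - Y (min (S ω) M) ω| ≤ mesh n := by
    intro ω M
    obtain ⟨-, h1, h2, h3⟩ := skeleton_spec (hex ω) n k
    rcases le_total M (S ω) with hM | hM
    · rw [min_eq_right hM, min_eq_right (hM.trans (hST ω).le)]
      simpa using (mesh_pos n).le
    · rw [min_eq_left hM]
      rcases le_or_gt (T ω) M with hM2 | hM2
      · rw [min_eq_left hM2]; exact h2.le
      · rw [min_eq_right hM2.le]
        by_contra hcon
        exact absurd (h3 M hM (not_le.1 hcon).le) (not_le.2 hM2)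
  have step : ∀ M : ℕ, ∫ ω, F ω * (Y (min (T ω) M) ω - Y (min (S ω) M) ω) ∂P = 0 := by
    intro M
    set t : ℕ → ℕ → ℝ≥0 := fun p j => (j : ℝ≥0) / 2 ^ p
    set A : ℕ → ℕ → Ω → ℝ := fun p j =>
      {ω | S ω ≤ t p j ∧ t p j < T ω}.indicator F
    have hAm : ∀ p j, Measurable[natFiltration hYm (t p j)] (A p j) := by
      intro p j
      have : A p j = {ω | T ω ≤ t p j}ᶜ.indicator ({ω | S ω ≤ t p j}.indicator F) := by
        rw [Set.indicator_indicator]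
        have hset : {ω | S ω ≤ t p j ∧ t p j < T ω} = {ω | T ω ≤ t p j}ᶜ ∩ {ω | S ω ≤ t p j} := by
          ext ω
          simp only [Set.mem_inter_iff, Set.mem_compl_iff, Set.mem_ofPred_eq, not_le]
          tauto
        simp only [A, hset]
      rw [this]
      exact (hFm _).indicator (hst (k + 1) _).compl
    have hAb : ∀ p j ω, |A p j ω| ≤ 1 := fun p j ω => by
      by_cases h : ω ∈ {ω | S ω ≤ t p j ∧ t p j < T ω}
      · simp only [A]; rw [Set.indicator_of_mem h]; exact hF ω
      · simp only [A]; rw [Set.indicator_of_notMem h]; simp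
    have hA2 : ∀ p j, MemLp (A p j) 2 P := fun p j =>
      MemLp.of_bound ((hAm p j).mono ((natFiltration hYm).le _) le_rfl).aestronglyMeasurable 1
        (ae_of_all _ (hAb p j))
    have hI := fun p => isInnovation_of_preBrownian hYm hY (t p)
      (fun i j hij => by simp only [t]; gcongr) (A p) (hAm p) (hA2 p)
    refine integral_eq_zero_of_tendsto_of_sq_le (b := mesh n) (C := M)
      (D := fun p ω => ∑ j ∈ Finset.range (M * 2 ^ p), A p j ω * (Y (t p (j + 1)) ω - Y (t p j) ω))
      (fun p => (hI p).memLp_sum _) (fun p => ?_) (fun p => ?_) (ae_of_all _ fun ω => ?_)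
      (ae_of_all _ fun ω => ?_)
    · rw [(hI p).integral_sq_sum]
      have : ∀ j ∈ Finset.range (M * 2 ^ p), (∫ ω, A p j ω ^ 2 ∂P) *
          ∫ ω, (Y (t p (j + 1)) ω - Y (t p j) ω) ^ 2 ∂P ≤ 1 * (1 / 2 ^ p) := by
        intro j _
        have e : ∫ ω, (Y (t p (j + 1)) ω - Y (t p j) ω) ^ 2 ∂P = 1 / 2 ^ p := by
          rw [integral_sub_sq_of_preBrownian hY (by simp only [t]; gcongr; simp)]
          simp only [t]; push_cast; ring
        rw [e]
        gcongr
        calc ∫ ω, A p j ω ^ 2 ∂P ≤ ∫ _, (1 : ℝ) ∂P :=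
              integral_mono (hA2 p j).integrable_sq (integrable_const _) fun ω => by
                simpa [sq_le_one_iff_abs_le_one] using hAb p j ω
          _ = 1 := by simp
      refine (Finset.sum_le_sum this).trans ?_
      rw [Finset.sum_const, Finset.card_range, nsmul_eq_mul]
      push_cast
      field_simp
      rfl
    · rw [integral_finsetSum]
      · exact Finset.sum_eq_zero fun j _ => (hI p).integral_mul_eq_zero j (hAm p j)
      · exact fun j _ => ((hI p).memLp_mul j (hAm p j) (hA2 p j)).integrable (by norm_num)
    · rw [abs_mul]
      calc |F ω| * |Y (min (T ω) M) ω - Y (min (S ω) M) ω| ≤ 1 * mesh n := by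
            gcongr
            · exact hF ω
            · exact hbd ω M
        _ = mesh n := one_mul _
    · have hD : ∀ p, ∑ j ∈ Finset.range (M * 2 ^ p), A p j ω * (Y (t p (j + 1)) ω - Y (t p j) ω) =
          F ω * (Y (t p (min ⌈T ω * 2 ^ p⌉₊ (M * 2 ^ p))) ω -
            Y (t p (min ⌈S ω * 2 ^ p⌉₊ (M * 2 ^ p))) ω) := by
        intro p
        rw [← sum_range_ite_telescope (fun j => Y (t p j) ω) _ _ _
          (Nat.ceil_mono (by gcongr; exact (hST ω).le)), Finset.mul_sum]
        refine Finset.sum_congr rfl fun j _ => ?_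
        have e1 : S ω ≤ t p j ↔ ⌈S ω * 2 ^ p⌉₊ ≤ j := by
          rw [Nat.ceil_le, le_div_iff₀ (by positivity)]
        have e2 : t p j < T ω ↔ j < ⌈T ω * 2 ^ p⌉₊ := by
          rw [Nat.lt_ceil, div_lt_iff₀ (by positivity)]
        by_cases h : S ω ≤ t p j ∧ t p j < T ω
        · simp only [A]
          rw [Set.indicator_of_mem (show ω ∈ {ω | S ω ≤ t p j ∧ t p j < T ω} from h),
            if_pos (by rwa [← e1, ← e2])]
        · simp only [A]
          rw [Set.indicator_of_notMem (show ω ∉ {ω | S ω ≤ t p j ∧ t p j < T ω} from h),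
            if_neg (by rwa [← e1, ← e2])]
          simp
      simp_rw [hD]
      have hlim : ∀ U : ℝ≥0, Tendsto (fun p => t p (min ⌈U * 2 ^ p⌉₊ (M * 2 ^ p))) atTop
          (𝓝 (min U M)) := by
        intro U
        have e : ∀ p, t p (min ⌈U * 2 ^ p⌉₊ (M * 2 ^ p)) = min ((⌈U * 2 ^ p⌉₊ : ℝ≥0) / 2 ^ p) M := by
          intro p
          simp only [t]
          have h2 : (M : ℝ≥0) = ((M * 2 ^ p : ℕ) : ℝ≥0) / 2 ^ p := by
            push_cast; field_simp
          have hmono : Monotone fun x : ℝ≥0 => x / 2 ^ p := fun x y h => by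
            change x / 2 ^ p ≤ y / 2 ^ p
            gcongr
          rw [h2, Nat.cast_min]
          exact hmono.map_min
        simp_rw [e]
        refine Tendsto.min ?_ tendsto_const_nhds
        have hpow' : Tendsto (fun p : ℕ => (2 : ℝ) ^ p) atTop atTop :=
          tendsto_pow_atTop_atTop_of_one_lt one_lt_two
        have h3 := (tendsto_nat_ceil_mul_div_atTop (R := ℝ) (a := U) U.coe_nonneg).comp hpow'
        rw [← NNReal.tendsto_coe]
        refine h3.congr fun p => ?_
        simp only [Function.comp]
        push_cast
        congr 2
      have hc := (hex ω).cont
      exact (((hc.tendsto _).comp (hlim (T ω))).sub ((hc.tendsto _).comp (hlim (S ω)))).const_mul _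
  have hlim : Tendsto (fun M : ℕ => ∫ ω, F ω * (Y (min (T ω) M) ω - Y (min (S ω) M) ω) ∂P) atTop
      (𝓝 (∫ ω, F ω * (Y (T ω) ω - Y (S ω) ω) ∂P)) := by
    refine tendsto_integral_of_dominated_convergence (fun _ => mesh n) (fun M => ?_)
      (integrable_const _) (fun M => ae_of_all _ fun ω => ?_) (ae_of_all _ fun ω => ?_)
    · have hadap : StronglyAdapted (natFiltration hYm) Y := Filtration.stronglyAdapted_natural _
      have hD : ∀ k, (fun ω => Y (min (skeletonTime Y n k ω) M) ω) =
          stoppedProcess Y (fun ω => (skeletonTime Y n k ω : WithTop ℝ≥0)) M := fun k => by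
        ext ω
        rw [stoppedProcess_coe]
      have hs := fun k => ((hadap.stoppedProcess (fun ω => (hex ω).cont)
        (isStoppingTime_skeletonTime hYm hex n k) M).mono ((natFiltration hYm).le _)).measurable
      have hs' : ∀ k, Measurable (fun ω => Y (min (skeletonTime Y n k ω) M) ω) := fun k => by
        rw [hD k]; exact hs k
      have hFmeas : Measurable F := by
        have : ∀ ω, Tendsto (fun j : ℕ => {ω | S ω ≤ (j : ℝ≥0)}.indicator F ω) atTop (𝓝 (F ω)) := by
          intro ω
          obtain ⟨j0, hj0⟩ := exists_nat_ge (S ω)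
          refine tendsto_const_nhds.congr' ?_
          filter_upwards [eventually_ge_atTop j0] with j hj
          rw [Set.indicator_of_mem]
          exact hj0.trans (by exact_mod_cast hj)
        exact measurable_of_tendsto_metrizable
          (fun j : ℕ => (hFm j).mono ((natFiltration hYm).le _) le_rfl) (tendsto_pi_nhds.2 this)
      exact (hFmeas.mul ((hs' (k + 1)).sub (hs' k))).aestronglyMeasurable
    · rw [Real.norm_eq_abs, abs_mul]
      calc |F ω| * |Y (min (T ω) M) ω - Y (min (S ω) M) ω| ≤ 1 * mesh n := by
            gcongr
            · exact hF ω
            · exact hbd ω M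
        _ = mesh n := one_mul _
    · refine tendsto_const_nhds.congr' ?_
      obtain ⟨j0, hj0⟩ := exists_nat_ge (T ω)
      filter_upwards [eventually_ge_atTop j0] with j hj
      have h1 : T ω ≤ (j : ℝ≥0) := hj0.trans (by exact_mod_cast hj)
      rw [min_eq_left h1, min_eq_left ((hST ω).le.trans h1)]
  simp_rw [step] at hlim
  exact (tendsto_nhds_unique hlim tendsto_const_nhds)

end Embedding

end IteratedBM
namespace IteratedBM

section Walk

variable {Ω : Type*} [m : MeasurableSpace Ω] {P : Measure Ω} [IsProbabilityMeasure P]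

/-- Characteristic function of a centred Gaussian process. -/
lemma integral_exp_gaussian {T ι : Type*} [Fintype ι] {Z : T → Ω → ℝ} (hZ : IsGaussianProcess Z P)
    (h0 : ∀ t, ∫ ω, Z t ω ∂P = 0) (r : T → T → ℝ) (hr : ∀ s t, cov[Z s, Z t; P] = r s t)
    (p : ι → T) (a : ι → ℝ) :
    ∫ ω, Complex.exp ((∑ i, a i * Z (p i) ω : ℝ) * Complex.I) ∂P =
      Complex.exp (-((∑ i, ∑ j, a i * a j * r (p i) (p j) : ℝ) / 2 : ℂ)) := by
  have hL : HasGaussianLaw (fun ω => ∑ i, a i * Z (p i) ω) P :=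
    ((hZ.comp_right p).smul a).hasGaussianLaw_fun_sum (I := Finset.univ)
  have h2 : ∀ i, MemLp (fun ω => a i * Z (p i) ω) 2 P := fun i =>
    ((hZ.hasGaussianLaw_eval (p i)).memLp_two).const_mul (a i)
  have hmean : ∫ ω, ∑ i, a i * Z (p i) ω ∂P = 0 := by
    rw [integral_finsetSum _ fun i _ => (h2 i).integrable (by norm_num)]
    refine Finset.sum_eq_zero fun i _ => ?_
    rw [integral_const_mul, h0, mul_zero]
  have hvar : Var[fun ω => ∑ i, a i * Z (p i) ω; P] = ∑ i, ∑ j, a i * a j * r (p i) (p j) := by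
    rw [variance_fun_sum h2]
    refine Finset.sum_congr rfl fun i _ => Finset.sum_congr rfl fun j _ => ?_
    rw [covariance_const_mul_left, covariance_const_mul_right]
    rw [hr, mul_assoc]
  have hc := charFun_gaussianReal (μ := ∫ ω, ∑ i, a i * Z (p i) ω ∂P)
    (v := Var[fun ω => ∑ i, a i * Z (p i) ω; P].toNNReal) 1
  rw [← hL.map_eq_gaussianReal, charFun_apply_real,
    integral_map hL.aemeasurable (Measurable.aestronglyMeasurable (by fun_prop)), hmean,
    Real.coe_toNNReal _ (variance_nonneg _ _), hvar] at hc
  simp only [Complex.ofReal_one, one_mul, Complex.ofReal_zero, zero_mul, one_pow, mul_one,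
    zero_sub] at hc
  exact hc

variable {Y : ℝ≥0 → Ω → ℝ} (hYm : ∀ t, Measurable (Y t)) (hex : ∀ ω, IsExcursive fun t => Y t ω)

omit [IsProbabilityMeasure P] in
include hYm hex in
lemma measurable_skeletonPos (n k : ℕ) : Measurable (skeletonPos Y n k) := by
  have hadap : StronglyAdapted (natFiltration hYm) Y := Filtration.stronglyAdapted_natural _
  have hs := fun M : ℝ≥0 => ((hadap.stoppedProcess (fun ω => (hex ω).cont)
    (isStoppingTime_skeletonTime hYm hex n k) M).mono ((natFiltration hYm).le _)).measurable
  have h1 : Measurable fun ω => Y (skeletonTime Y n k ω) ω := by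
    refine measurable_of_tendsto_metrizable (fun j : ℕ => hs j) (tendsto_pi_nhds.2 fun ω => ?_)
    refine tendsto_const_nhds.congr' ?_
    obtain ⟨j0, hj0⟩ := exists_nat_ge (skeletonTime Y n k ω)
    filter_upwards [eventually_ge_atTop j0] with j hj
    rw [stoppedProcess_coe, min_eq_left (hj0.trans (by exact_mod_cast hj))]
  unfold skeletonPos
  simp_rw [round_eq]
  exact Int.measurable_floor.comp ((h1.div_const _).add_const _)

include hYm hex in
lemma integral_mul_skeletonPos_increment (hY : IsPreBrownianReal Y P) (n k : ℕ)
    {ψ : (Fin (k + 1) → ℤ) → ℝ} (hψ : ∀ x, |ψ x| ≤ 1) :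
    ∫ ω, ψ (fun j => skeletonPos Y n j ω) *
      ((skeletonPos Y n (k + 1) ω : ℝ) - skeletonPos Y n k ω) ∂P = 0 := by
  have hadap : StronglyAdapted (natFiltration hYm) Y := Filtration.stronglyAdapted_natural _
  have hmono : ∀ ω, Monotone fun k => skeletonTime Y n k ω := fun ω =>
    monotone_nat_of_le_succ fun k => (skeleton_spec (hex ω) n k).2.1.le
  have hst : ∀ k, ∀ t : ℝ≥0, MeasurableSet[natFiltration hYm t] {ω | skeletonTime Y n k ω ≤ t} :=
    fun k t => by
      have h := isStoppingTime_skeletonTime hYm hex n k t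
      simp only [WithTop.coe_le_coe] at h
      exact h
  have key := integral_mul_skeleton_increment hYm hex hY n k
    (F := fun ω => ψ (fun j => skeletonPos Y n j ω)) (fun ω => hψ _) fun t => by
      have e : {ω | skeletonTime Y n k ω ≤ t}.indicator
          (fun ω => ψ (fun j : Fin (k + 1) => skeletonPos Y n j ω)) =
          {ω | skeletonTime Y n k ω ≤ t}.indicator (fun ω => ψ (fun j : Fin (k + 1) =>
            round (stoppedProcess Y (fun ω => (skeletonTime Y n j ω : WithTop ℝ≥0)) t ω
              / mesh n))) := by
        ext ω
        by_cases h : ω ∈ {ω | skeletonTime Y n k ω ≤ t}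
        · rw [Set.indicator_of_mem h, Set.indicator_of_mem h]
          congr 1
          ext j
          rw [stoppedProcess_coe, min_eq_left ((hmono ω (Nat.lt_succ_iff.1 j.2)).trans h)]
          rfl
        · rw [Set.indicator_of_notMem h, Set.indicator_of_notMem h]
      rw [e]
      refine Measurable.indicator ?_ (hst k t)
      refine (measurable_of_countable ψ).comp
        (@measurable_pi_lambda _ _ _ (natFiltration hYm t) _ _ fun j => ?_)
      simp_rw [round_eq]
      have hs := (hadap.stoppedProcess (fun ω => (hex ω).cont)
        (isStoppingTime_skeletonTime hYm hex n j) t).measurable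
      exact Int.measurable_floor.comp ((hs.div_const _).add_const _)
  have e : ∀ ω, ψ (fun j : Fin (k + 1) => skeletonPos Y n j ω) *
      (Y (skeletonTime Y n (k + 1) ω) ω - Y (skeletonTime Y n k ω) ω) =
      mesh n * (ψ (fun j => skeletonPos Y n j ω) *
      ((skeletonPos Y n (k + 1) ω : ℝ) - skeletonPos Y n k ω)) := fun ω => by
    rw [(skeleton_spec (hex ω) n (k + 1)).1, (skeleton_spec (hex ω) n k).1]; ring
  simp_rw [e] at key
  rw [integral_const_mul] at key
  exact (mul_eq_zero.1 key).resolve_left (mesh_pos n).ne'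

include hYm hex in
lemma integral_exp_skeleton (hY : IsPreBrownianReal Y P) (n : ℕ) (c : ℕ → ℝ) (L : ℕ) :
    ∫ ω, Complex.exp ((∑ l ∈ Finset.range L,
      c l * ((skeletonPos Y n (l + 1) ω : ℝ) - skeletonPos Y n l ω) : ℝ) * Complex.I) ∂P =
      ∏ l ∈ Finset.range L, (Real.cos (c l) : ℂ) := by
  induction L with
  | zero => simp
  | succ L ih =>
    set E : Ω → ℂ := fun ω => Complex.exp ((∑ l ∈ Finset.range L,
      c l * ((skeletonPos Y n (l + 1) ω : ℝ) - skeletonPos Y n l ω) : ℝ) * Complex.I)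
    set ε : Ω → ℝ := fun ω => (skeletonPos Y n (L + 1) ω : ℝ) - skeletonPos Y n L ω
    have hpm := fun k => measurable_skeletonPos hYm hex n k
    have hpm' : ∀ k, Measurable fun ω => (skeletonPos Y n k ω : ℝ) := fun k =>
      (measurable_of_countable _).comp (hpm k)
    have hEm : Measurable E := by
      refine Complex.measurable_exp.comp ((Complex.measurable_ofReal.comp ?_).mul_const _)
      exact Finset.measurable_sum _ fun l _ => ((hpm' _).sub (hpm' _)).const_mul _
    have hεm : Measurable ε := (hpm' _).sub (hpm' _)
    have hε : ∀ ω, |ε ω| = 1 := fun ω => by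
      have := abs_skeletonPos_succ_sub (hex ω) n L
      simp only [ε]
      exact_mod_cast this
    have hEn : ∀ ω, ‖E ω‖ = 1 := fun ω => Complex.norm_exp_ofReal_mul_I _
    have hsplit : ∀ ω, Complex.exp ((∑ l ∈ Finset.range (L + 1),
        c l * ((skeletonPos Y n (l + 1) ω : ℝ) - skeletonPos Y n l ω) : ℝ) * Complex.I) =
        E ω * (Real.cos (c L) : ℂ) + (E ω * ε ω) * (Real.sin (c L) * Complex.I) := fun ω => by
      rw [Finset.sum_range_succ]
      push_cast
      rw [add_mul, Complex.exp_add]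
      have h1 : Complex.exp (((c L : ℂ) * ((skeletonPos Y n (L + 1) ω : ℂ) - skeletonPos Y n L ω)) *
          Complex.I) = Complex.cos (c L) + (ε ω : ℂ) * (Complex.sin (c L) * Complex.I) := by
        have h2 : ((skeletonPos Y n (L + 1) ω : ℂ) - skeletonPos Y n L ω) = (ε ω : ℂ) := by
          simp [ε]
        rw [h2]
        rcases (abs_eq zero_le_one).1 (hε ω) with h | h
        · rw [h, Complex.exp_mul_I]; simp
        · rw [h, Complex.exp_mul_I]; simp
      rw [h1]
      simp only [E]
      push_cast
      ring
    have hE1 : Integrable E P := Integrable.of_bound hEm.aestronglyMeasurable 1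
      (ae_of_all _ fun ω => (hEn ω).le)
    have hE2 : Integrable (fun ω => E ω * ε ω) P := by
      refine Integrable.of_bound (hEm.mul (Complex.measurable_ofReal.comp hεm)).aestronglyMeasurable 1
        (ae_of_all _ fun ω => ?_)
      rw [norm_mul, hEn, Complex.norm_real, Real.norm_eq_abs, hε, one_mul]
    have hz : ∫ ω, E ω * ε ω ∂P = 0 := by
      rw [← integral_re_add_im hE2]
      set Ψ : (Fin (L + 1) → ℤ) → ℂ := fun x => Complex.exp ((∑ l : Fin L,
        c l * ((x l.succ : ℝ) - x l.castSucc) : ℝ) * Complex.I)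
      have hΨ : ∀ ω, E ω = Ψ fun j => skeletonPos Y n j ω := fun ω => by
        simp only [E, Ψ]
        rw [Finset.sum_range]
        rfl
      have hΨn : ∀ x, ‖Ψ x‖ = 1 := fun x => Complex.norm_exp_ofReal_mul_I _
      have h1 := integral_mul_skeletonPos_increment hYm hex hY n L (ψ := fun x => (Ψ x).re)
        fun x => (Complex.abs_re_le_norm _).trans (hΨn x).le
      have h2 := integral_mul_skeletonPos_increment hYm hex hY n L (ψ := fun x => (Ψ x).im)
        fun x => (Complex.abs_im_le_norm _).trans (hΨn x).le
      simp_rw [← hΨ] at h1 h2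
      have e1 : ∫ ω, RCLike.re (E ω * (ε ω : ℂ)) ∂P = 0 := by
        rw [← h1]; congr 1; ext ω; simp [ε]
      have e2 : ∫ ω, RCLike.im (E ω * (ε ω : ℂ)) ∂P = 0 := by
        rw [← h2]; congr 1; ext ω; simp [ε]
      rw [e1, e2]; simp
    simp_rw [hsplit]
    rw [integral_add (hE1.mul_const _) (hE2.mul_const _), integral_mul_const, integral_mul_const,
      hz, ih, Finset.prod_range_succ, zero_mul, add_zero]

lemma abs_cos_sub_le (x : ℝ) : |Real.cos x - (1 - x ^ 2 / 2)| ≤ 4 * |x| ^ 3 := by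
  have h := (Complex.abs_re_le_norm _).trans (norm_exp_I_sub_taylor_le x)
  rw [Complex.exp_mul_I] at h
  have e : (Complex.cos x + Complex.sin x * Complex.I - (1 + x * Complex.I - x ^ 2 / 2) : ℂ).re =
      Real.cos x - (1 - x ^ 2 / 2) := by
    have : (Complex.cos x + Complex.sin x * Complex.I - (1 + x * Complex.I - x ^ 2 / 2) : ℂ) =
        ((Real.cos x - (1 - x ^ 2 / 2) : ℝ) : ℂ) + ((Real.sin x - x : ℝ) : ℂ) * Complex.I := by
      push_cast; ring
    rw [this, Complex.add_re, Complex.ofReal_re, Complex.re_ofReal_mul]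
    simp
  rwa [e] at h

/-- Sums of step functions with prescribed lengths. -/
lemma sum_indicator_sq {ι : Type*} [Fintype ι] (a : ι → ℝ) (N : ι → ℕ) (L : ℕ) (hL : ∀ i, N i ≤ L) :
    ∑ l ∈ Finset.range L, (∑ i, if l < N i then a i else 0) ^ 2 =
      ∑ i, ∑ j, a i * a j * (min (N i) (N j) : ℕ) := by
  simp_rw [sq, Finset.sum_mul_sum]
  rw [Finset.sum_comm]
  refine Finset.sum_congr rfl fun i _ => ?_
  rw [Finset.sum_comm]
  refine Finset.sum_congr rfl fun j _ => ?_
  have : ∀ l, ((if l < N i then a i else 0) * if l < N j then a j else 0) =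
      if l < min (N i) (N j) then a i * a j else 0 := fun l => by
    rw [ite_zero_mul_ite_zero]
    simp only [lt_min_iff]
  simp_rw [this]
  rw [← Finset.sum_filter, Finset.sum_const, nsmul_eq_mul, mul_comm]
  have e : Finset.filter (fun l => l < min (N i) (N j)) (Finset.range L) =
      Finset.range (min (N i) (N j)) := by
    ext l
    have := hL i
    simp only [Finset.mem_filter, Finset.mem_range]
    omega
  rw [e, Finset.card_range]

lemma sum_step_mul {ι : Type*} [Fintype ι] (a : ι → ℝ) (N : ι → ℕ) (L : ℕ) (hL : ∀ i, N i ≤ L)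
    (v : ℕ → ℝ) :
    ∑ l ∈ Finset.range L, (∑ i, if l < N i then a i else 0) * v l =
      ∑ i, a i * ∑ l ∈ Finset.range (N i), v l := by
  simp_rw [Finset.sum_mul, Finset.mul_sum]
  rw [Finset.sum_comm]
  refine Finset.sum_congr rfl fun i _ => ?_
  rw [← Finset.sum_subset (Finset.range_subset_range.2 (hL i))]
  · refine Finset.sum_congr rfl fun l hl => ?_
    rw [if_pos (Finset.mem_range.1 hl)]
  · intro l _ hl
    rw [if_neg (by simpa using hl), zero_mul]

include hYm hex in
/-- Invariance principle for the embedded walk. -/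
theorem tendstoInDistribution_skeleton (hY : IsPreBrownianReal Y P) {ι : Type*} [Fintype ι]
    (t : ι → ℝ≥0) (N : ℕ → ι → ℕ)
    (hN : ∀ i, Tendsto (fun n => (N n i : ℝ) * (mesh n * mesh n)) atTop (𝓝 (t i))) :
    TendstoInDistribution (fun n ω i => (skeletonPos Y n (N n i) ω : ℝ) * mesh n) atTop
      (fun ω i => Y (t i) ω) (fun _ => P) P := by
  refine tendstoInDistribution_pi_of_charFun (fun n => ?_) ?_ fun a => ?_
  · exact (measurable_pi_lambda _ fun i => ((measurable_of_countable _).comp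
      (measurable_skeletonPos hYm hex n _)).mul_const _).aemeasurable
  · exact (measurable_pi_lambda _ fun i => hYm _).aemeasurable
  rw [integral_exp_gaussian hY.isGaussianProcess hY.integral_eval (fun s t => (min s t : ℝ≥0))
    (fun s t => hY.covariance_eval s t) t a]
  set L : ℕ → ℕ := fun n => ∑ i, N n i
  have hL : ∀ n i, N n i ≤ L n := fun n i =>
    Finset.single_le_sum (f := fun i => N n i) (fun _ _ => Nat.zero_le _) (Finset.mem_univ i)
  set c : ℕ → ℕ → ℝ := fun n l => mesh n * ∑ i, if l < N n i then a i else 0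
  have hrew : ∀ n ω, ∑ i, a i * ((skeletonPos Y n (N n i) ω : ℝ) * mesh n) =
      ∑ l ∈ Finset.range (L n), c n l * ((skeletonPos Y n (l + 1) ω : ℝ) - skeletonPos Y n l ω) := by
    intro n ω
    have h1 := sum_step_mul a (N n) (L n) (hL n)
      (fun l => (skeletonPos Y n (l + 1) ω : ℝ) - skeletonPos Y n l ω)
    simp_rw [Finset.sum_range_sub (fun l => (skeletonPos Y n l ω : ℝ)),
      skeletonPos_zero (hex ω)] at h1
    simp only [c, mul_assoc]
    rw [← Finset.mul_sum, h1, Finset.mul_sum]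
    refine Finset.sum_congr rfl fun i _ => ?_
    push_cast; ring
  simp_rw [hrew, fun n => integral_exp_skeleton hYm hex hY n (c n) (L n)]
  have hvar : ∀ n, ∑ l ∈ Finset.range (L n), c n l ^ 2 =
      ∑ i, ∑ j, a i * a j * min ((N n i : ℝ) * (mesh n * mesh n)) (N n j * (mesh n * mesh n)) := by
    intro n
    simp only [c, mul_pow]
    rw [← Finset.mul_sum, sum_indicator_sq a (N n) (L n) (hL n), Finset.mul_sum]
    refine Finset.sum_congr rfl fun i _ => ?_
    rw [Finset.mul_sum]
    refine Finset.sum_congr rfl fun j _ => ?_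
    rw [← min_mul_of_nonneg _ _ (mul_self_nonneg (mesh n)), ← Nat.cast_min]
    ring
  have hvlim : Tendsto (fun n => ∑ l ∈ Finset.range (L n), c n l ^ 2) atTop
      (𝓝 (∑ i, ∑ j, a i * a j * ((min (t i) (t j) : ℝ≥0) : ℝ))) := by
    simp_rw [hvar, NNReal.coe_min]
    exact tendsto_finsetSum _ fun i _ => tendsto_finsetSum _ fun j _ =>
      ((hN i).min (hN j)).const_mul _
  set C : ℝ := ∑ i, |a i|
  have hC0 : 0 ≤ C := Finset.sum_nonneg fun _ _ => abs_nonneg _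
  have hcb : ∀ n l, |c n l| ≤ mesh n * C := fun n l => by
    simp only [c]
    rw [abs_mul, abs_of_pos (mesh_pos n)]
    refine mul_le_mul_of_nonneg_left ((Finset.abs_sum_le_sum_abs _ _).trans
      (Finset.sum_le_sum fun i _ => ?_)) (mesh_pos n).le
    split_ifs
    · exact le_rfl
    · simp
  have herr : ∀ n, ‖∏ l ∈ Finset.range (L n), (Real.cos (c n l) : ℂ) -
      Complex.exp (-((∑ l ∈ Finset.range (L n), c n l ^ 2 : ℝ) / 2 : ℂ))‖ ≤
      (L n * (mesh n * mesh n)) * (4 * mesh n * C ^ 3 + (mesh n) ^ 2 * C ^ 4) := by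
    intro n
    refine (norm_prod_sub_exp_le (Finset.range (L n)) _ _ (fun l => 4 * |c n l| ^ 3)
      (fun l _ => sq_nonneg _) (fun l _ => ?_) (fun l _ => ?_)).trans ?_
    · rw [Complex.norm_real]; exact Real.abs_cos_le_one _
    · have := abs_cos_sub_le (c n l)
      rw [← Real.norm_eq_abs, ← Complex.norm_real] at this
      convert this using 2
      push_cast; ring
    · have hterm : ∀ l ∈ Finset.range (L n), 4 * |c n l| ^ 3 + (c n l ^ 2) ^ 2 ≤
          4 * (mesh n * C) ^ 3 + (mesh n * C) ^ 4 := fun l _ => by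
        have h1 := hcb n l
        have : (c n l ^ 2) ^ 2 = |c n l| ^ 4 := by
          rw [← pow_mul, ← abs_pow, abs_of_nonneg (by positivity)]
        rw [this]
        gcongr
      refine (Finset.sum_le_sum hterm).trans (le_of_eq ?_)
      rw [Finset.sum_const, Finset.card_range, nsmul_eq_mul]
      ring
  have hLlim : Tendsto (fun n => (L n : ℝ) * (mesh n * mesh n)) atTop (𝓝 (∑ i, (t i : ℝ))) := by
    simp only [L, Nat.cast_sum, Finset.sum_mul]
    exact tendsto_finsetSum _ fun i _ => hN i
  have hz : Tendsto (fun n => (L n * (mesh n * mesh n)) *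
      (4 * mesh n * C ^ 3 + (mesh n) ^ 2 * C ^ 4)) atTop (𝓝 0) := by
    have hm := tendsto_mesh
    have h2 : Tendsto (fun n => 4 * mesh n * C ^ 3 + (mesh n) ^ 2 * C ^ 4) atTop (𝓝 0) := by
      have := ((hm.const_mul 4).mul_const (C ^ 3)).add ((hm.pow 2).mul_const (C ^ 4))
      simpa using this
    simpa using hLlim.mul h2
  have hd := squeeze_zero_norm herr hz
  have he : Tendsto (fun n => Complex.exp (-((∑ l ∈ Finset.range (L n), c n l ^ 2 : ℝ) / 2 : ℂ)))
      atTop (𝓝 (Complex.exp (-((∑ i, ∑ j, a i * a j * ((min (t i) (t j) : ℝ≥0) : ℝ) : ℝ) / 2 : ℂ)))) :=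
    (Complex.continuous_exp.tendsto _).comp
      (((Complex.continuous_ofReal.tendsto _).comp hvlim).div_const 2).neg
  have := hd.add he
  simpa using this

end Walk

end IteratedBM
namespace IteratedBM

section GaussianProcess

variable {Ω : Type*} [MeasurableSpace Ω] {P : Measure Ω}

/-- Independent Gaussian processes are jointly Gaussian. -/
lemma isGaussianProcess_sumElim {S T : Type*} {Z : S → Ω → ℝ} {W : T → Ω → ℝ}
    (hZ : IsGaussianProcess Z P) (hW : IsGaussianProcess W P)
    (h : IndepFun (fun ω s => Z s ω) (fun ω t => W t ω) P) :
    IsGaussianProcess (Sum.elim Z W) P where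
  hasGaussianLaw I := by
    classical
    let I₁ : Finset S := I.toLeft
    let I₂ : Finset T := I.toRight
    have h1 := IndepFun.hasGaussianLaw (hZ.hasGaussianLaw I₁) (hW.hasGaussianLaw I₂)
      (h.comp (φ := fun z : S → ℝ => I₁.restrict z) (ψ := fun w : T → ℝ => I₂.restrict w)
        (by fun_prop) (by fun_prop))
    let L : (I₁ → ℝ) × (I₂ → ℝ) →L[ℝ] (I → ℝ) := LinearMap.toContinuousLinearMap
      { toFun x := fun i => match i with
          | ⟨Sum.inl s, hs⟩ => x.1 ⟨s, Finset.mem_toLeft.2 hs⟩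
          | ⟨Sum.inr t, ht⟩ => x.2 ⟨t, Finset.mem_toRight.2 ht⟩
        map_add' x y := by
          ext ⟨i | i, hi⟩ <;> simp
        map_smul' c x := by
          ext ⟨i | i, hi⟩ <;> simp }
    convert! h1.map L using 1
    ext ω ⟨i | i, hi⟩ <;> simp [L]

/-- A family of independent one-sided Brownian motions, described by its covariance. -/
structure IsBrownianFamily {ι : Type*} [DecidableEq ι] (U : ι → ℝ≥0 → Ω → ℝ) (P : Measure Ω) :
    Prop where
  measurable : ∀ i t, Measurable (U i t)
  gaussian : IsGaussianProcess (fun p : ι × ℝ≥0 => U p.1 p.2) P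
  mean : ∀ i t, ∫ ω, U i t ω ∂P = 0
  cov : ∀ i j s t, cov[U i s, U j t; P] = if i = j then ((min s t : ℝ≥0) : ℝ) else 0

namespace IsBrownianFamily

variable {ι κ : Type*} [DecidableEq ι] [DecidableEq κ] {U V : ι → ℝ≥0 → Ω → ℝ}

lemma of_preBrownian {Y : ℝ≥0 → Ω → ℝ} (hYm : ∀ t, Measurable (Y t)) (hY : IsPreBrownianReal Y P) :
    IsBrownianFamily (fun _ : Unit => Y) P where
  measurable _ t := hYm t
  gaussian := hY.isGaussianProcess.comp_right Prod.snd
  mean _ t := hY.integral_eval t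
  cov i j s t := by rw [if_pos rfl]; exact hY.covariance_eval s t

lemma comp (h : IsBrownianFamily U P) {e : κ → ι} (he : Function.Injective e) :
    IsBrownianFamily (fun k => U (e k)) P where
  measurable _ t := h.measurable _ t
  gaussian := h.gaussian.comp_right (fun p : κ × ℝ≥0 => (e p.1, p.2))
  mean _ t := h.mean _ t
  cov i j s t := by rw [h.cov]; simp [he.eq_iff]

/-- Two independent families form one family. -/
lemma prod (hU : IsBrownianFamily U P) (hV : IsBrownianFamily V P)
    (h : IndepFun (fun ω (p : ι × ℝ≥0) => U p.1 p.2 ω) (fun ω (p : ι × ℝ≥0) => V p.1 p.2 ω) P) :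
    IsBrownianFamily (fun b : Bool × ι => cond b.1 (U b.2) (V b.2)) P where
  measurable b t := by rcases b with ⟨_ | _, i⟩ <;> [exact hV.measurable _ _; exact hU.measurable _ _]
  gaussian := by
    have := (isGaussianProcess_sumElim hU.gaussian hV.gaussian h).comp_right
      (fun p : (Bool × ι) × ℝ≥0 => cond p.1.1 (Sum.inl (p.1.2, p.2)) (Sum.inr (p.1.2, p.2)))
    convert! this using 1
    ext ⟨⟨_ | _, i⟩, t⟩ ω <;> rfl
  mean b t := by rcases b with ⟨_ | _, i⟩ <;> [exact hV.mean _ _; exact hU.mean _ _]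
  cov a b s t := by
    have hUV : ∀ i j, cov[U i s, V j t; P] = 0 := fun i j =>
      (h.comp (φ := fun u : ι × ℝ≥0 → ℝ => u (i, s)) (ψ := fun u : ι × ℝ≥0 → ℝ => u (j, t))
        (measurable_pi_apply _) (measurable_pi_apply _)).covariance_eq_zero
        (hU.gaussian.hasGaussianLaw_eval (i, s)).memLp_two
        (hV.gaussian.hasGaussianLaw_eval (j, t)).memLp_two
    have hVU : ∀ i j, cov[V i s, U j t; P] = 0 := fun i j =>
      (h.comp (φ := fun u : ι × ℝ≥0 → ℝ => u (j, t)) (ψ := fun u : ι × ℝ≥0 → ℝ => u (i, s))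
        (measurable_pi_apply _) (measurable_pi_apply _)).symm.covariance_eq_zero
        (hV.gaussian.hasGaussianLaw_eval (i, s)).memLp_two
        (hU.gaussian.hasGaussianLaw_eval (j, t)).memLp_two
    rcases a with ⟨_ | _, i⟩ <;> rcases b with ⟨_ | _, j⟩ <;>
      simp [hU.cov, hV.cov, hUV, hVU, Prod.ext_iff]

lemma isPreBrownian (h : IsBrownianFamily U P) (i : ι) : IsPreBrownianReal (U i) P := by
  have hg : IsGaussianProcess (U i) P := h.gaussian.comp_right (fun t => (i, t))
  refine hg.isPreBrownianReal_of_covariance (h.mean i) fun s t hst => ?_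
  rw [h.cov, if_pos rfl, min_eq_left hst]

lemma memLp_eval (h : IsBrownianFamily U P) (i : ι) (t : ℝ≥0) (p : ℝ≥0) : MemLp (U i t) p P :=
  (h.gaussian.hasGaussianLaw_eval (i, t)).memLp (by simp)

lemma cov_increment (h : IsBrownianFamily U P) (i j : ι) (s t s' t' : ℝ≥0) :
    cov[fun ω => U i t ω - U i s ω, fun ω => U j t' ω - U j s' ω; P] =
      if i = j then ((min t t' : ℝ≥0) : ℝ) - (min t s' : ℝ≥0) - (min s t' : ℝ≥0) + (min s s' : ℝ≥0)
      else 0 := by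
  have := h.gaussian.isProbabilityMeasure
  have m : ∀ i t, MemLp (U i t) 2 P := fun i t =>
    (h.gaussian.hasGaussianLaw_eval (i, t)).memLp_two
  have m' : MemLp (fun ω => U j t' ω - U j s' ω) 2 P := (m _ _).sub (m _ _)
  rw [covariance_fun_sub_left (m _ _) (m _ _) m',
    covariance_fun_sub_right (m _ _) (m _ _) (m _ _), covariance_fun_sub_right (m _ _) (m _ _) (m _ _)]
  have e := h.cov
  have e1 : ∀ i j s t, cov[fun ω => U i s ω, fun ω => U j t ω; P] =
    if i = j then ((min s t : ℝ≥0) : ℝ) else 0 := e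
  simp only [e1]
  split_ifs <;> ring

lemma integral_increment (h : IsBrownianFamily U P) (i : ι) (s t : ℝ≥0) :
    ∫ ω, (U i t ω - U i s ω) ∂P = 0 := by
  have := h.gaussian.isProbabilityMeasure
  rw [integral_sub ((h.isPreBrownian i).integrable_eval _) ((h.isPreBrownian i).integrable_eval _),
    h.mean, h.mean, sub_zero]

lemma integral_increment_mul (h : IsBrownianFamily U P) (i : ι) (s t s' t' : ℝ≥0) :
    ∫ ω, (U i t ω - U i s ω) * (U i t' ω - U i s' ω) ∂P =
      ((min t t' : ℝ≥0) : ℝ) - (min t s' : ℝ≥0) - (min s t' : ℝ≥0) + (min s s' : ℝ≥0) := by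
  have := h.cov_increment i i s t s' t'
  rw [if_pos rfl] at this
  rw [← this, covariance]
  simp [h.integral_increment]

lemma hasLaw_increment (h : IsBrownianFamily U P) (i : ι) {s t : ℝ≥0} (hst : s ≤ t) :
    HasLaw (fun ω => U i t ω - U i s ω) (gaussianReal 0 (t - s)) P := by
  have := (h.isPreBrownian i).hasLaw_sub t s
  convert! this using 2
  ext
  rw [coe_nndist, NNReal.coe_sub hst]
  change _ = dist (t : ℝ) s
  rw [Real.dist_eq, abs_of_nonneg (sub_nonneg.2 (by exact_mod_cast hst))]

/-- The increments over the steps of a common partition are independent. -/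
lemma iIndepFun_increment (h : IsBrownianFamily U P) {t : ℕ → ℝ≥0} (ht : Monotone t) :
    iIndepFun (fun (p : ι × ℕ) ω => U p.1 (t (p.2 + 1)) ω - U p.1 (t p.2) ω) P := by
  have hg : IsGaussianProcess (fun (p : (_ : ι × ℕ) × Unit) ω =>
      U p.1.1 (t (p.1.2 + 1)) ω - U p.1.1 (t p.1.2) ω) P := by
    classical
    have hU := h.gaussian
    refine hU.of_isGaussianProcess fun p => ⟨{(p.1.1, t (p.1.2 + 1)), (p.1.1, t p.1.2)},
      { toFun x := x ⟨(p.1.1, t (p.1.2 + 1)), by simp⟩ - x ⟨(p.1.1, t p.1.2), by simp⟩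
        map_add' x y := by simp; abel
        map_smul' c x := by simp; ring }, by simp⟩
  have := IsGaussianProcess.iIndepFun_of_covariance_eq_zero
    (X := fun (p : ι × ℕ) (_ : Unit) ω => U p.1 (t (p.2 + 1)) ω - U p.1 (t p.2) ω) hg
    (fun p _ => ((h.measurable _ _).sub (h.measurable _ _)).aemeasurable) ?_
  · exact this.comp (fun _ (x : Unit → ℝ) => x ()) fun _ => measurable_pi_apply _
  · rintro ⟨i, k⟩ ⟨j, l⟩ hne _ _
    rw [h.cov_increment]
    split_ifs with hij
    · subst hij
      rcases lt_trichotomy k l with hkl | hkl | hkl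
      · have h1 : t (k + 1) ≤ t l := ht hkl
        have h2 : t k ≤ t (k + 1) := ht k.le_succ
        have h3 : t l ≤ t (l + 1) := ht l.le_succ
        rw [min_eq_left (h1.trans h3), min_eq_left h1, min_eq_left (h2.trans (h1.trans h3)),
          min_eq_left (h2.trans h1)]
        ring
      · exact absurd (by rw [hkl]) hne
      · have h1 : t (l + 1) ≤ t k := ht hkl
        have h2 : t k ≤ t (k + 1) := ht k.le_succ
        have h3 : t l ≤ t (l + 1) := ht l.le_succ
        rw [min_eq_right (h1.trans h2), min_eq_right (h3.trans (h1.trans h2)), min_eq_right h1,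
          min_eq_right (h3.trans h1)]
        ring
    · rfl

/-- Everything that is known about the family when the `i`-th motion is observed up to time `s`. -/
abbrev past (U : ι → ℝ≥0 → Ω → ℝ) (i : ι) (s : ℝ≥0) : MeasurableSpace Ω :=
  MeasurableSpace.comap (fun ω (p : {p : ι × ℝ≥0 // p.1 ≠ i ∨ p.2 ≤ s}) => U p.1.1 p.1.2 ω)
    inferInstance

omit [MeasurableSpace Ω] [DecidableEq ι] in
lemma measurable_past {i j : ι} {s t : ℝ≥0} (h : j ≠ i ∨ t ≤ s) : Measurable[past U i s] (U j t) := by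
  have : U j t = (fun x : {p : ι × ℝ≥0 // p.1 ≠ i ∨ p.2 ≤ s} → ℝ => x ⟨(j, t), h⟩) ∘
    (fun ω p => U p.1.1 p.1.2 ω) := rfl
  rw [this]
  exact (measurable_pi_apply _).comp (comap_measurable _)

/-- Functions of the steps of the `i`-th motion are innovations. -/
lemma isInnovation (h : IsBrownianFamily U P) (i : ι) {t : ℕ → ℝ≥0} (ht : Monotone t)
    {A : ℕ → Ω → ℝ} (hA : ∀ k, Measurable[past U i (t k)] (A k)) (hA2 : ∀ k, MemLp (A k) 2 P)
    {φ : ℕ → ℝ → ℝ} (hφ : ∀ k, Measurable (φ k))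
    (hφ2 : ∀ k, MemLp (fun ω => φ k (U i (t (k + 1)) ω - U i (t k) ω)) 2 P)
    (hφ0 : ∀ k, ∫ ω, φ k (U i (t (k + 1)) ω - U i (t k) ω) ∂P = 0) :
    IsInnovation P (fun k => past U i (t k)) A
      (fun k ω => φ k (U i (t (k + 1)) ω - U i (t k) ω)) where
  mono := by
    intro k l hkl
    refine Measurable.comap_le (@measurable_pi_lambda _ _ _ (past U i (t l)) _ _ fun p => ?_)
    exact measurable_past (p.2.imp_right fun hp => hp.trans (ht hkl))
  le k := Measurable.comap_le (measurable_pi_lambda _ fun p => h.measurable _ _)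
  measA := hA
  measQ k := (hφ k).comp ((measurable_past (Or.inr le_rfl)).sub
    (measurable_past (Or.inr (ht k.le_succ))))
  indep k := by
    have hg : IsGaussianProcess (Sum.elim (fun _ : Unit => fun ω => U i (t (k + 1)) ω - U i (t k) ω)
        (fun (p : {p : ι × ℝ≥0 // p.1 ≠ i ∨ p.2 ≤ t k}) ω => U p.1.1 p.1.2 ω)) P := by
      classical
      have hU := h.gaussian
      refine hU.of_isGaussianProcess fun p => ?_
      rcases p with _ | p
      · exact ⟨{(i, t (k + 1)), (i, t k)},
          { toFun x := x ⟨(i, t (k + 1)), by simp⟩ - x ⟨(i, t k), by simp⟩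
            map_add' x y := by simp; abel
            map_smul' c x := by simp; ring }, by simp⟩
      · exact ⟨{p.1},
          { toFun x := x ⟨p.1, by simp⟩
            map_add' x y := by simp
            map_smul' c x := by simp }, by simp⟩
    have hi := hg.indepFun_of_covariance_eq_zero
      (fun _ => ((h.measurable _ _).sub (h.measurable _ _)).aemeasurable)
      (fun p => (h.measurable _ _).aemeasurable) ?_
    · rw [IndepFun_iff_Indep] at hi
      refine indep_of_indep_of_le_left hi (Measurable.comap_le ?_)
      have : (fun ω => φ k (U i (t (k + 1)) ω - U i (t k) ω)) = (fun x : Unit → ℝ => φ k (x ())) ∘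
        (fun ω _ => U i (t (k + 1)) ω - U i (t k) ω) := rfl
      rw [this]
      exact ((hφ k).comp (measurable_pi_apply _)).comp (comap_measurable _)
    · rintro _ ⟨⟨j, s⟩, hj⟩
      have := h.gaussian.isProbabilityMeasure
      have m : ∀ i t, MemLp (U i t) 2 P := fun i t =>
        (h.gaussian.hasGaussianLaw_eval (i, t)).memLp_two
      rw [covariance_fun_sub_left (m _ _) (m _ _) (m _ _)]
      have e1 : ∀ i j s t, cov[fun ω => U i s ω, fun ω => U j t ω; P] =
        if i = j then ((min s t : ℝ≥0) : ℝ) else 0 := h.cov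
      rw [e1, e1]
      split_ifs with hij
      · subst hij
        have hs : s ≤ t k := by simpa using hj
        rw [min_eq_right hs, min_eq_right (hs.trans (ht k.le_succ)), sub_self]
      · simp
  memA := hA2
  memQ := hφ2
  mean := hφ0

lemma indepFun (h : IsBrownianFamily U P) {i j : ι} (hij : i ≠ j) :
    IndepFun (fun ω s => U i s ω) (fun ω s => U j s ω) P := by
  refine IsGaussianProcess.indepFun_of_covariance_eq_zero ?_ (fun _ => (h.measurable _ _).aemeasurable)
    (fun _ => (h.measurable _ _).aemeasurable) fun s t => by rw [h.cov, if_neg hij]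
  have := h.gaussian.comp_right (fun p : ℝ≥0 ⊕ ℝ≥0 => Sum.elim (fun s => (i, s)) (fun s => (j, s)) p)
  convert! this using 1
  ext (s | s) ω <;> rfl

end IsBrownianFamily

/-- Two independent two-sided Brownian motions, as four one-sided ones: the first component tells
the motion, the second one the half-line. -/
def halfLines (X B : ℝ → Ω → ℝ) (b : Bool × Bool) (t : ℝ≥0) (ω : Ω) : ℝ :=
  cond b.1 X B (cond b.2 (t : ℝ) (-(t : ℝ))) ω

lemma isBrownianFamily_halfLines {X B : ℝ → Ω → ℝ} (hX : IsTwoSidedBrownian X P)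
    (hB : IsTwoSidedBrownian B P) (h : IndepFun (fun ω t => X t ω) (fun ω t => B t ω) P) :
    IsBrownianFamily (halfLines X B) P := by
  have one : ∀ Z : ℝ → Ω → ℝ, IsTwoSidedBrownian Z P → IsBrownianFamily
      (fun b : Bool × Unit => cond b.1 (fun (t : ℝ≥0) => Z t) (fun (t : ℝ≥0) => Z (-(t : ℝ)))) P := by
    intro Z hZ
    refine (IsBrownianFamily.of_preBrownian (fun t => hZ.measurable _)
      hZ.pos.toIsPreBrownianReal).prod (IsBrownianFamily.of_preBrownian
      (fun t => hZ.measurable _) hZ.neg.toIsPreBrownianReal) ?_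
    exact hZ.indep.comp (φ := fun z (p : Unit × ℝ≥0) => z p.2) (ψ := fun z (p : Unit × ℝ≥0) => z p.2)
      (measurable_pi_lambda _ fun _ => measurable_pi_apply _)
      (measurable_pi_lambda _ fun _ => measurable_pi_apply _)
  have := (one X hX).prod (one B hB) ?_
  · have h2 := this.comp (e := fun b : Bool × Bool => (b.1, b.2, ())) (by
      rintro ⟨a, b⟩ ⟨c, d⟩ hh; simpa using hh)
    convert! h2 using 1
    ext ⟨_ | _, _ | _⟩ t ω <;> rfl
  · have := h.comp (φ := fun z (p : (Bool × Unit) × ℝ≥0) => z (cond p.1.1 (p.2 : ℝ) (-(p.2 : ℝ))))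
      (ψ := fun z (p : (Bool × Unit) × ℝ≥0) => z (cond p.1.1 (p.2 : ℝ) (-(p.2 : ℝ))))
      (measurable_pi_lambda _ fun _ => measurable_pi_apply _)
      (measurable_pi_lambda _ fun _ => measurable_pi_apply _)
    convert! this using 1
    · ext ω ⟨⟨_ | _, _⟩, t⟩ <;> rfl
    · ext ω ⟨⟨_ | _, _⟩, t⟩ <;> rfl

end GaussianProcess

end IteratedBM
namespace IteratedBM

section Moments

/-- Continuous functions of polynomial growth. -/
structure PolyGrowth (φ : ℝ → ℝ) : Prop where
  cont : Continuous φ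
  bound : ∃ C n, ∀ x, |φ x| ≤ C * (1 + x ^ 2) ^ (n : ℕ)

namespace PolyGrowth

variable {φ ψ : ℝ → ℝ}

lemma const (c : ℝ) : PolyGrowth fun _ => c := ⟨continuous_const, |c|, 0, fun x => by simp⟩

lemma id : PolyGrowth fun x => x := ⟨continuous_id, 1, 1, fun x => by
  rw [one_mul, pow_one, abs_le]; constructor <;> nlinarith [sq_nonneg (x - 1), sq_nonneg (x + 1)]⟩

lemma abs (h : PolyGrowth φ) : PolyGrowth fun x => |φ x| :=
  ⟨h.cont.abs, by simpa using h.bound⟩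

lemma mul (h : PolyGrowth φ) (h' : PolyGrowth ψ) : PolyGrowth fun x => φ x * ψ x := by
  obtain ⟨C, n, hC⟩ := h.bound
  obtain ⟨D, m, hD⟩ := h'.bound
  refine ⟨h.cont.mul h'.cont, C * D, n + m, fun x => ?_⟩
  rw [abs_mul, pow_add, mul_mul_mul_comm]
  exact mul_le_mul (hC x) (hD x) (abs_nonneg _) ((abs_nonneg _).trans (hC x))

lemma add (h : PolyGrowth φ) (h' : PolyGrowth ψ) : PolyGrowth fun x => φ x + ψ x := by
  obtain ⟨C, n, hC⟩ := h.bound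
  obtain ⟨D, m, hD⟩ := h'.bound
  refine ⟨h.cont.add h'.cont, |C| + |D|, n + m, fun x => (abs_add_le _ _).trans ?_⟩
  have h1 : (1 : ℝ) ≤ 1 + x ^ 2 := by nlinarith [sq_nonneg x]
  rw [add_mul]
  refine add_le_add ((hC x).trans ?_) ((hD x).trans ?_)
  · exact mul_le_mul (le_abs_self C) (pow_le_pow_right₀ h1 (by omega)) (by positivity) (abs_nonneg _)
  · exact mul_le_mul (le_abs_self D) (pow_le_pow_right₀ h1 (by omega)) (by positivity) (abs_nonneg _)

lemma const_mul (h : PolyGrowth φ) (c : ℝ) : PolyGrowth fun x => c * φ x := (const c).mul h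

lemma sub (h : PolyGrowth φ) (h' : PolyGrowth ψ) : PolyGrowth fun x => φ x - ψ x := by
  simpa [sub_eq_add_neg] using h.add (h'.const_mul (-1))

lemma pow (h : PolyGrowth φ) (n : ℕ) : PolyGrowth fun x => φ x ^ n := by
  induction n with
  | zero => simpa using const 1
  | succ n ih => simpa [pow_succ] using ih.mul h

lemma integrable (h : PolyGrowth φ) : Integrable φ (gaussianReal 0 1) := by
  obtain ⟨C, n, hC⟩ := h.bound
  have hp : ∀ k : ℕ, Integrable (fun x : ℝ => x ^ k) (gaussianReal 0 1) := fun k => by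
    have := (memLp_id_gaussianReal (μ := 0) (v := 1) (k : ℝ≥0)).integrable_norm_pow'
    refine (integrable_norm_iff (by fun_prop)).1 ?_
    simpa using this
  have : Integrable (fun x : ℝ => C * (1 + x ^ 2) ^ n) (gaussianReal 0 1) := by
    refine Integrable.const_mul ?_ C
    simp_rw [add_pow, ← pow_mul]
    refine integrable_finsetSum _ fun k _ => ?_
    simpa using (hp _).mul_const _
  exact this.mono' h.cont.aestronglyMeasurable (ae_of_all _ hC)

lemma memLp (h : PolyGrowth φ) (n : ℕ) : MemLp φ n (gaussianReal 0 1) := by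
  by_cases hn : n = 0
  · subst hn; simpa using h.cont.aestronglyMeasurable
  · refine (integrable_norm_rpow_iff h.cont.aestronglyMeasurable (by simpa) (by simp)).1 ?_
    simpa using (h.abs.pow n).integrable

end PolyGrowth

lemma integral_comp_neg_gaussian (φ : ℝ → ℝ) :
    ∫ x, φ (-x) ∂(gaussianReal 0 1) = ∫ x, φ x ∂(gaussianReal 0 1) := by
  have : (gaussianReal 0 1).map (fun x : ℝ => -x) = gaussianReal 0 1 := by
    rw [gaussianReal_map_neg, neg_zero]
  conv_rhs => rw [← this]
  exact ((MeasurableEquiv.neg ℝ).measurableEmbedding.integral_map φ).symm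

lemma gaussMoment_odd {k : ℕ} (hk : Odd k) : gaussMoment k = 0 := by
  have := integral_comp_neg_gaussian (fun x => x ^ k)
  simp only [hk.neg_pow, integral_neg] at this
  unfold gaussMoment
  linarith

lemma gaussMoment_two : gaussMoment 2 = 1 := by
  have h2 := variance_eq_integral (X := fun x : ℝ => x) (μ := gaussianReal 0 1) (by fun_prop)
  rw [integral_id_gaussianReal, variance_fun_id_gaussianReal] at h2
  simpa [gaussMoment] using h2.symm

/-- The coefficient of the Stratonovich integral. -/
noncomputable def linCoeff (κ : ℕ) : ℝ := if Odd κ then gaussMoment (κ + 1) else 0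

/-- The `κ`-th power without its constant and linear Hermite components. -/
noncomputable def residual (κ : ℕ) (x : ℝ) : ℝ := x ^ κ - linCoeff κ * x - gaussMoment κ

variable (κ : ℕ)

lemma polyGrowth_residual : PolyGrowth (residual κ) :=
  ((PolyGrowth.id.pow κ).sub (PolyGrowth.id.const_mul _)).sub (PolyGrowth.const _)

lemma integral_pow_gaussian (k : ℕ) : ∫ x, x ^ k ∂(gaussianReal 0 1) = gaussMoment k := rfl

lemma integral_id_gaussian : ∫ x, x ∂(gaussianReal 0 1) = 0 := by
  simp

lemma integral_residual : ∫ x, residual κ x ∂(gaussianReal 0 1) = 0 := by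
  unfold residual
  have h1 := (PolyGrowth.id.pow κ).integrable
  have h2 := (PolyGrowth.id.const_mul (linCoeff κ)).integrable
  have h3 : Integrable (fun x : ℝ => x ^ κ - linCoeff κ * x) (gaussianReal 0 1) := h1.sub h2
  rw [integral_sub h3 (integrable_const _), integral_sub h1 h2, integral_const_mul,
    integral_id_gaussian, integral_pow_gaussian]
  simp

lemma linCoeff_mul_moment : linCoeff κ * gaussMoment κ = 0 := by
  unfold linCoeff
  split_ifs with h
  · rw [gaussMoment_odd h, mul_zero]
  · simp

lemma integral_mul_residual : ∫ x, x * residual κ x ∂(gaussianReal 0 1) = 0 := by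
  have e : ∀ x, x * residual κ x = x ^ (κ + 1) - linCoeff κ * x ^ 2 - gaussMoment κ * x := fun x => by
    unfold residual; ring
  simp_rw [e]
  have h1 := (PolyGrowth.id.pow (κ + 1)).integrable
  have h2 := ((PolyGrowth.id.pow 2).const_mul (linCoeff κ)).integrable
  have h4 := (PolyGrowth.id.const_mul (gaussMoment κ)).integrable
  have h3 : Integrable (fun x : ℝ => x ^ (κ + 1) - linCoeff κ * x ^ 2) (gaussianReal 0 1) := h1.sub h2
  rw [integral_sub h3 h4, integral_sub h1 h2, integral_const_mul, integral_const_mul,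
    integral_id_gaussian, integral_pow_gaussian, integral_pow_gaussian, gaussMoment_two]
  unfold linCoeff
  split_ifs with h
  · simp
  · simp [gaussMoment_odd (Nat.not_odd_iff_even.1 h).add_one]

/-- The variance of the residual. -/
noncomputable def residualVar (κ : ℕ) : ℝ := ∫ x, residual κ x ^ 2 ∂(gaussianReal 0 1)

lemma residualVar_nonneg : 0 ≤ residualVar κ := integral_nonneg fun _ => sq_nonneg _

lemma residualVar_eq : residualVar κ = gaussMoment (2 * κ) - linCoeff κ ^ 2 - gaussMoment κ ^ 2 := by
  have e : ∀ x, residual κ x ^ 2 = x ^ (2 * κ) - 2 * gaussMoment κ * x ^ κ + linCoeff κ ^ 2 * x ^ 2 +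
      (2 * (linCoeff κ * gaussMoment κ)) * x + gaussMoment κ ^ 2
      - 2 * linCoeff κ * x ^ (κ + 1) := fun x => by
    unfold residual; ring
  unfold residualVar
  simp_rw [e, linCoeff_mul_moment]
  simp only [mul_zero, zero_mul, add_zero]
  have h1 := (PolyGrowth.id.pow (2 * κ)).integrable
  have h2 := ((PolyGrowth.id.pow κ).const_mul (2 * gaussMoment κ)).integrable
  have h3 := ((PolyGrowth.id.pow 2).const_mul (linCoeff κ ^ 2)).integrable
  have h4 := ((PolyGrowth.id.pow (κ + 1)).const_mul (2 * linCoeff κ)).integrable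
  have j1 : Integrable (fun x : ℝ => x ^ (2 * κ) - 2 * gaussMoment κ * x ^ κ) (gaussianReal 0 1) :=
    h1.sub h2
  have j2 : Integrable (fun x : ℝ => x ^ (2 * κ) - 2 * gaussMoment κ * x ^ κ + linCoeff κ ^ 2 * x ^ 2)
    (gaussianReal 0 1) := j1.add h3
  have j3 : Integrable (fun x : ℝ => x ^ (2 * κ) - 2 * gaussMoment κ * x ^ κ + linCoeff κ ^ 2 * x ^ 2
    + gaussMoment κ ^ 2) (gaussianReal 0 1) := j2.add (integrable_const _)
  rw [integral_sub j3 h4, integral_add j2 (integrable_const _), integral_add j1 h3,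
    integral_sub h1 h2]
  simp only [integral_const_mul, integral_pow_gaussian, gaussMoment_two, integral_const,
    probReal_univ, one_smul]
  have : linCoeff κ * gaussMoment (κ + 1) = linCoeff κ ^ 2 := by
    unfold linCoeff
    split_ifs <;> ring
  linear_combination (-2) * this

/-- The sign of the `k`-th step in the signed power variation. -/
def stepSign (κ k : ℕ) : ℝ := if Odd k then 1 else (-1) ^ (κ + 1)

lemma stepSign_sq (k : ℕ) : stepSign κ k ^ 2 = 1 := by
  unfold stepSign
  split_ifs
  · simp
  · rw [← pow_mul, mul_comm, pow_mul]; simp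

lemma abs_stepSign (k : ℕ) : |stepSign κ k| = 1 := by
  unfold stepSign; split_ifs <;> simp

lemma one_add_sign_mul_moment : (1 + (-1) ^ (κ + 1)) * gaussMoment κ = 0 := by
  rcases Nat.even_or_odd κ with h | h
  · rw [h.add_one.neg_one_pow]; ring
  · rw [gaussMoment_odd h, mul_zero]

lemma sign_mul_linCoeff : (-1) ^ (κ + 1) * linCoeff κ = linCoeff κ := by
  unfold linCoeff
  split_ifs with h
  · rw [h.add_one.neg_one_pow, one_mul]
  · simp

end Moments

section Taylor

lemma abs_le_of_hasDerivAt {g g' : ℝ → ℝ} {x C : ℝ} {n : ℕ} (hC : 0 ≤ C)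
    (hg : ∀ t, HasDerivAt g (g' t) t) (h0 : g x = 0) (hb : ∀ t, |g' t| ≤ C * |t - x| ^ n) (y : ℝ) :
    |g y| ≤ C * |y - x| ^ (n + 1) := by
  have := (convex_uIcc x y).norm_image_sub_le_of_norm_hasDerivWithin_le (f := g) (f' := g')
    (C := C * |y - x| ^ n) (fun t _ => (hg t).hasDerivWithinAt) (fun t ht => ?_)
    Set.left_mem_uIcc Set.right_mem_uIcc
  · rw [h0, sub_zero, Real.norm_eq_abs, Real.norm_eq_abs] at this
    rwa [pow_succ, ← mul_assoc]
  · rw [Real.norm_eq_abs]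
    refine (hb t).trans ?_
    exact mul_le_mul_of_nonneg_left
      (pow_le_pow_left₀ (abs_nonneg _) (Set.abs_sub_left_of_mem_uIcc ht) _) hC

/-- The integrand `f`, its derivative, its antiderivative and a bound for `f'` and the Lipschitz
constant of `f'`. -/
structure IsWeight (f f' F : ℝ → ℝ) (C : ℝ) : Prop where
  nonneg : 0 ≤ C
  derivF : ∀ x, HasDerivAt F (f x) x
  deriv : ∀ x, HasDerivAt f (f' x) x
  bound : ∀ x, |f' x| ≤ C
  lip : ∀ x y, |f' y - f' x| ≤ C * |y - x|

namespace IsWeight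

variable {f f' F : ℝ → ℝ} {C : ℝ}

lemma abs_sub_le (h : IsWeight f f' F C) (x y : ℝ) : |f y - f x| ≤ C * |y - x| := by
  have := abs_le_of_hasDerivAt (g := fun t => f t - f x) (n := 0) (x := x) h.nonneg
    (fun t => (h.deriv t).sub_const _) (by simp) (fun t => by simpa using h.bound t) y
  simpa using this

lemma abs_taylor_one (h : IsWeight f f' F C) (x y : ℝ) :
    |f y - f x - f' x * (y - x)| ≤ C * |y - x| ^ 2 := by
  refine abs_le_of_hasDerivAt (g := fun t => f t - f x - f' x * (t - x)) (n := 1) h.nonneg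
    (fun t => ((h.deriv t).sub_const _).sub (((hasDerivAt_id t).sub_const x).const_mul (f' x)))
    (by simp) (fun t => ?_) y
  simpa using h.lip x t

lemma abs_taylor_two (h : IsWeight f f' F C) (x y : ℝ) :
    |F y - F x - f x * (y - x) - f' x / 2 * (y - x) ^ 2| ≤ C * |y - x| ^ 3 := by
  refine abs_le_of_hasDerivAt (g := fun t => F t - F x - f x * (t - x) - f' x / 2 * (t - x) ^ 2)
    (g' := fun t => f t - f x - f' x * (t - x)) (n := 2) h.nonneg
    (fun t => ?_) (by simp) (fun t => h.abs_taylor_one x t) y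
  have := ((((h.derivF t).sub_const (F x)).sub
    (((hasDerivAt_id t).sub_const x).const_mul (f x))).sub
    ((((hasDerivAt_id t).sub_const x).pow 2).const_mul (f' x / 2)))
  refine this.congr_deriv ?_
  simp; ring

lemma cont (h : IsWeight f f' F C) : Continuous f :=
  continuous_iff_continuousAt.2 fun x => (h.deriv x).continuousAt

lemma contF (h : IsWeight f f' F C) : Continuous F :=
  continuous_iff_continuousAt.2 fun x => (h.derivF x).continuousAt

lemma cont' (h : IsWeight f f' F C) : Continuous f' := by
  refine (LipschitzWith.of_dist_le_mul (K := ⟨C, h.nonneg⟩) fun x y => ?_).continuous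
  exact h.lip y x

lemma abs_le (h : IsWeight f f' F C) (x : ℝ) : |f x| ≤ |f 0| + C * |x| := by
  have := h.abs_sub_le 0 x
  rw [sub_zero] at this
  calc |f x| = |f 0 + (f x - f 0)| := by ring_nf
    _ ≤ _ := (abs_add_le _ _).trans (by gcongr)

lemma exists_of_contDiff (hf : ContDiff ℝ 2 f) (h1 : ∃ C, ∀ x, |_root_.deriv f x| ≤ C)
    (h2 : ∃ C, ∀ x, |_root_.deriv (_root_.deriv f) x| ≤ C) :
    ∃ C, IsWeight f (_root_.deriv f) (fun x => ∫ t in (0 : ℝ)..x, f t) C := by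
  obtain ⟨C₁, hC₁⟩ := h1
  obtain ⟨C₂, hC₂⟩ := h2
  have hd : ContDiff ℝ 1 (_root_.deriv f) := by
    have : ContDiff ℝ (1 + 1) f := hf
    exact (contDiff_succ_iff_deriv.1 this).2.2
  refine ⟨max C₁ C₂, (abs_nonneg _).trans ((hC₁ 0).trans (le_max_left _ _)), fun x => ?_, fun x => ?_,
    fun x => (hC₁ x).trans (le_max_left _ _), fun x y => ?_⟩
  · exact intervalIntegral.integral_hasDerivAt_right (hf.continuous.intervalIntegrable _ _)
      hf.continuous.stronglyMeasurable.stronglyMeasurableAtFilter hf.continuous.continuousAt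
  · exact (hf.differentiable (by norm_num) x).hasDerivAt
  · have := abs_le_of_hasDerivAt (g := fun t => _root_.deriv f t - _root_.deriv f x)
      (C := max C₁ C₂) (n := 0) (x := x)
      ((abs_nonneg _).trans ((hC₁ 0).trans (le_max_left _ _)))
      (fun t => ((hd.differentiable (by norm_num) t).hasDerivAt).sub_const _) (by simp)
      (fun t => by simpa using Or.inr (hC₂ t)) y
    simpa using this

end IsWeight

end Taylor

end IteratedBM
namespace IteratedBM

section Blocks

/-- The left endpoint of the block of `{0, …, n - 1}` containing `k`, when this set is divided into
`r` blocks of almost equal length. -/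
def blockStart (n r k : ℕ) : ℕ := n * ((r * (k + 1) - 1) / n) / r

lemma blockStart_le {n r k : ℕ} (hr : 0 < r) : blockStart n r k ≤ k := by
  unfold blockStart
  have h1 : n * ((r * (k + 1) - 1) / n) ≤ r * (k + 1) - 1 := Nat.mul_div_le _ _
  have h2 : 0 < r * (k + 1) := by positivity
  refine Nat.lt_succ_iff.1 ((Nat.div_lt_iff_lt_mul hr).2 ?_)
  rw [Nat.succ_eq_add_one, mul_comm (k + 1)]
  omega

lemma sub_blockStart_le {n r k : ℕ} (hr : 0 < r) (hn : 0 < n) :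
    (k : ℝ) - blockStart n r k ≤ n / r := by
  unfold blockStart
  set j := (r * (k + 1) - 1) / n with hj
  have h1 : r * (k + 1) - 1 < n * (j + 1) := by
    exact Nat.lt_mul_div_succ _ hn
  have h2 : n * j < r * (n * j / r + 1) := by
    have := Nat.lt_mul_div_succ (n * j) hr
    exact this
  have h3 : r * (k + 1) ≤ n * j + n := by
    rw [mul_add n, mul_one] at h1; omega
  have h4 : r * k < r * (n * j / r) + n := by rw [mul_add, mul_one] at h2 h3; omega
  have h5 : (r : ℝ) * k < r * (n * j / r : ℕ) + n := by exact_mod_cast h4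
  have hr' : (0 : ℝ) < r := by exact_mod_cast hr
  rw [le_div_iff₀ hr']
  nlinarith

lemma blockStart_eq {n r k j : ℕ} (hr : 0 < r) (h1 : n * j / r ≤ k) (h2 : k < n * (j + 1) / r) :
    blockStart n r k = n * j / r := by
  unfold blockStart
  have a1 : n * j < (k + 1) * r := (Nat.div_lt_iff_lt_mul hr).1 (Nat.lt_succ_iff.2 h1)
  have a2 : (k + 1) * r ≤ n * (j + 1) := (Nat.le_div_iff_mul_le hr).1 h2
  have hn : 0 < n := by
    rcases Nat.eq_zero_or_pos n with rfl | h
    · simp at h2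
    · exact h
  have : (r * (k + 1) - 1) / n = j := by
    rw [mul_comm r]
    apply Nat.div_eq_of_lt_le
    · rw [mul_comm j]; omega
    · rw [mul_comm (j + 1)]
      have : 0 < (k + 1) * r := by positivity
      omega
  rw [this]

lemma sum_blocks (n r : ℕ) (hr : 0 < r) (a V : ℕ → ℝ) :
    ∑ j ∈ Finset.range r, a (n * j / r) * (∑ k ∈ Finset.range (n * (j + 1) / r), V k -
      ∑ k ∈ Finset.range (n * j / r), V k) =
      ∑ k ∈ Finset.range n, a (blockStart n r k) * V k := by
  have key : ∀ s, ∑ j ∈ Finset.range s, a (n * j / r) * (∑ k ∈ Finset.range (n * (j + 1) / r), V k -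
      ∑ k ∈ Finset.range (n * j / r), V k) =
      ∑ k ∈ Finset.range (n * s / r), a (blockStart n r k) * V k := by
    intro s
    induction s with
    | zero => simp
    | succ s ih =>
      have hle : n * s / r ≤ n * (s + 1) / r := Nat.div_le_div_right (Nat.mul_le_mul_left _ s.le_succ)
      rw [Finset.sum_range_succ, ih, ← Finset.sum_range_add_sum_Ico V hle, add_sub_cancel_left,
        Finset.mul_sum, ← Finset.sum_range_add_sum_Ico (fun k => a (blockStart n r k) * V k) hle]
      congr 1
      refine Finset.sum_congr rfl fun k hk => ?_
      rw [Finset.mem_Ico] at hk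
      rw [blockStart_eq hr hk.1 hk.2]
  rw [key r, Nat.mul_div_cancel _ hr]

end Blocks

section Steps

variable {Ω : Type*} [MeasurableSpace Ω] {P : Measure Ω} {ι : Type*} [DecidableEq ι]
  {U : ι → ℝ≥0 → Ω → ℝ}

/-- The normalized steps of the `i`-th motion. -/
noncomputable def normStep (U : ι → ℝ≥0 → Ω → ℝ) (i : ι) (δ : ℝ≥0) (k : ℕ) (ω : Ω) : ℝ :=
  (U i (((k + 1 : ℕ) : ℝ≥0) * δ) ω - U i ((k : ℝ≥0) * δ) ω) / √(δ : ℝ)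

lemma monotone_gridTime (δ : ℝ≥0) : Monotone fun k : ℕ => (k : ℝ≥0) * δ := fun _ _ h => by
  simp only; gcongr

namespace IsBrownianFamily

variable (h : IsBrownianFamily U P) {δ : ℝ≥0} (hδ : 0 < δ)

include h

lemma measurable_normStep (i : ι) (k : ℕ) : Measurable (normStep U i δ k) :=
  ((h.measurable _ _).sub (h.measurable _ _)).div_const _

include hδ

lemma hasLaw_normStep (i : ι) (k : ℕ) : HasLaw (normStep U i δ k) (gaussianReal 0 1) P := by
  have h1 := h.hasLaw_increment i (monotone_gridTime δ k.le_succ)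
  have e : ((k + 1 : ℕ) : ℝ≥0) * δ - (k : ℝ≥0) * δ = δ := by
    push_cast; rw [add_mul, one_mul, add_tsub_cancel_left]
  have h2 : HasLaw (fun x : ℝ => x / √(δ : ℝ)) (gaussianReal 0 1) (gaussianReal 0 δ) := by
    refine ⟨by fun_prop, ?_⟩
    rw [gaussianReal_map_div_const]
    congr 1
    · simp
    · ext
      have : (0 : ℝ) < δ := by exact_mod_cast hδ
      simp [Real.sq_sqrt this.le, this.ne']
  simp only [Nat.succ_eq_add_one] at h1
  rw [e] at h1
  exact h2.comp h1

lemma integral_normStep (i : ι) (k : ℕ) {φ : ℝ → ℝ} (hφ : Continuous φ) :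
    ∫ ω, φ (normStep U i δ k ω) ∂P = ∫ x, φ x ∂(gaussianReal 0 1) :=
  (h.hasLaw_normStep hδ i k).integral_comp hφ.aestronglyMeasurable

lemma memLp_normStep (i : ι) (k : ℕ) {φ : ℝ → ℝ} (hφ : PolyGrowth φ) (p : ℕ) :
    MemLp (fun ω => φ (normStep U i δ k ω)) p P := by
  have hl := h.hasLaw_normStep hδ i k
  have := hφ.memLp p
  rw [← hl.map_eq] at this
  exact this.comp_of_map hl.aemeasurable

lemma integrable_normStep (i : ι) (k : ℕ) {φ : ℝ → ℝ} (hφ : PolyGrowth φ) :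
    Integrable (fun ω => φ (normStep U i δ k ω)) P := by
  simpa [memLp_one_iff_integrable] using h.memLp_normStep hδ i k hφ 1

/-- Orthogonality of the steps. -/
lemma integral_sq_weighted_le (i : ι) {A : ℕ → Ω → ℝ}
    (hA : ∀ k : ℕ, Measurable[past U i ((k : ℝ≥0) * δ)] (A k)) (hA2 : ∀ k, MemLp (A k) 2 P)
    {φ : ℕ → ℝ → ℝ} (hφ : ∀ k, PolyGrowth (φ k)) (hφ0 : ∀ k, ∫ x, φ k x ∂(gaussianReal 0 1) = 0)
    {v : ℝ} (hv : ∀ k, ∫ x, φ k x ^ 2 ∂(gaussianReal 0 1) ≤ v) (N : ℕ) :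
    MemLp (fun ω => ∑ k ∈ Finset.range N, A k ω * φ k (normStep U i δ k ω)) 2 P ∧
    ∫ ω, (∑ k ∈ Finset.range N, A k ω * φ k (normStep U i δ k ω)) ^ 2 ∂P ≤
      v * ∑ k ∈ Finset.range N, ∫ ω, A k ω ^ 2 ∂P := by
  have hin := h.isInnovation i (monotone_gridTime δ) hA hA2 (φ := fun k x => φ k (x / √(δ : ℝ)))
    (fun k => by have := (hφ k).cont; fun_prop) (fun k => by exact_mod_cast h.memLp_normStep hδ i k (hφ k) 2)
    (fun k => (h.integral_normStep hδ i k (hφ k).cont).trans (hφ0 k))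
  refine ⟨hin.memLp_sum N, ?_⟩
  have := hin.integral_sq_sum N
  refine this.trans_le ?_
  rw [Finset.mul_sum]
  refine Finset.sum_le_sum fun k _ => ?_
  rw [mul_comm]
  refine mul_le_mul_of_nonneg_right ?_ (integral_nonneg fun _ => sq_nonneg _)
  exact (h.integral_normStep hδ i k ((hφ k).cont.pow 2)).trans_le (hv k)

end IsBrownianFamily

lemma integral_abs_le_sqrt [IsProbabilityMeasure P] {M : Ω → ℝ} (hM : MemLp M 2 P) {v : ℝ}
    (hv : ∫ ω, M ω ^ 2 ∂P ≤ v) : ∫ ω, |M ω| ∂P ≤ √v := by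
  have hM2 : MemLp (fun ω => |M ω|) 2 P := hM.abs
  have := variance_nonneg (fun ω => |M ω|) P
  rw [variance_eq_sub hM2] at this
  refine Real.le_sqrt_of_sq_le ?_
  simp only [Pi.pow_apply, sq_abs] at this
  linarith

/-- The martingale part of the normalized signed variation along one half-line. -/
noncomputable def residualSum (U : ι → ℝ≥0 → Ω → ℝ) (κ : ℕ) (i : ι) (δ : ℝ≥0) (N : ℕ) (ω : Ω) : ℝ :=
  ∑ k ∈ Finset.range N, √(δ : ℝ) * (stepSign κ k * residual κ (normStep U i δ k ω))

/-- Taylor expansion of one term of the signed variation. -/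
lemma abs_term_expansion_le {f f' F : ℝ → ℝ} {C : ℝ} (hf : IsWeight f f' F C) (κ : ℕ) {r : ℝ}
    (hr : 0 < r) (a ξ ξ' : ℝ) {a₀ a₂ : ℝ} (h0 : a₀ = a - r * ξ) (h2 : a₂ = a + r * ξ') :
    |r / r ^ κ * (f a * ((a₂ - a) ^ κ + (-1) ^ (κ + 1) * (a - a₀) ^ κ)) - linCoeff κ * (F a₂ - F a₀)
      - (f a₀ * (r * ((-1) ^ (κ + 1) * residual κ ξ)) + f a * (r * residual κ ξ'))
      - (r ^ 2 * f' a₀ * (linCoeff κ / 2 * (ξ ^ 2 - 1) + (-1) ^ (κ + 1) * (ξ * residual κ ξ)) +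
          r ^ 2 * f' a * (-(linCoeff κ / 2) * (ξ' ^ 2 - 1)))| ≤
      C * r ^ 3 * ((|linCoeff κ| * |ξ| ^ 3 + |linCoeff κ| * (|ξ| * |ξ ^ 2 - 1|) +
        |ξ| ^ 2 * |residual κ ξ|) + |linCoeff κ| * |ξ'| ^ 3) := by
  set s : ℝ := (-1) ^ (κ + 1) with hs
  have hsabs : |s| = 1 := by simp [hs]
  have T1 := hf.abs_taylor_two a a₂
  have T2 := hf.abs_taylor_two a a₀
  have T3 := hf.abs_taylor_one a₀ a
  have T4 := hf.lip a₀ a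
  have e2 : a₂ - a = r * ξ' := by rw [h2]; ring
  have e0 : a₀ - a = -(r * ξ) := by rw [h0]; ring
  have e0' : a - a₀ = r * ξ := by rw [h0]; ring
  rw [e2] at T1
  rw [e0] at T2
  rw [e0'] at T3 T4
  set t1 := F a₂ - F a - f a * (r * ξ') - f' a / 2 * (r * ξ') ^ 2
  set t2 := F a₀ - F a - f a * (-(r * ξ)) - f' a / 2 * (-(r * ξ)) ^ 2
  set t3 := f a - f a₀ - f' a₀ * (r * ξ)
  have hrk : r / r ^ κ * r ^ κ = r := div_mul_cancel₀ _ (pow_pos hr κ).ne'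
  have hid : r / r ^ κ * (f a * ((a₂ - a) ^ κ + s * (a - a₀) ^ κ)) - linCoeff κ * (F a₂ - F a₀)
      - (f a₀ * (r * (s * residual κ ξ)) + f a * (r * residual κ ξ'))
      - (r ^ 2 * f' a₀ * (linCoeff κ / 2 * (ξ ^ 2 - 1) + s * (ξ * residual κ ξ)) +
          r ^ 2 * f' a * (-(linCoeff κ / 2) * (ξ' ^ 2 - 1))) =
      s * (r * residual κ ξ * t3) - linCoeff κ * t1 + linCoeff κ * t2
        + linCoeff κ / 2 * r ^ 2 * (ξ ^ 2 - 1) * (f' a - f' a₀) := by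
    have u1 : (1 + s) * gaussMoment κ = 0 := one_add_sign_mul_moment κ
    have u2 : s * linCoeff κ = linCoeff κ := sign_mul_linCoeff κ
    rw [e2, e0', mul_pow, mul_pow]
    simp only [t1, t2, t3, residual]
    linear_combination (f a * (ξ' ^ κ + s * ξ ^ κ)) * hrk + f a * r * u1 + f a * r * ξ * u2
  rw [hid]
  have hC := hf.nonneg
  have b1 : |s * (r * residual κ ξ * t3)| ≤ C * r ^ 3 * (|ξ| ^ 2 * |residual κ ξ|) := by
    rw [abs_mul, hsabs, one_mul, abs_mul, abs_mul, abs_of_pos hr]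
    calc r * |residual κ ξ| * |t3| ≤ r * |residual κ ξ| * (C * |r * ξ| ^ 2) := by gcongr
      _ = _ := by rw [abs_mul, abs_of_pos hr]; ring
  have b2 : |linCoeff κ * t1| ≤ C * r ^ 3 * (|linCoeff κ| * |ξ'| ^ 3) := by
    rw [abs_mul]
    calc |linCoeff κ| * |t1| ≤ |linCoeff κ| * (C * |r * ξ'| ^ 3) := by gcongr
      _ = _ := by rw [abs_mul, abs_of_pos hr]; ring
  have b3 : |linCoeff κ * t2| ≤ C * r ^ 3 * (|linCoeff κ| * |ξ| ^ 3) := by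
    rw [abs_mul]
    calc |linCoeff κ| * |t2| ≤ |linCoeff κ| * (C * |-(r * ξ)| ^ 3) := by gcongr
      _ = _ := by rw [abs_neg, abs_mul, abs_of_pos hr]; ring
  have b4 : |linCoeff κ / 2 * r ^ 2 * (ξ ^ 2 - 1) * (f' a - f' a₀)| ≤
      C * r ^ 3 * (|linCoeff κ| * (|ξ| * |ξ ^ 2 - 1|)) := by
    rw [abs_mul, abs_mul, abs_mul, abs_div, abs_two, abs_of_pos (pow_pos hr 2)]
    calc |linCoeff κ| / 2 * r ^ 2 * |ξ ^ 2 - 1| * |f' a - f' a₀|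
        ≤ |linCoeff κ| * r ^ 2 * |ξ ^ 2 - 1| * (C * |r * ξ|) := by
          gcongr
          linarith [abs_nonneg (linCoeff κ)]
      _ = _ := by rw [abs_mul, abs_of_pos hr]; ring
  calc _ ≤ |s * (r * residual κ ξ * t3)| + |linCoeff κ * t1| + |linCoeff κ * t2| +
        |linCoeff κ / 2 * r ^ 2 * (ξ ^ 2 - 1) * (f' a - f' a₀)| :=
        (abs_add_le _ _).trans (add_le_add_left ((abs_add_le _ _).trans
          (add_le_add_left (abs_sub _ _) _)) _)
    _ ≤ _ := by linarith

end Steps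

end IteratedBM
namespace IteratedBM

section Expansion

variable {Ω : Type*} [MeasurableSpace Ω] {P : Measure Ω} [IsProbabilityMeasure P]
  {ι : Type*} [DecidableEq ι] {U : ι → ℝ≥0 → Ω → ℝ} {f f' F : ℝ → ℝ} {C : ℝ}

omit [IsProbabilityMeasure P] [DecidableEq ι] [MeasurableSpace Ω] in
lemma normStep_eq {δ : ℝ≥0} (hδ : 0 < δ) (i : ι) (k : ℕ) (ω : Ω) :
    U i (((k + 1 : ℕ) : ℝ≥0) * δ) ω = U i ((k : ℝ≥0) * δ) ω + √(δ : ℝ) * normStep U i δ k ω := by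
  have : (0 : ℝ) < √(δ : ℝ) := Real.sqrt_pos.2 (by exact_mod_cast hδ)
  unfold normStep
  rw [mul_div_cancel₀ _ this.ne']
  ring

/-- The expansion of the signed variation along a half-line into a Stratonovich part and a
martingale part, up to a negligible error. -/
lemma exists_gridSum_expansion (h : IsBrownianFamily U P) (hf : IsWeight f f' F C) (κ : ℕ) (i : ι) :
    ∃ K, 0 ≤ K ∧ ∀ δ : ℝ≥0, 0 < δ → ∀ N : ℕ, ∃ D : Ω → ℝ, Integrable D P ∧
      (∀ ω, |√(δ : ℝ) / √(δ : ℝ) ^ κ * gridSum κ f (fun k => U i ((k : ℝ≥0) * δ) ω) N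
        - linCoeff κ * (F (U i (((2 * N : ℕ) : ℝ≥0) * δ) ω) - F (U i 0 ω))
        - ∑ k ∈ Finset.range (2 * N), f (U i ((k : ℝ≥0) * δ) ω) *
            (√(δ : ℝ) * (stepSign κ k * residual κ (normStep U i δ k ω)))| ≤ D ω) ∧
      ∫ ω, D ω ∂P ≤ K * (√(δ : ℝ) * (√(N * δ) + N * δ)) := by
  have hC := hf.nonneg
  set c := linCoeff κ with hc
  have g2 : PolyGrowth fun x => x ^ 2 - 1 := (PolyGrowth.id.pow 2).sub (PolyGrowth.const 1)
  have gq := polyGrowth_residual κ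
  let φ₁ : ℝ → ℝ := fun x => -(c / 2) * (x ^ 2 - 1)
  let φ₀ : ℝ → ℝ := fun x => c / 2 * (x ^ 2 - 1) + (-1) ^ (κ + 1) * (x * residual κ x)
  have gφ₁ : PolyGrowth φ₁ := g2.const_mul _
  have gφ₀ : PolyGrowth φ₀ := (g2.const_mul _).add ((PolyGrowth.id.mul gq).const_mul _)
  have i2 : ∫ x, (x ^ 2 - 1) ∂(gaussianReal 0 1) = 0 := by
    rw [integral_sub (PolyGrowth.id.pow 2).integrable (integrable_const _), integral_pow_gaussian,
      gaussMoment_two]; simp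
  have z₁ : ∫ x, φ₁ x ∂(gaussianReal 0 1) = 0 := by
    simp only [φ₁]; rw [integral_const_mul, i2, mul_zero]
  have z₀ : ∫ x, φ₀ x ∂(gaussianReal 0 1) = 0 := by
    simp only [φ₀]
    rw [integral_add (g2.const_mul _).integrable ((PolyGrowth.id.mul gq).const_mul _).integrable,
      integral_const_mul, integral_const_mul, i2, integral_mul_residual]
    ring
  let φ : ℕ → ℝ → ℝ := fun k => if Odd k then φ₁ else φ₀
  have gφ : ∀ k, PolyGrowth (φ k) := fun k => by simp only [φ]; split_ifs <;> assumption
  have zφ : ∀ k, ∫ x, φ k x ∂(gaussianReal 0 1) = 0 := fun k => by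
    simp only [φ]; split_ifs <;> assumption
  set v₁ := ∫ x, φ₁ x ^ 2 ∂(gaussianReal 0 1)
  set v₀ := ∫ x, φ₀ x ^ 2 ∂(gaussianReal 0 1)
  have hv₁ : 0 ≤ v₁ := integral_nonneg fun _ => sq_nonneg _
  have hv₀ : 0 ≤ v₀ := integral_nonneg fun _ => sq_nonneg _
  have vφ : ∀ k, ∫ x, φ k x ^ 2 ∂(gaussianReal 0 1) ≤ v₁ + v₀ := fun k => by
    simp only [φ]; split_ifs <;> simp only [v₁, v₀] at * <;> linarith
  let ρ₀ : ℝ → ℝ := fun ξ => |c| * |ξ| ^ 3 + |c| * (|ξ| * |ξ ^ 2 - 1|) + |ξ| ^ 2 * |residual κ ξ|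
  let ρ₁ : ℝ → ℝ := fun ξ => |c| * |ξ| ^ 3
  have gρ₁ : PolyGrowth ρ₁ := (PolyGrowth.id.abs.pow 3).const_mul _
  have gρ₀ : PolyGrowth ρ₀ := (gρ₁.add ((PolyGrowth.id.abs.mul g2.abs).const_mul _)).add
    ((PolyGrowth.id.abs.pow 2).mul gq.abs)
  set w₁ := ∫ x, ρ₁ x ∂(gaussianReal 0 1)
  set w₀ := ∫ x, ρ₀ x ∂(gaussianReal 0 1)
  have hw₁ : 0 ≤ w₁ := integral_nonneg fun _ => by simp only [ρ₁]; positivity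
  have hw₀ : 0 ≤ w₀ := integral_nonneg fun _ => by simp only [ρ₀]; positivity
  refine ⟨C * √(2 * (v₁ + v₀)) + C * (w₀ + w₁), by positivity, fun δ hδ N => ?_⟩
  set r := √(δ : ℝ) with hr
  have hδ' : (0 : ℝ) < δ := by exact_mod_cast hδ
  have hrpos : 0 < r := Real.sqrt_pos.2 hδ'
  have hr2 : r ^ 2 = δ := Real.sq_sqrt hδ'.le
  let A : ℕ → Ω → ℝ := fun k ω => r ^ 2 * f' (U i ((k : ℝ≥0) * δ) ω)
  have hAb : ∀ k ω, |A k ω| ≤ r ^ 2 * C := fun k ω => by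
    simp only [A]; rw [abs_mul, abs_of_pos (pow_pos hrpos 2)]
    exact mul_le_mul_of_nonneg_left (hf.bound _) (by positivity)
  have hAm : ∀ k, Measurable (A k) := fun k =>
    (hf.cont'.measurable.comp (h.measurable _ _)).const_mul _
  have hA2 : ∀ k, MemLp (A k) 2 P := fun k =>
    MemLp.of_bound (hAm k).aestronglyMeasurable (r ^ 2 * C) (ae_of_all _ fun ω => hAb k ω)
  obtain ⟨hM2, hMle⟩ := h.integral_sq_weighted_le hδ i (A := A)
    (fun k => (hf.cont'.measurable.comp
      (IsBrownianFamily.measurable_past (Or.inr le_rfl))).const_mul _) hA2 gφ zφ vφ (2 * N)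
  set M : Ω → ℝ := fun ω => ∑ k ∈ Finset.range (2 * N), A k ω * φ k (normStep U i δ k ω)
  let R : Ω → ℝ := fun ω => ∑ l ∈ Finset.range N, C * r ^ 3 *
    (ρ₀ (normStep U i δ (2 * l) ω) + ρ₁ (normStep U i δ (2 * l + 1) ω))
  have hRl : ∀ l, Integrable (fun ω => C * r ^ 3 *
    (ρ₀ (normStep U i δ (2 * l) ω) + ρ₁ (normStep U i δ (2 * l + 1) ω))) P := fun l =>
    ((h.integrable_normStep hδ i _ gρ₀).add (h.integrable_normStep hδ i _ gρ₁)).const_mul _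
  have hR : Integrable R P := integrable_finsetSum _ fun l _ => hRl l
  have hMi : Integrable (fun ω => |M ω|) P := (hM2.integrable (by norm_num)).abs
  refine ⟨fun ω => |M ω| + R ω, hMi.add hR, fun ω => ?_, ?_⟩
  · have key : r / r ^ κ * gridSum κ f (fun k => U i ((k : ℝ≥0) * δ) ω) N
        - c * (F (U i (((2 * N : ℕ) : ℝ≥0) * δ) ω) - F (U i 0 ω))
        - ∑ k ∈ Finset.range (2 * N), f (U i ((k : ℝ≥0) * δ) ω) *
            (r * (stepSign κ k * residual κ (normStep U i δ k ω))) - M ω =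
        ∑ l ∈ Finset.range N, (r / r ^ κ * (f (U i (((2 * l + 1 : ℕ) : ℝ≥0) * δ) ω) *
          ((U i (((2 * l + 1 + 1: ℕ) : ℝ≥0) * δ) ω - U i (((2 * l + 1 : ℕ) : ℝ≥0) * δ) ω) ^ κ +
            (-1) ^ (κ + 1) *
              (U i (((2 * l + 1 : ℕ) : ℝ≥0) * δ) ω - U i (((2 * l : ℕ) : ℝ≥0) * δ) ω) ^ κ))
          - c * (F (U i (((2 * l + 1 + 1: ℕ) : ℝ≥0) * δ) ω) - F (U i (((2 * l : ℕ) : ℝ≥0) * δ) ω))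
          - (f (U i (((2 * l : ℕ) : ℝ≥0) * δ) ω) *
              (r * ((-1) ^ (κ + 1) * residual κ (normStep U i δ (2 * l) ω)))
            + f (U i (((2 * l + 1 : ℕ) : ℝ≥0) * δ) ω) *
              (r * residual κ (normStep U i δ (2 * l + 1) ω)))
          - (r ^ 2 * f' (U i (((2 * l : ℕ) : ℝ≥0) * δ) ω) * (c / 2 *
                (normStep U i δ (2 * l) ω ^ 2 - 1) + (-1) ^ (κ + 1) *
                  (normStep U i δ (2 * l) ω * residual κ (normStep U i δ (2 * l) ω))) +
             r ^ 2 * f' (U i (((2 * l + 1 : ℕ) : ℝ≥0) * δ) ω) *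
              (-(c / 2) * (normStep U i δ (2 * l + 1) ω ^ 2 - 1)))) := by
      simp only [M]
      clear hM2 hMle hMi hR hRl
      induction N with
      | zero => simp [gridSum]
      | succ N ih =>
        have o1 : Odd (2 * N + 1) := ⟨N, rfl⟩
        have o0 : ¬ Odd (2 * N) := by simp
        rw [Finset.sum_range_succ, ← ih, gridSum_succ, show 2 * (N + 1) = 2 * N + 1 + 1 by ring,
          Finset.sum_range_succ, Finset.sum_range_succ, Finset.sum_range_succ, Finset.sum_range_succ]
        simp only [φ, A, stepSign, o1, o0, if_true, if_false, φ₀, φ₁]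
        ring
    rw [sub_eq_iff_eq_add] at key
    rw [key]
    refine (abs_add_le _ _).trans ?_
    change _ ≤ |M ω| + R ω
    rw [add_comm |M ω|]
    refine add_le_add ((Finset.abs_sum_le_sum_abs _ _).trans (Finset.sum_le_sum fun l _ => ?_)) le_rfl
    · refine abs_term_expansion_le hf κ hrpos _ (normStep U i δ (2 * l) ω)
        (normStep U i δ (2 * l + 1) ω) ?_ ?_
      · rw [normStep_eq (U := U) hδ i (2 * l)]; ring
      · rw [normStep_eq (U := U) hδ i (2 * l + 1)]
  · rw [integral_add hMi hR]
    have m1 : ∫ ω, |M ω| ∂P ≤ C * √(2 * (v₁ + v₀)) * (r * √(N * δ)) := by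
      refine (integral_abs_le_sqrt hM2 (hMle.trans (c := (C * √(2 * (v₁ + v₀)) * (r * √(N * δ))) ^ 2)
        ?_)).trans_eq (Real.sqrt_sq (by positivity))
      have : ∀ k, ∫ ω, A k ω ^ 2 ∂P ≤ (r ^ 2 * C) ^ 2 := fun k => by
        have := integral_mono_of_nonneg (μ := P) (f := fun ω => A k ω ^ 2)
          (g := fun _ => (r ^ 2 * C) ^ 2) (ae_of_all _ fun ω => sq_nonneg _) (integrable_const _)
          (ae_of_all _ fun ω => by
            simp only; rw [← sq_abs]; exact pow_le_pow_left₀ (abs_nonneg _) (hAb k ω) 2)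
        simpa using this
      calc (v₁ + v₀) * ∑ k ∈ Finset.range (2 * N), ∫ ω, A k ω ^ 2 ∂P
          ≤ (v₁ + v₀) * ∑ k ∈ Finset.range (2 * N), (r ^ 2 * C) ^ 2 := by
            gcongr with k hk; exact this k
        _ = _ := by
            have q1 : √((N : ℝ) * δ) ^ 2 = N * δ := Real.sq_sqrt (by positivity)
            have q2 : √(2 * (v₁ + v₀)) ^ 2 = 2 * (v₁ + v₀) := Real.sq_sqrt (by positivity)
            rw [Finset.sum_const, Finset.card_range, nsmul_eq_mul]
            simp only [mul_pow, q1, q2, hr2]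
            push_cast; ring
    have m2 : ∫ ω, R ω ∂P = C * (w₀ + w₁) * (r * (N * δ)) := by
      simp only [R]
      rw [integral_finsetSum _ fun l _ => hRl l]
      have : ∀ l, ∫ ω, C * r ^ 3 * (ρ₀ (normStep U i δ (2 * l) ω) +
          ρ₁ (normStep U i δ (2 * l + 1) ω)) ∂P = C * r ^ 3 * (w₀ + w₁) := fun l => by
        rw [integral_const_mul, integral_add (h.integrable_normStep hδ i _ gρ₀)
          (h.integrable_normStep hδ i _ gρ₁), h.integral_normStep hδ i _ gρ₀.cont,
          h.integral_normStep hδ i _ gρ₁.cont]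
      simp only [this]
      rw [Finset.sum_const, Finset.card_range, nsmul_eq_mul, ← hr2]
      ring
    have p1 : 0 ≤ C * √(2 * (v₁ + v₀)) * (r * (N * δ)) := by positivity
    have p2 : 0 ≤ C * (w₀ + w₁) * (r * √(N * δ)) := by positivity
    rw [m2]
    linarith

/-- The martingale part is close to a Riemann sum over `r` blocks. -/
lemma exists_coarse_sum (h : IsBrownianFamily U P) (hf : IsWeight f f' F C) (κ : ℕ) (i : ι)
    {δ : ℝ≥0} (hδ : 0 < δ) (n : ℕ) {r : ℕ} (hr : 0 < r) :
    ∃ D : Ω → ℝ, Integrable D P ∧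
      (∀ ω, |∑ k ∈ Finset.range n, f (U i ((k : ℝ≥0) * δ) ω) *
            (√(δ : ℝ) * (stepSign κ k * residual κ (normStep U i δ k ω)))
        - ∑ j ∈ Finset.range r, f (U i (((n * j / r : ℕ) : ℝ≥0) * δ) ω) *
          (residualSum U κ i δ (n * (j + 1) / r) ω - residualSum U κ i δ (n * j / r) ω)| ≤ D ω) ∧
      ∫ ω, D ω ∂P ≤ C * √(residualVar κ) * (n * δ / √r) := by
  have hC := hf.nonneg
  have hδ' : (0 : ℝ) < δ := by exact_mod_cast hδ
  set x : ℕ → Ω → ℝ := fun k => U i ((k : ℝ≥0) * δ) with hx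
  let A : ℕ → Ω → ℝ := fun k ω => √(δ : ℝ) * (f (x k ω) - f (x (blockStart n r k) ω))
  have hAb : ∀ k ω, |A k ω| ≤ √(δ : ℝ) * C * |x k ω - x (blockStart n r k) ω| := fun k ω => by
    simp only [A]; rw [abs_mul, abs_of_nonneg (Real.sqrt_nonneg _), mul_assoc]
    exact mul_le_mul_of_nonneg_left (hf.abs_sub_le _ _) (by positivity)
  have hAp : ∀ k : ℕ, Measurable[IsBrownianFamily.past U i ((k : ℝ≥0) * δ)] (A k) := fun k => by
    refine (Measurable.sub ?_ ?_).const_mul _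
    · exact hf.cont.measurable.comp (IsBrownianFamily.measurable_past (Or.inr le_rfl))
    · exact hf.cont.measurable.comp (IsBrownianFamily.measurable_past
        (Or.inr (monotone_gridTime δ (blockStart_le hr))))
  have hAm : ∀ k, Measurable (A k) := fun k =>
    ((hf.cont.measurable.comp (h.measurable _ _)).sub
      (hf.cont.measurable.comp (h.measurable _ _))).const_mul _
  have hd2 : ∀ k, MemLp (fun ω => x k ω - x (blockStart n r k) ω) 2 P := fun k =>
    (h.memLp_eval i _ 2).sub (h.memLp_eval i _ 2)
  have hA2 : ∀ k, MemLp (A k) 2 P := fun k =>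
    ((hd2 k).abs.const_mul (√(δ : ℝ) * C)).mono (hAm k).aestronglyMeasurable (ae_of_all _ fun ω => by
      rw [Real.norm_eq_abs, Real.norm_eq_abs]
      exact (hAb k ω).trans (le_abs_self _))
  obtain ⟨hM2, hMle⟩ := h.integral_sq_weighted_le hδ i (A := A) hAp hA2
    (φ := fun k y => stepSign κ k * residual κ y) (fun k => (polyGrowth_residual κ).const_mul _)
    (fun k => by rw [integral_const_mul, integral_residual, mul_zero]) (v := residualVar κ)
    (fun k => by
      simp only [mul_pow, stepSign_sq, one_mul]; exact le_rfl) n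
  refine ⟨_, (hM2.integrable (by norm_num)).abs, fun ω => ?_, ?_⟩
  · have := sum_blocks n r hr (fun k => f (x k ω))
      (fun k => √(δ : ℝ) * (stepSign κ k * residual κ (normStep U i δ k ω)))
    simp only [residualSum]
    rw [this, ← Finset.sum_sub_distrib]
    refine le_of_eq ?_
    congr 1
    refine Finset.sum_congr rfl fun k _ => ?_
    simp only [A, x]
    ring
  · have hv := residualVar_nonneg κ
    refine (integral_abs_le_sqrt hM2 (hMle.trans
      (c := (C * √(residualVar κ) * (n * δ / √r)) ^ 2) ?_)).trans_eq (Real.sqrt_sq (by positivity))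
    have hk : ∀ k ∈ Finset.range n, ∫ ω, A k ω ^ 2 ∂P ≤ δ * C ^ 2 * (n / r * δ) := fun k hk => by
      have hn : 0 < n := (Nat.zero_le _).trans_lt (Finset.mem_range.1 hk)
      have h1 := integral_mono_of_nonneg (μ := P) (f := fun ω => A k ω ^ 2)
          (g := fun ω => δ * C ^ 2 * (x k ω - x (blockStart n r k) ω) ^ 2)
          (ae_of_all _ fun ω => sq_nonneg _) ((hd2 k).integrable_sq.const_mul _)
          (ae_of_all _ fun ω => by
            simp only
            have := pow_le_pow_left₀ (abs_nonneg _) (hAb k ω) 2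
            rw [mul_pow, mul_pow, Real.sq_sqrt hδ'.le, sq_abs, sq_abs] at this
            exact this)
      refine h1.trans ?_
      rw [integral_const_mul, integral_sub_sq_of_preBrownian (h.isPreBrownian i)
        (monotone_gridTime δ (blockStart_le hr))]
      push_cast
      rw [← sub_mul]
      gcongr
      exact sub_blockStart_le hr hn
    calc residualVar κ * ∑ k ∈ Finset.range n, ∫ ω, A k ω ^ 2 ∂P
        ≤ residualVar κ * ∑ k ∈ Finset.range n, δ * C ^ 2 * (n / r * δ) := by
          gcongr with k hk'; exact hk k hk'
      _ = _ := by
        rw [Finset.sum_const, Finset.card_range, nsmul_eq_mul, mul_pow, mul_pow, div_pow,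
          Real.sq_sqrt hv, Real.sq_sqrt (by positivity)]
        ring

end Expansion

end IteratedBM
namespace IteratedBM

section CLT

variable {Ω : Type*} [MeasurableSpace Ω] {P : Measure Ω} [IsProbabilityMeasure P]

omit [IsProbabilityMeasure P] in
lemma measurable_residualSum {ι : Type*} [DecidableEq ι] {U : ι → ℝ≥0 → Ω → ℝ}
    (h : IsBrownianFamily U P) (κ : ℕ) (i : ι) (δ : ℝ≥0) (N : ℕ) :
    Measurable (residualSum U κ i δ N) := by
  have := (polyGrowth_residual κ).cont.measurable
  exact Finset.measurable_sum _ fun k _ =>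
    ((this.comp (h.measurable_normStep i k)).const_mul _).const_mul _

variable {U : Bool × Bool → ℝ≥0 → Ω → ℝ}

omit [IsProbabilityMeasure P] in
/-- Second and third moments of one step of a linear combination of a Brownian motion and the
martingale part of its signed variation. -/
lemma step_moments (h : IsBrownianFamily U P) (κ : ℕ) {δ : ℝ≥0} (hδ : 0 < δ) (σ : Bool) (k : ℕ)
    (A B : ℝ) :
    MemLp (fun ω => √(δ : ℝ) * (A * normStep U (true, σ) δ k ω + B * (stepSign κ k *
      residual κ (normStep U (true, σ) δ k ω)))) 3 P ∧
    ∫ ω, √(δ : ℝ) * (A * normStep U (true, σ) δ k ω + B * (stepSign κ k *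
      residual κ (normStep U (true, σ) δ k ω))) ∂P = 0 ∧
    ∫ ω, (√(δ : ℝ) * (A * normStep U (true, σ) δ k ω + B * (stepSign κ k *
      residual κ (normStep U (true, σ) δ k ω)))) ^ 2 ∂P = δ * (A ^ 2 + residualVar κ * B ^ 2) ∧
    ∀ S, |A| ≤ S → |B| ≤ S → ∫ ω, |√(δ : ℝ) * (A * normStep U (true, σ) δ k ω + B * (stepSign κ k *
      residual κ (normStep U (true, σ) δ k ω)))| ^ 3 ∂P ≤
      √(δ : ℝ) ^ 3 * S ^ 3 * ∫ x, (|x| + |residual κ x|) ^ 3 ∂(gaussianReal 0 1) := by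
  have hδ' : (0 : ℝ) < δ := by exact_mod_cast hδ
  have gq := polyGrowth_residual κ
  have g : PolyGrowth fun x => √(δ : ℝ) * (A * x + B * (stepSign κ k * residual κ x)) :=
    ((PolyGrowth.id.const_mul A).add ((gq.const_mul _).const_mul B)).const_mul _
  have g3 : PolyGrowth fun x => (|x| + |residual κ x|) ^ 3 := (PolyGrowth.id.abs.add gq.abs).pow 3
  refine ⟨by exact_mod_cast h.memLp_normStep hδ (true, σ) k g 3, ?_, ?_, fun S hA hB => ?_⟩
  · rw [h.integral_normStep hδ (true, σ) k g.cont, integral_const_mul,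
      integral_add (PolyGrowth.id.const_mul A).integrable ((gq.const_mul _).const_mul B).integrable,
      integral_const_mul, integral_const_mul, integral_const_mul, integral_residual,
      integral_id_gaussian]
    ring
  · refine (h.integral_normStep hδ (true, σ) k (g.cont.pow 2)).trans ?_
    simp only [Pi.pow_apply]
    have e : ∀ x, (√(δ : ℝ) * (A * x + B * (stepSign κ k * residual κ x))) ^ 2 =
        δ * (A ^ 2 * x ^ 2 + 2 * A * B * stepSign κ k * (x * residual κ x) +
          B ^ 2 * residual κ x ^ 2) := fun x => by
      have h1 : √(δ : ℝ) ^ 2 = δ := Real.sq_sqrt hδ'.le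
      linear_combination (A * x + B * (stepSign κ k * residual κ x)) ^ 2 * h1 +
        δ * B ^ 2 * residual κ x ^ 2 * stepSign_sq κ k
    simp_rw [e]
    have i1 := ((PolyGrowth.id.pow 2).const_mul (A ^ 2)).integrable
    have i2 := ((PolyGrowth.id.mul gq).const_mul (2 * A * B * stepSign κ k)).integrable
    have i3 := ((gq.pow 2).const_mul (B ^ 2)).integrable
    have i12 : Integrable (fun x => A ^ 2 * x ^ 2 + 2 * A * B * stepSign κ k * (x * residual κ x))
      (gaussianReal 0 1) := i1.add i2
    rw [integral_const_mul, integral_add i12 i3, integral_add i1 i2, integral_const_mul,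
      integral_const_mul, integral_const_mul, integral_mul_residual, integral_pow_gaussian,
      gaussMoment_two]
    unfold residualVar
    ring
  · refine (h.integral_normStep hδ (true, σ) k (g.cont.abs.pow 3)).trans_le ?_
    rw [← integral_const_mul]
    refine integral_mono (g.abs.pow 3).integrable (g3.const_mul _).integrable fun x => ?_
    simp only [Pi.pow_apply]
    rw [← mul_pow, ← mul_pow, abs_mul, abs_of_nonneg (Real.sqrt_nonneg _), mul_assoc]
    refine pow_le_pow_left₀ (by positivity) (mul_le_mul_of_nonneg_left ?_ (Real.sqrt_nonneg _)) _
    refine (abs_add_le _ _).trans ?_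
    rw [abs_mul, abs_mul, abs_mul, abs_stepSign, one_mul, mul_add]
    gcongr

/-- The joint central limit theorem for the Brownian motion `U (true, ·)` and the martingale part
of its signed variation, on both half-lines. -/
theorem tendstoInDistribution_residualSum (h : IsBrownianFamily U P) (κ : ℕ) {δ : ℕ → ℝ≥0}
    (hδ : ∀ n, 0 < δ n) (hδ0 : Tendsto δ atTop (𝓝 0)) {J : Type*} [Fintype J] (τ σ : J → Bool)
    (m : ℕ → J → ℕ) (p : J → ℝ≥0)
    (hm : ∀ j, Tendsto (fun n => (m n j : ℝ) * δ n) atTop (𝓝 (p j))) :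
    TendstoInDistribution (fun n ω j => cond (τ j) (U (true, σ j) ((m n j : ℝ≥0) * δ n) ω)
        (residualSum U κ (true, σ j) (δ n) (m n j) ω)) atTop
      (fun ω j => cond (τ j) (U (true, σ j) (p j) ω) (√(residualVar κ) * U (false, σ j) (p j) ω))
      (fun _ => P) P := by
  set v := residualVar κ with hv
  have hv0 : 0 ≤ v := residualVar_nonneg κ
  refine tendstoInDistribution_pi_of_charFun (fun n => ?_) ?_ fun a => ?_
  · refine (measurable_pi_lambda _ fun j => ?_).aemeasurable
    rcases τ j with _ | _
    · exact measurable_residualSum h κ _ _ _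
    · exact h.measurable _ _
  · refine (measurable_pi_lambda _ fun j => ?_).aemeasurable
    rcases τ j with _ | _
    · exact (h.measurable _ _).const_mul _
    · exact h.measurable _ _
  set Z : J → Ω → ℝ := fun j ω =>
    cond (τ j) (U (true, σ j) (p j) ω) (√v * U (false, σ j) (p j) ω) with hZ
  have hZ' : ∀ j, Z j = fun ω => cond (τ j) 1 √v * U (τ j, σ j) (p j) ω := fun j => by
    ext ω; simp only [hZ]; cases τ j <;> simp
  have hgZ : IsGaussianProcess Z P := by
    have := (h.gaussian.comp_right (fun j => ((τ j, σ j), p j))).smul (fun j => cond (τ j) 1 √v)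
    convert! this using 1
    ext j ω
    rw [hZ']; rfl
  set rr : J → J → ℝ := fun i j => if τ i = τ j ∧ σ i = σ j then
    cond (τ i) 1 v * ((min (p i) (p j) : ℝ≥0) : ℝ) else 0 with hrr
  have hcov : ∀ i j, cov[Z i, Z j; P] = rr i j := fun i j => by
    have e1 : ∀ i j s t, cov[fun ω => U i s ω, fun ω => U j t ω; P] =
      if i = j then ((min s t : ℝ≥0) : ℝ) else 0 := h.cov
    rw [hZ', hZ', covariance_const_mul_left, covariance_const_mul_right, e1]
    simp only [hrr, Prod.mk.injEq]
    by_cases hij : τ i = τ j ∧ σ i = σ j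
    · rw [if_pos hij, if_pos hij, ← hij.1]
      cases τ i
      · simp only [cond_false]; rw [← mul_assoc, Real.mul_self_sqrt hv0]
      · simp
    · rw [if_neg hij, if_neg hij, mul_zero, mul_zero]
  have hmean : ∀ j, ∫ ω, Z j ω ∂P = 0 := fun j => by
    rw [hZ', integral_const_mul, h.mean, mul_zero]
  have hlim := integral_exp_gaussian hgZ hmean rr hcov id a
  simp only [id] at hlim
  change Tendsto _ _ (𝓝 (∫ ω, Complex.exp ((∑ i, a i * Z i ω : ℝ) * Complex.I) ∂P))
  rw [hlim]
  set L : ℕ → ℕ := fun n => ∑ j, m n j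
  have hL : ∀ n j, m n j ≤ L n := fun n j =>
    Finset.single_le_sum (f := fun i => m n i) (fun _ _ => Nat.zero_le _) (Finset.mem_univ j)
  let α : Bool → Bool → J → ℝ := fun b s j => if τ j = b ∧ σ j = s then a j else 0
  let A : Bool → ℕ → Bool → ℕ → ℝ := fun b n s k => ∑ j, if k < m n j then α b s j else 0
  set S : ℝ := ∑ j, |a j|
  have hS0 : 0 ≤ S := Finset.sum_nonneg fun _ _ => abs_nonneg _
  have hAS : ∀ b n s k, |A b n s k| ≤ S := fun b n s k => by
    refine (Finset.abs_sum_le_sum_abs _ _).trans (Finset.sum_le_sum fun j _ => ?_)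
    simp only [α]
    split_ifs <;> simp
  let Y : ℕ → Bool × ℕ → Ω → ℝ := fun n q ω => √(δ n : ℝ) * (A true n q.1 q.2 *
    normStep U (true, q.1) (δ n) q.2 ω + A false n q.1 q.2 * (stepSign κ q.2 *
      residual κ (normStep U (true, q.1) (δ n) q.2 ω)))
  have hmom := fun n (q : Bool × ℕ) => step_moments h κ (hδ n) q.1 q.2 (A true n q.1 q.2)
    (A false n q.1 q.2)
  have hind : ∀ n, iIndepFun (Y n) P := fun n => by
    have h1 := (h.iIndepFun_increment (monotone_gridTime (δ n))).precomp
      (g := fun q : Bool × ℕ => ((true, q.1), q.2)) (by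
        rintro ⟨s, k⟩ ⟨s', k'⟩ hh; simpa using hh)
    refine h1.comp (fun q x => √(δ n : ℝ) * (A true n q.1 q.2 * (x / √(δ n : ℝ)) +
      A false n q.1 q.2 * (stepSign κ q.2 * residual κ (x / √(δ n : ℝ))))) fun q => ?_
    have := (polyGrowth_residual κ).cont
    fun_prop
  set I : ℕ → Finset (Bool × ℕ) := fun n => Finset.univ ×ˢ Finset.range (L n) with hI
  have hrew : ∀ n, ∀ᵐ ω ∂P, ∑ j, a j * cond (τ j) (U (true, σ j) ((m n j : ℝ≥0) * δ n) ω)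
      (residualSum U κ (true, σ j) (δ n) (m n j) ω) = ∑ q ∈ I n, Y n q ω := by
    intro n
    filter_upwards [(h.isPreBrownian (true, true)).eval_zero_ae_eq_zero,
      (h.isPreBrownian (true, false)).eval_zero_ae_eq_zero] with ω h1 h2
    have hUsum : ∀ (s : Bool) (N : ℕ), U (true, s) ((N : ℝ≥0) * δ n) ω =
        ∑ k ∈ Finset.range N, √(δ n : ℝ) * normStep U (true, s) (δ n) k ω := by
      intro s N
      induction N with
      | zero => cases s <;> simp [h1, h2]
      | succ N ih => rw [Finset.sum_range_succ, ← ih, normStep_eq (U := U) (hδ n)]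
    have hY1 : ∀ s k, Y n (s, k) ω = A true n s k * (√(δ n : ℝ) *
        normStep U (true, s) (δ n) k ω) + A false n s k * (√(δ n : ℝ) * (stepSign κ k *
        residual κ (normStep U (true, s) (δ n) k ω))) := fun s k => by
      simp only [Y]; ring
    simp only [hI, Finset.sum_product, hY1, Finset.sum_add_distrib, A]
    simp only [sum_step_mul _ (m n) (L n) (hL n)]
    simp only [← hUsum, Fintype.sum_bool, α]
    rw [← Finset.sum_add_distrib, ← Finset.sum_add_distrib, ← Finset.sum_add_distrib]
    refine Finset.sum_congr rfl fun j _ => ?_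
    unfold residualSum
    rcases τ j with _ | _ <;> rcases σ j with _ | _ <;> simp
  have hrew' : ∀ n, ∫ ω, Complex.exp ((∑ j, a j * cond (τ j) (U (true, σ j) ((m n j : ℝ≥0) * δ n) ω)
      (residualSum U κ (true, σ j) (δ n) (m n j) ω) : ℝ) * Complex.I) ∂P =
      ∫ ω, Complex.exp ((∑ q ∈ I n, Y n q ω : ℝ) * Complex.I) ∂P := fun n => by
    refine integral_congr_ae ?_
    filter_upwards [hrew n] with ω hω
    rw [hω]
  simp_rw [hrew']
  have hvar : ∀ n, ∑ q ∈ I n, ∫ ω, Y n q ω ^ 2 ∂P = ∑ s : Bool, ((∑ i, ∑ j, α true s i * α true s j *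
      min ((m n i : ℝ) * δ n) (m n j * δ n)) +
      v * ∑ i, ∑ j, α false s i * α false s j * min ((m n i : ℝ) * δ n) (m n j * δ n)) := by
    intro n
    have h2 : ∀ q, ∫ ω, Y n q ω ^ 2 ∂P = δ n * (A true n q.1 q.2 ^ 2 + v * A false n q.1 q.2 ^ 2) :=
      fun q => (hmom n q).2.2.1
    simp only [h2, hI, Finset.sum_product, ← Finset.mul_sum, Finset.sum_add_distrib, A]
    simp only [sum_indicator_sq _ (m n) (L n) (hL n)]
    rw [mul_add, Finset.mul_sum, Finset.mul_sum, Finset.mul_sum, Finset.mul_sum]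
    have e : ∀ i j (c : ℝ), c * min ((m n i : ℝ) * δ n) (m n j * δ n) =
        δ n * (c * (min (m n i) (m n j) : ℕ)) := fun i j c => by
      rw [← min_mul_of_nonneg _ _ (δ n).coe_nonneg, ← Nat.cast_min]; ring
    simp only [e, ← Finset.mul_sum]
    congr 1
    ring
  have hvlim : Tendsto (fun n => ∑ q ∈ I n, ∫ ω, Y n q ω ^ 2 ∂P) atTop
      (𝓝 (∑ i, ∑ j, a i * a j * rr i j)) := by
    simp_rw [hvar]
    have e : ∑ i, ∑ j, a i * a j * rr i j = ∑ s : Bool, ((∑ i, ∑ j, α true s i * α true s j *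
      min (p i : ℝ) (p j)) + v * ∑ i, ∑ j, α false s i * α false s j * min (p i : ℝ) (p j)) := by
      simp only [Fintype.sum_bool, Finset.mul_sum]
      simp only [← Finset.sum_add_distrib]
      refine Finset.sum_congr rfl fun i _ => Finset.sum_congr rfl fun j _ => ?_
      simp only [α, hrr, NNReal.coe_min]
      rcases τ i with _ | _ <;> rcases τ j with _ | _ <;> rcases σ i with _ | _ <;>
        rcases σ j with _ | _ <;> simp <;> ring
    rw [e]
    refine tendsto_finsetSum _ fun s _ => Tendsto.add ?_ (Tendsto.const_mul _ ?_)
    · exact tendsto_finsetSum _ fun i _ => tendsto_finsetSum _ fun j _ =>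
        ((hm i).min (hm j)).const_mul _
    · exact tendsto_finsetSum _ fun i _ => tendsto_finsetSum _ fun j _ =>
        ((hm i).min (hm j)).const_mul _
  set w := ∫ x, (|x| + |residual κ x|) ^ 3 ∂(gaussianReal 0 1)
  have herr : ∀ n, ‖∫ ω, Complex.exp ((∑ q ∈ I n, Y n q ω : ℝ) * Complex.I) ∂P -
      Complex.exp (-((∑ q ∈ I n, ∫ ω, Y n q ω ^ 2 ∂P : ℝ) / 2 : ℂ))‖ ≤
      (L n * δ n) * (2 * (4 * √(δ n : ℝ) * S ^ 3 * w + δ n * (S ^ 2 + v * S ^ 2) ^ 2)) := by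
    intro n
    refine (norm_integral_exp_sum_sub_le (I n) (hind n) (fun q => (hmom n q).1)
      (fun q => (hmom n q).2.1)).trans ?_
    have hr2 : √(δ n : ℝ) ^ 2 = δ n := Real.sq_sqrt (δ n).coe_nonneg
    have hterm : ∀ q ∈ I n, (4 * ∫ ω, |Y n q ω| ^ 3 ∂P + (∫ ω, Y n q ω ^ 2 ∂P) ^ 2) ≤
        4 * (√(δ n : ℝ) ^ 3 * S ^ 3 * w) + (δ n * (S ^ 2 + v * S ^ 2)) ^ 2 := fun q _ => by
      have h3 := (hmom n q).2.2.2 S (hAS _ _ _ _) (hAS _ _ _ _)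
      have h2 : ∫ ω, Y n q ω ^ 2 ∂P ≤ δ n * (S ^ 2 + v * S ^ 2) := by
        refine (hmom n q).2.2.1.trans_le ?_
        have q1 := pow_le_pow_left₀ (abs_nonneg _) (hAS true n q.1 q.2) 2
        have q2 := pow_le_pow_left₀ (abs_nonneg _) (hAS false n q.1 q.2) 2
        rw [sq_abs] at q1 q2
        gcongr
      have h2' : 0 ≤ ∫ ω, Y n q ω ^ 2 ∂P := integral_nonneg fun _ => sq_nonneg _
      gcongr
    refine (Finset.sum_le_sum hterm).trans (le_of_eq ?_)
    rw [Finset.sum_const, hI, Finset.card_product, Finset.card_range, nsmul_eq_mul]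
    simp only [Finset.card_univ, Fintype.card_bool]
    push_cast
    linear_combination 2 * (L n : ℝ) * 4 * √(δ n : ℝ) * S ^ 3 * w * hr2
  have hδr : Tendsto (fun n => (δ n : ℝ)) atTop (𝓝 0) := by
    simpa using NNReal.tendsto_coe.2 hδ0
  have hLlim : Tendsto (fun n => (L n : ℝ) * δ n) atTop (𝓝 (∑ i, (p i : ℝ))) := by
    simp only [L, Nat.cast_sum, Finset.sum_mul]
    exact tendsto_finsetSum _ fun i _ => hm i
  have hsq : Tendsto (fun n => √(δ n : ℝ)) atTop (𝓝 0) := by simpa using hδr.sqrt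
  have hz : Tendsto (fun n => (L n * δ n) *
      (2 * (4 * √(δ n : ℝ) * S ^ 3 * w + δ n * (S ^ 2 + v * S ^ 2) ^ 2))) atTop (𝓝 0) := by
    have h2 := (((((hsq.const_mul 4).mul_const (S ^ 3)).mul_const w).add
      (hδr.mul_const ((S ^ 2 + v * S ^ 2) ^ 2))).const_mul 2)
    have h3 := hLlim.mul h2
    simpa using h3
  have hd := squeeze_zero_norm herr hz
  have he : Tendsto (fun n => Complex.exp (-((∑ q ∈ I n, ∫ ω, Y n q ω ^ 2 ∂P : ℝ) / 2 : ℂ)))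
      atTop (𝓝 (Complex.exp (-((∑ i, ∑ j, a i * a j * rr i j : ℝ) / 2 : ℂ)))) :=
    (Complex.continuous_exp.tendsto _).comp
      (((Complex.continuous_ofReal.tendsto _).comp hvlim).div_const 2).neg
  have := hd.add he
  simpa using this

end CLT

end IteratedBM
namespace IteratedBM

section Overlap

/-- The length of the intersection of the intervals `[s, t]` and `[s', t']`. -/
def overlap (s t s' t' : ℝ) : ℝ := min t t' - min t s' - min s t' + min s s'

lemma overlap_nonneg {s t s' t' : ℝ} (h : s ≤ t) (h' : s' ≤ t') : 0 ≤ overlap s t s' t' := by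
  unfold overlap
  rcases min_cases t t' with ⟨e1, _⟩ | ⟨e1, _⟩ <;> rcases min_cases t s' with ⟨e2, _⟩ | ⟨e2, _⟩ <;>
    rcases min_cases s t' with ⟨e3, _⟩ | ⟨e3, _⟩ <;> rcases min_cases s s' with ⟨e4, _⟩ | ⟨e4, _⟩ <;>
    rw [e1, e2, e3, e4] <;> linarith

lemma overlap_comm (s t s' t' : ℝ) : overlap s t s' t' = overlap s' t' s t := by
  unfold overlap
  rw [min_comm t t', min_comm t s', min_comm s t', min_comm s s']
  ring

lemma overlap_eq_zero {s t s' t' : ℝ} (h : s ≤ t) (h' : s' ≤ t') (h0 : t ≤ s') :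
    overlap s t s' t' = 0 := by
  unfold overlap
  rw [min_eq_left (h0.trans h'), min_eq_left h0, min_eq_left (h.trans (h0.trans h')),
    min_eq_left (h.trans h0)]
  ring

lemma overlap_self {s t : ℝ} (h : s ≤ t) : overlap s t s t = t - s := by
  unfold overlap
  rw [min_self, min_self, min_eq_right h, min_eq_left h]; ring

lemma sum_overlap {s t : ℝ} (z : ℕ → ℝ) (N : ℕ) (h0 : z 0 ≤ s) (hst : s ≤ t) (hN : t ≤ z N) :
    ∑ l ∈ Finset.range N, overlap s t (z l) (z (l + 1)) = t - s := by
  have e : ∀ l, overlap s t (z l) (z (l + 1)) = (min t (z (l + 1)) - min s (z (l + 1))) -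
      (min t (z l) - min s (z l)) := fun l => by unfold overlap; ring
  simp_rw [e]
  rw [Finset.sum_range_sub (fun l => min t (z l) - min s (z l)), min_eq_left hN,
    min_eq_left (hst.trans hN), min_eq_right (h0.trans hst), min_eq_right h0]
  ring

end Overlap

section RiemannSums

variable {Ω : Type*} [MeasurableSpace Ω] {P : Measure Ω} [IsProbabilityMeasure P]
  {ι : Type*} [DecidableEq ι] {U : ι → ℝ≥0 → Ω → ℝ} {f f' F : ℝ → ℝ} {C : ℝ}

omit [IsProbabilityMeasure P] in
lemma sq_integral_weight_sub_le (h : IsBrownianFamily U P) (hf : IsWeight f f' F C) (j : ι)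
    (s t : ℝ≥0) : MemLp (fun ω => f (U j t ω) - f (U j s ω)) 2 P ∧
      ∫ ω, (f (U j t ω) - f (U j s ω)) ^ 2 ∂P ≤ C ^ 2 * |(t : ℝ) - s| := by
  have hC := hf.nonneg
  have hd : MemLp (fun ω => U j t ω - U j s ω) 2 P := (h.memLp_eval j t 2).sub (h.memLp_eval j s 2)
  have hm : Measurable fun ω => f (U j t ω) - f (U j s ω) :=
    (hf.cont.measurable.comp (h.measurable _ _)).sub (hf.cont.measurable.comp (h.measurable _ _))
  have hsq : ∫ ω, (U j t ω - U j s ω) ^ 2 ∂P = |(t : ℝ) - s| := by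
    rcases le_total s t with hst | hst
    · rw [integral_sub_sq_of_preBrownian (h.isPreBrownian j) hst, abs_of_nonneg]
      exact sub_nonneg.2 (by exact_mod_cast hst)
    · have := integral_sub_sq_of_preBrownian (h.isPreBrownian j) hst
      rw [abs_sub_comm, abs_of_nonneg (sub_nonneg.2 (by exact_mod_cast hst)), ← this]
      congr 1; ext ω; ring
  refine ⟨(hd.const_mul C).mono hm.aestronglyMeasurable (ae_of_all _ fun ω => ?_), ?_⟩
  · rw [Real.norm_eq_abs, Real.norm_eq_abs, abs_mul, abs_of_nonneg hC]
    exact hf.abs_sub_le _ _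
  · rw [← hsq, ← integral_const_mul]
    refine integral_mono_of_nonneg (ae_of_all _ fun _ => sq_nonneg _)
      (hd.integrable_sq.const_mul _) (ae_of_all _ fun ω => ?_)
    simp only
    rw [← sq_abs, ← sq_abs (U j t ω - U j s ω), ← mul_pow]
    exact pow_le_pow_left₀ (abs_nonneg _) (hf.abs_sub_le _ _) 2

lemma memLp_weight (h : IsBrownianFamily U P) (hf : IsWeight f f' F C) (j : ι) (t : ℝ≥0) :
    MemLp (fun ω => f (U j t ω)) 2 P := by
  have := ((h.memLp_eval j t 2).abs.const_mul C).add (memLp_const (|f 0|))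
  refine this.mono (hf.cont.measurable.comp (h.measurable _ _)).aestronglyMeasurable
    (ae_of_all _ fun ω => ?_)
  rw [Real.norm_eq_abs, Real.norm_eq_abs]
  refine (hf.abs_le _).trans ((le_of_eq ?_).trans (le_abs_self _))
  simp [add_comm]

/-- Riemann sums of the Wiener–Itô integral of `f (U j ·)` with respect to `U i`. -/
def riemannSum (f : ℝ → ℝ) (x b : ℝ≥0 → Ω → ℝ) (t τ : ℕ → ℝ≥0) (N : ℕ) (ω : Ω) : ℝ :=
  ∑ k ∈ Finset.range N, f (x (τ k) ω) * (b (t (k + 1)) ω - b (t k) ω)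

/-- A tagged partition of `[0, u]`. -/
structure IsTagged (u δ : ℝ≥0) (t τ : ℕ → ℝ≥0) (N : ℕ) : Prop where
  mono : Monotone t
  first : t 0 = 0
  last : t N = u
  le_tag : ∀ k, t k ≤ τ k
  tag_le : ∀ k, τ k ≤ t (k + 1)
  mesh : ∀ k, (t (k + 1) : ℝ) - t k ≤ δ

lemma memLp_riemannSum_term (h : IsBrownianFamily U P) (hf : IsWeight f f' F C) {i j : ι}
    (hij : i ≠ j) (a s t : ℝ≥0) :
    MemLp (fun ω => f (U j a ω) * (U i t ω - U i s ω)) 2 P := by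
  have hw := memLp_weight h hf j a
  have hd : MemLp (fun ω => U i t ω - U i s ω) 2 P := (h.memLp_eval i t 2).sub (h.memLp_eval i s 2)
  refine (memLp_two_iff_integrable_sq (hw.1.mul hd.1)).2 ?_
  have hi := (h.indepFun hij.symm).comp (φ := fun z : ℝ≥0 → ℝ => f (z a) ^ 2)
    (ψ := fun z : ℝ≥0 → ℝ => (z t - z s) ^ 2)
    ((hf.cont.measurable.comp (measurable_pi_apply _)).pow_const 2) (by fun_prop)
  have := hi.integrable_mul hw.integrable_sq hd.integrable_sq
  refine this.congr (ae_of_all _ fun ω => ?_)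
  simp [mul_pow]

lemma integral_riemannSum_term_mul (h : IsBrownianFamily U P) (hf : IsWeight f f' F C) {i j : ι}
    (hij : i ≠ j) (a s t a' s' t' : ℝ≥0) :
    ∫ ω, (f (U j a ω) * (U i t ω - U i s ω)) * (f (U j a' ω) * (U i t' ω - U i s' ω)) ∂P =
      overlap s t s' t' * ∫ ω, f (U j a ω) * f (U j a' ω) ∂P := by
  have hi := (h.indepFun hij.symm).comp (φ := fun z : ℝ≥0 → ℝ => f (z a) * f (z a'))
    (ψ := fun z : ℝ≥0 → ℝ => (z t - z s) * (z t' - z s'))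
    ((hf.cont.measurable.comp (measurable_pi_apply _)).mul
      (hf.cont.measurable.comp (measurable_pi_apply _))) (by fun_prop)
  have hw := memLp_weight h hf j
  have hd : ∀ s t, MemLp (fun ω => U i t ω - U i s ω) 2 P := fun s t =>
    (h.memLp_eval i t 2).sub (h.memLp_eval i s 2)
  have := hi.integral_fun_mul_eq_mul_integral ((hw a).1.mul (hw a').1) ((hd s t).1.mul (hd s' t').1)
  simp only [Function.comp_def] at this
  rw [h.integral_increment_mul] at this
  unfold overlap
  rw [← NNReal.coe_min, ← NNReal.coe_min, ← NNReal.coe_min, ← NNReal.coe_min, mul_comm, ← this]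
  congr 1; ext ω; ring

lemma memLp_riemannSum (h : IsBrownianFamily U P) (hf : IsWeight f f' F C) {i j : ι} (hij : i ≠ j)
    (t τ : ℕ → ℝ≥0) (N : ℕ) : MemLp (riemannSum f (U j) (U i) t τ N) 2 P :=
  memLp_finsetSum _ fun _ _ => memLp_riemannSum_term h hf hij _ _ _

lemma integral_riemannSum_mul (h : IsBrownianFamily U P) (hf : IsWeight f f' F C) {i j : ι}
    (hij : i ≠ j) (t τ t' τ' : ℕ → ℝ≥0) (N N' : ℕ) :
    ∫ ω, riemannSum f (U j) (U i) t τ N ω * riemannSum f (U j) (U i) t' τ' N' ω ∂P =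
      ∑ k ∈ Finset.range N, ∑ l ∈ Finset.range N', overlap (t k) (t (k + 1)) (t' l) (t' (l + 1)) *
        ∫ ω, f (U j (τ k) ω) * f (U j (τ' l) ω) ∂P := by
  simp only [riemannSum, Finset.sum_mul_sum]
  rw [integral_finsetSum]
  · refine Finset.sum_congr rfl fun k _ => ?_
    rw [integral_finsetSum]
    · exact Finset.sum_congr rfl fun l _ => integral_riemannSum_term_mul h hf hij _ _ _ _ _ _
    · exact fun l _ => (memLp_riemannSum_term h hf hij _ _ _).integrable_mul
        (memLp_riemannSum_term h hf hij _ _ _)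
  · exact fun k _ => integrable_finsetSum _ fun l _ =>
      (memLp_riemannSum_term h hf hij _ _ _).integrable_mul (memLp_riemannSum_term h hf hij _ _ _)

/-- Two Riemann sums of fine partitions are close in mean square. -/
theorem integral_sq_riemannSum_sub_le (h : IsBrownianFamily U P) (hf : IsWeight f f' F C) {i j : ι}
    (hij : i ≠ j) {u δ : ℝ≥0} {t τ t' τ' : ℕ → ℝ≥0} {N N' : ℕ} (ht : IsTagged u δ t τ N)
    (ht' : IsTagged u δ t' τ' N') :
    ∫ ω, (riemannSum f (U j) (U i) t τ N ω - riemannSum f (U j) (U i) t' τ' N' ω) ^ 2 ∂P ≤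
      2 * C ^ 2 * δ * u := by
  have hle : ∀ {u δ : ℝ≥0} {t τ : ℕ → ℝ≥0} {N : ℕ}, IsTagged u δ t τ N → ∀ k, (t k : ℝ) ≤ t (k + 1) :=
    fun ht k => by exact_mod_cast ht.mono k.le_succ
  set R := riemannSum f (U j) (U i) t τ N
  set R' := riemannSum f (U j) (U i) t' τ' N'
  have hR : MemLp R 2 P := memLp_riemannSum h hf hij _ _ _
  have hR' : MemLp R' 2 P := memLp_riemannSum h hf hij _ _ _
  have hw := memLp_weight h hf j
  have hexp : ∫ ω, (R ω - R' ω) ^ 2 ∂P = ∫ ω, R ω * R ω ∂P - 2 * ∫ ω, R ω * R' ω ∂P +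
      ∫ ω, R' ω * R' ω ∂P := by
    have e : ∀ ω, (R ω - R' ω) ^ 2 = R ω * R ω - 2 * (R ω * R' ω) + R' ω * R' ω := fun ω => by ring
    have i1 : Integrable (fun ω => R ω * R ω) P := hR.integrable_mul hR
    have i2 : Integrable (fun ω => 2 * (R ω * R' ω)) P := (hR.integrable_mul hR').const_mul 2
    have i3 : Integrable (fun ω => R' ω * R' ω) P := hR'.integrable_mul hR'
    have i12 : Integrable (fun ω => R ω * R ω - 2 * (R ω * R' ω)) P := i1.sub i2
    simp_rw [e]
    rw [integral_add i12 i3, integral_sub i1 i2, integral_const_mul]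
  have diag : ∀ {u δ δ' : ℝ≥0} {t τ t' τ' : ℕ → ℝ≥0} {N N' : ℕ}, IsTagged u δ t τ N →
      IsTagged u δ' t' τ' N' →
      ∑ k ∈ Finset.range N, ∑ l ∈ Finset.range N, overlap (t k) (t (k + 1)) (t l) (t (l + 1)) *
        ∫ ω, f (U j (τ k) ω) * f (U j (τ l) ω) ∂P =
      ∑ k ∈ Finset.range N, ∑ l ∈ Finset.range N', overlap (t k) (t (k + 1)) (t' l) (t' (l + 1)) *
        ∫ ω, f (U j (τ k) ω) * f (U j (τ k) ω) ∂P := by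
    intro u δ δ' t τ t' τ' N N' ht ht'
    refine Finset.sum_congr rfl fun k hk => ?_
    rw [Finset.sum_eq_single k]
    · rw [← Finset.sum_mul, overlap_self (hle ht k),
        sum_overlap (fun l => (t' l : ℝ)) N' (by rw [ht'.first]; exact (t k).coe_nonneg) (hle ht k)]
      have : t (k + 1) ≤ t' N' := by
        rw [ht'.last, ← ht.last]; exact ht.mono (Finset.mem_range.1 hk)
      exact_mod_cast this
    · intro l _ hlk
      rcases lt_or_gt_of_ne hlk with hl | hl
      · rw [overlap_comm, overlap_eq_zero (hle ht l) (hle ht k), zero_mul]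
        exact_mod_cast ht.mono hl
      · rw [overlap_eq_zero (hle ht k) (hle ht l), zero_mul]
        exact_mod_cast ht.mono hl
    · intro hk'; exact absurd hk hk'
  have hsq : ∀ a a', ∫ ω, (f (U j a ω) - f (U j a' ω)) ^ 2 ∂P =
      ∫ ω, f (U j a ω) * f (U j a ω) ∂P - 2 * ∫ ω, f (U j a ω) * f (U j a' ω) ∂P +
        ∫ ω, f (U j a' ω) * f (U j a' ω) ∂P := fun a a' => by
    have e : ∀ ω, (f (U j a ω) - f (U j a' ω)) ^ 2 = f (U j a ω) * f (U j a ω) -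
      2 * (f (U j a ω) * f (U j a' ω)) + f (U j a' ω) * f (U j a' ω) := fun ω => by ring
    have i1 : Integrable (fun ω => f (U j a ω) * f (U j a ω)) P := (hw a).integrable_mul (hw a)
    have i2 : Integrable (fun ω => 2 * (f (U j a ω) * f (U j a' ω))) P :=
      ((hw a).integrable_mul (hw a')).const_mul 2
    have i3 : Integrable (fun ω => f (U j a' ω) * f (U j a' ω)) P := (hw a').integrable_mul (hw a')
    have i12 : Integrable (fun ω => f (U j a ω) * f (U j a ω) - 2 * (f (U j a ω) * f (U j a' ω))) P :=
      i1.sub i2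
    simp_rw [e]
    rw [integral_add i12 i3, integral_sub i1 i2, integral_const_mul]
  rw [hexp, integral_riemannSum_mul h hf hij, integral_riemannSum_mul h hf hij,
    integral_riemannSum_mul h hf hij, diag ht ht', diag ht' ht,
    Finset.sum_comm (s := Finset.range N') (t := Finset.range N)]
  simp_rw [Finset.mul_sum]
  rw [← Finset.sum_sub_distrib, ← Finset.sum_add_distrib]
  have hu : ∑ k ∈ Finset.range N, ∑ l ∈ Finset.range N', overlap (t k) (t (k + 1)) (t' l) (t' (l + 1))
      * (2 * C ^ 2 * δ) = 2 * C ^ 2 * δ * u := by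
    simp_rw [← Finset.sum_mul]
    have : ∀ k ∈ Finset.range N, ∑ l ∈ Finset.range N',
        overlap (t k) (t (k + 1)) (t' l) (t' (l + 1)) = (t (k + 1) : ℝ) - t k := fun k hk => by
      refine sum_overlap (fun l => (t' l : ℝ)) N' (by rw [ht'.first]; exact (t k).coe_nonneg)
        (hle ht k) ?_
      have : t (k + 1) ≤ t' N' := by
        rw [ht'.last, ← ht.last]; exact ht.mono (Finset.mem_range.1 hk)
      exact_mod_cast this
    rw [Finset.sum_congr rfl this, Finset.sum_range_sub (fun k => (t k : ℝ)), ht.last, ht.first]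
    simp; ring
  rw [← hu]
  refine Finset.sum_le_sum fun k _ => ?_
  rw [← Finset.sum_sub_distrib, ← Finset.sum_add_distrib]
  refine Finset.sum_le_sum fun l _ => ?_
  have e : overlap (t k) (t (k + 1)) (t' l) (t' (l + 1)) * ∫ ω, f (U j (τ k) ω) * f (U j (τ k) ω) ∂P -
      2 * (overlap (t k) (t (k + 1)) (t' l) (t' (l + 1)) *
        ∫ ω, f (U j (τ k) ω) * f (U j (τ' l) ω) ∂P) +
      overlap (t' l) (t' (l + 1)) (t k) (t (k + 1)) * ∫ ω, f (U j (τ' l) ω) * f (U j (τ' l) ω) ∂P =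
      overlap (t k) (t (k + 1)) (t' l) (t' (l + 1)) *
        ∫ ω, (f (U j (τ k) ω) - f (U j (τ' l) ω)) ^ 2 ∂P := by
    rw [hsq, overlap_comm (t' l)]; ring
  rw [e]
  by_cases h1 : (t (k + 1) : ℝ) ≤ t' l
  · rw [overlap_eq_zero (hle ht k) (hle ht' l) h1]; simp
  by_cases h2 : (t' (l + 1) : ℝ) ≤ t k
  · rw [overlap_comm, overlap_eq_zero (hle ht' l) (hle ht k) h2]; simp
  refine mul_le_mul_of_nonneg_left ?_ (overlap_nonneg (hle ht k) (hle ht' l))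
  refine (sq_integral_weight_sub_le h hf j _ _).2.trans ?_
  have a1 : (t k : ℝ) ≤ τ k := by exact_mod_cast ht.le_tag k
  have a2 : (τ k : ℝ) ≤ t (k + 1) := by exact_mod_cast ht.tag_le k
  have a3 : (t' l : ℝ) ≤ τ' l := by exact_mod_cast ht'.le_tag l
  have a4 : (τ' l : ℝ) ≤ t' (l + 1) := by exact_mod_cast ht'.tag_le l
  have a5 := ht.mesh k
  have a6 := ht'.mesh l
  have : |(τ k : ℝ) - τ' l| ≤ 2 * δ := by
    rw [abs_le]; constructor <;> linarith
  calc C ^ 2 * |(τ k : ℝ) - τ' l| ≤ C ^ 2 * (2 * δ) := by gcongr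
    _ = _ := by ring

end RiemannSums

end IteratedBM
namespace IteratedBM

section Dyadic

/-- The dyadic mesh `2⁻ᵖ`. -/
noncomputable def dyad (p : ℕ) : ℝ≥0 := 2⁻¹ ^ p

lemma dyad_pos (p : ℕ) : 0 < dyad p := by unfold dyad; positivity

lemma two_pow_mul_dyad (p : ℕ) : ((2 ^ p : ℕ) : ℝ≥0) * dyad p = 1 := by
  unfold dyad; push_cast; rw [← mul_pow]; simp

lemma dyad_eq {p q : ℕ} (h : p ≤ q) : dyad p = ((2 ^ (q - p) : ℕ) : ℝ≥0) * dyad q := by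
  obtain ⟨d, rfl⟩ := Nat.exists_eq_add_of_le h
  rw [Nat.add_sub_cancel_left]
  unfold dyad
  push_cast
  rw [pow_add, mul_comm, mul_assoc, ← mul_pow]; simp

lemma tendsto_dyad : Tendsto (fun p => (dyad p : ℝ)) atTop (𝓝 0) := by
  simp only [dyad, NNReal.coe_pow]
  exact tendsto_pow_atTop_nhds_zero_of_lt_one (by positivity) (by
    rw [NNReal.coe_inv, NNReal.coe_ofNat]; norm_num)

variable {Ω : Type*}

/-- Left-point Riemann sums along the dyadic partition of mesh `2⁻ᵖ`, stopped at `u`. -/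
noncomputable def dyadicSum (f : ℝ → ℝ) (x b : ℝ≥0 → Ω → ℝ) (p K : ℕ) (u : ℝ≥0) (ω : Ω) : ℝ :=
  ∑ j ∈ Finset.range K, f (x ((j : ℝ≥0) * dyad p) ω) *
    (b (min (((j + 1 : ℕ) : ℝ≥0) * dyad p) u) ω - b (min ((j : ℝ≥0) * dyad p) u) ω)

variable {f : ℝ → ℝ} {x b : ℝ≥0 → Ω → ℝ}

lemma dyadicSum_eq_of_le {p K K' : ℕ} {u : ℝ≥0} (hK : K ≤ K') (hu : u ≤ K * dyad p) (ω : Ω) :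
    dyadicSum f x b p K u ω = dyadicSum f x b p K' u ω := by
  unfold dyadicSum
  refine Finset.sum_subset (Finset.range_subset_range.2 hK) fun j _ hj => ?_
  have hj : K ≤ j := by simpa using hj
  have h1 : u ≤ (j : ℝ≥0) * dyad p := hu.trans (by gcongr)
  have h2 : u ≤ ((j + 1 : ℕ) : ℝ≥0) * dyad p := h1.trans (monotone_gridTime _ j.le_succ)
  rw [min_eq_right h1, min_eq_right h2, sub_self, mul_zero]

lemma continuous_dyadicSum {ω : Ω} (hb : Continuous fun t => b t ω) (p K : ℕ) :
    Continuous fun u => dyadicSum f x b p K u ω := by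
  unfold dyadicSum
  refine continuous_finsetSum _ fun j _ => continuous_const.mul ((hb.comp ?_).sub (hb.comp ?_)) <;>
    fun_prop

lemma dyadicSum_grid {p q K k : ℕ} (hpq : p ≤ q) (hk : k ≤ K * 2 ^ (q - p)) (ω : Ω) :
    dyadicSum f x b p K ((k : ℝ≥0) * dyad q) ω = ∑ l ∈ Finset.range k,
      f (x (((l / 2 ^ (q - p) : ℕ) : ℝ≥0) * dyad p) ω) *
        (b (((l + 1 : ℕ) : ℝ≥0) * dyad q) ω - b ((l : ℝ≥0) * dyad q) ω) := by
  set e := 2 ^ (q - p) with he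
  have hepos : 0 < e := by positivity
  have hmin : ∀ j k : ℕ, min ((j : ℝ≥0) * dyad p) ((k : ℝ≥0) * dyad q) =
      ((min (j * e) k : ℕ) : ℝ≥0) * dyad q := fun j k => by
    rw [dyad_eq hpq, ← he, ← mul_assoc, ← Nat.cast_mul, ← min_mul_of_nonneg _ _ (dyad_pos q).le,
      ← Nat.cast_min]
  induction k with
  | zero => simp [dyadicSum]
  | succ k ih =>
    rw [Finset.sum_range_succ, ← ih (by omega), ← sub_eq_iff_eq_add']
    unfold dyadicSum
    rw [← Finset.sum_sub_distrib]
    simp only [hmin]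
    rw [Finset.sum_eq_single (k / e)]
    · have h1 : k / e * e ≤ k := Nat.div_mul_le_self k e
      have h2 : k + 1 ≤ (k / e + 1) * e := by
        have := Nat.lt_mul_div_succ k hepos
        rw [mul_comm] at this; exact this
      rw [min_eq_right h2, min_eq_left (h1.trans k.le_succ), min_eq_right (k.le_succ.trans h2),
        min_eq_left h1]
      ring
    · intro j _ hj
      rcases lt_or_gt_of_ne hj with hj | hj
      · have h1 : (j + 1) * e ≤ k :=
          (Nat.mul_le_mul_right e hj).trans (Nat.div_mul_le_self k e)
        have h2 : j * e ≤ k := (Nat.mul_le_mul_right e j.le_succ).trans h1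
        rw [min_eq_left (h1.trans k.le_succ), min_eq_left (h2.trans k.le_succ), min_eq_left h1,
          min_eq_left h2, sub_self]
      · have h2 : k + 1 ≤ (k / e + 1) * e := by
          have := Nat.lt_mul_div_succ k hepos
          rw [mul_comm] at this; exact this
        have h1 : k + 1 ≤ j * e := h2.trans (Nat.mul_le_mul_right e hj)
        have h3 : k + 1 ≤ (j + 1) * e := h1.trans (Nat.mul_le_mul_right e j.le_succ)
        rw [min_eq_right h1, min_eq_right h3, min_eq_right (k.le_succ.trans h1),
          min_eq_right (k.le_succ.trans h3)]
        ring
    · intro hh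
      exfalso
      apply hh
      rw [Finset.mem_range, Nat.div_lt_iff_lt_mul hepos]
      omega

/-- A locally geometric sequence of continuous functions has a continuous limit. -/
lemma exists_continuous_limit {g : ℕ → ℝ≥0 → ℝ} (hg : ∀ p (M : ℕ), ContinuousOn (g p) (Set.Iic (M : ℝ≥0)))
    (h : ∀ M : ℕ, ∃ p₀, ∀ p ≥ p₀, ∀ u ≤ (M : ℝ≥0), |g (p + 1) u - g p u| ≤ (3 / 4) ^ p) :
    ∃ G : ℝ≥0 → ℝ, Continuous G ∧ ∀ u, Tendsto (fun p => g p u) atTop (𝓝 (G u)) := by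
  have hlim : ∀ u, ∃ a, Tendsto (fun p => g p u) atTop (𝓝 a) := fun u => by
    obtain ⟨p₀, hp₀⟩ := h ⌈u⌉₊
    have hc : CauchySeq fun n => g (n + p₀) u := by
      refine cauchySeq_of_le_geometric (3 / 4) ((3 / 4) ^ p₀) (by norm_num) fun n => ?_
      rw [dist_comm, Real.dist_eq]
      refine (by simpa [add_right_comm] using hp₀ (n + p₀) (by omega) u (Nat.le_ceil u) :
        |g (n + 1 + p₀) u - g (n + p₀) u| ≤ (3 / 4) ^ (n + p₀)).trans_eq ?_
      rw [pow_add, mul_comm]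
    obtain ⟨a, ha⟩ := cauchySeq_tendsto_of_complete hc
    exact ⟨a, (tendsto_add_atTop_iff_nat p₀).1 ha⟩
  choose G hG using hlim
  refine ⟨G, ?_, hG⟩
  have hunif : ∀ M : ℕ, TendstoUniformlyOn g G atTop (Set.Iic (M : ℝ≥0)) := fun M => by
    obtain ⟨p₀, hp₀⟩ := h M
    rw [Metric.tendstoUniformlyOn_iff]
    intro ε hε
    have hz : Tendsto (fun p : ℕ => (3 / 4 : ℝ) ^ p / (1 - 3 / 4)) atTop (𝓝 0) := by
      have := (tendsto_pow_atTop_nhds_zero_of_lt_one (r := (3 / 4 : ℝ)) (by norm_num)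
        (by norm_num)).div_const (1 - 3 / 4)
      simpa using this
    filter_upwards [hz.eventually (gt_mem_nhds hε), eventually_ge_atTop p₀] with p hp hpp u hu
    refine lt_of_le_of_lt ?_ hp
    have hd : ∀ n, dist (g (p + n) u) (g (p + (n + 1)) u) ≤ (3 / 4) ^ p * (3 / 4 : ℝ) ^ n := fun n => by
      rw [dist_comm, Real.dist_eq, ← pow_add]
      exact hp₀ (p + n) (by omega) u hu
    have ht : Tendsto (fun n => g (p + n) u) atTop (𝓝 (G u)) := by
      have := (tendsto_add_atTop_iff_nat p).2 (hG u)
      simpa [add_comm] using this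
    have := dist_le_of_le_geometric_of_tendsto (3 / 4) ((3 / 4) ^ p) (by norm_num) hd ht 0
    rw [dist_comm]
    simpa using this
  rw [continuous_iff_continuousAt]
  intro u
  have hc := (hunif (⌈u⌉₊ + 1)).continuousOn (Frequently.of_forall fun p => hg p _)
  refine hc.continuousAt (Iic_mem_nhds ?_)
  refine lt_of_le_of_lt (Nat.le_ceil u) ?_
  push_cast
  exact lt_add_one _

end Dyadic

section Ito

variable {Ω : Type*} [MeasurableSpace Ω] {P : Measure Ω} [IsProbabilityMeasure P]
  {ι : Type*} [DecidableEq ι] {U : ι → ℝ≥0 → Ω → ℝ} {f f' F : ℝ → ℝ} {C : ℝ}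

lemma measure_le_of_integral_sq_le {Z : Ω → ℝ} (hZ : MemLp Z 2 P) {v ε : ℝ} (hε : 0 < ε)
    (hv : ∫ ω, Z ω ^ 2 ∂P ≤ v) : P {ω | ε ≤ |Z ω|} ≤ ENNReal.ofReal (v / ε ^ 2) := by
  have := mul_meas_ge_le_integral_of_nonneg (μ := P) (f := fun ω => Z ω ^ 2)
    (ae_of_all _ fun ω => sq_nonneg _) hZ.integrable_sq (ε ^ 2)
  have hset : {ω | ε ^ 2 ≤ Z ω ^ 2} = {ω | ε ≤ |Z ω|} := by
    ext ω
    simp only [Set.mem_ofPred_eq]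
    rw [← sq_abs (Z ω)]
    exact pow_le_pow_iff_left₀ hε.le (abs_nonneg _) two_ne_zero
  rw [hset] at this
  rw [← ENNReal.ofReal_toReal (measure_ne_top P _)]
  refine ENNReal.ofReal_le_ofReal ?_
  rw [le_div_iff₀ (by positivity), mul_comm]
  exact this.trans hv

/-- The maximal inequality for the difference of two consecutive dyadic sums, on a fine grid. -/
lemma measure_dyadicSum_sub_grid_le (h : IsBrownianFamily U P) (hf : IsWeight f f' F C) {i j : ι}
    (hij : i ≠ j) (M p q : ℕ) (hpq : p + 1 ≤ q) {ε : ℝ} (hε : 0 < ε) :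
    P {ω | ∃ k ≤ M * 2 ^ q, ε ≤ |dyadicSum f (U j) (U i) (p + 1) (M * 2 ^ (p + 1)) (k * dyad q) ω -
      dyadicSum f (U j) (U i) p (M * 2 ^ p) (k * dyad q) ω|} ≤
      ENNReal.ofReal (C ^ 2 * dyad p * M / ε ^ 2) := by
  set A : ℕ → Ω → ℝ := fun l ω => f (U j (((l / 2 ^ (q - (p + 1)) : ℕ) : ℝ≥0) * dyad (p + 1)) ω) -
    f (U j (((l / 2 ^ (q - p) : ℕ) : ℝ≥0) * dyad p) ω) with hA
  have hAsq := fun l => sq_integral_weight_sub_le h hf j (((l / 2 ^ (q - p) : ℕ) : ℝ≥0) * dyad p)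
    (((l / 2 ^ (q - (p + 1)) : ℕ) : ℝ≥0) * dyad (p + 1))
  have hin := h.isInnovation i (monotone_gridTime (dyad q)) (A := A)
    (fun l => (hf.cont.measurable.comp (IsBrownianFamily.measurable_past (Or.inl hij.symm))).sub
      (hf.cont.measurable.comp (IsBrownianFamily.measurable_past (Or.inl hij.symm))))
    (fun l => (hAsq l).1) (φ := fun _ x => x) (fun _ => measurable_id)
    (fun l => (h.memLp_eval i _ 2).sub (h.memLp_eval i _ 2)) (fun l => h.integral_increment i _ _)
  have hfloor : ∀ r ≤ q, ∀ l : ℕ, ((l / 2 ^ (q - r) : ℕ) : ℝ) * dyad r ≤ l * dyad q ∧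
      l * dyad q ≤ ((l / 2 ^ (q - r) : ℕ) : ℝ) * dyad r + dyad r := fun r hr l => by
    have e : (dyad r : ℝ) = (2 ^ (q - r) : ℕ) * dyad q := by
      exact_mod_cast congrArg NNReal.toReal (dyad_eq hr)
    have hq : (0 : ℝ) < dyad q := by exact_mod_cast dyad_pos q
    have h1 : ((l / 2 ^ (q - r) : ℕ) : ℝ) * (2 ^ (q - r) : ℕ) ≤ l := by
      exact_mod_cast Nat.div_mul_le_self l _
    have h2 : (l : ℝ) ≤ ((l / 2 ^ (q - r) : ℕ) : ℝ) * (2 ^ (q - r) : ℕ) + (2 ^ (q - r) : ℕ) := by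
      have := (Nat.lt_mul_div_succ l (show 0 < 2 ^ (q - r) by positivity)).le
      rw [mul_add, mul_one, mul_comm] at this
      exact_mod_cast this
    rw [e]
    constructor <;> nlinarith
  have hbound : ∀ l, ∫ ω, A l ω ^ 2 ∂P ≤ C ^ 2 * dyad p := fun l => by
    refine (hAsq l).2.trans ?_
    refine mul_le_mul_of_nonneg_left ?_ (sq_nonneg _)
    obtain ⟨a1, a2⟩ := hfloor p (by omega) l
    obtain ⟨b1, b2⟩ := hfloor (p + 1) hpq l
    have hd : (dyad (p + 1) : ℝ) ≤ dyad p := by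
      have : dyad (p + 1) ≤ dyad p := by
        unfold dyad
        exact pow_le_pow_of_le_one (by positivity) (by
          rw [← NNReal.coe_le_coe]; push_cast; norm_num) p.le_succ
      exact_mod_cast this
    push_cast
    rw [abs_le]
    constructor <;> linarith
  have hQ : ∀ l : ℕ, ∫ ω, (U i (((l + 1 : ℕ) : ℝ≥0) * dyad q) ω - U i ((l : ℝ≥0) * dyad q) ω) ^ 2 ∂P =
      dyad q := fun l => by
    rw [integral_sub_sq_of_preBrownian (h.isPreBrownian i) (monotone_gridTime (dyad q) l.le_succ)]
    push_cast; ring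
  refine (measure_mono ?_).trans ((hin.maximal (M * 2 ^ q) hε).trans (ENNReal.ofReal_le_ofReal ?_))
  · rintro ω ⟨k, hk, hle⟩
    refine ⟨k, hk, ?_⟩
    have hp2 : 2 ^ q = 2 ^ p * 2 ^ (q - p) := by rw [← pow_add]; congr 1; omega
    have hp3 : 2 ^ q = 2 ^ (p + 1) * 2 ^ (q - (p + 1)) := by rw [← pow_add]; congr 1; omega
    rw [dyadicSum_grid hpq (by rw [mul_assoc, ← hp3]; exact hk),
      dyadicSum_grid (by omega) (by rw [mul_assoc, ← hp2]; exact hk), ← Finset.sum_sub_distrib] at hle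
    refine hle.trans_eq ?_
    congr 1
    refine Finset.sum_congr rfl fun l _ => ?_
    simp only [hA]; ring
  · gcongr
    simp only [hQ]
    rw [← Finset.sum_mul]
    calc (∑ l ∈ Finset.range (M * 2 ^ q), ∫ ω, A l ω ^ 2 ∂P) * dyad q
        ≤ (∑ l ∈ Finset.range (M * 2 ^ q), C ^ 2 * dyad p) * dyad q := by
          gcongr with l _; exact hbound l
      _ = C ^ 2 * dyad p * M * (((2 ^ q : ℕ) : ℝ) * dyad q) := by
          rw [Finset.sum_const, Finset.card_range, nsmul_eq_mul]; push_cast; ring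
      _ = _ := by
          have : (((2 ^ q : ℕ) : ℝ) * dyad q) = 1 := by exact_mod_cast congrArg NNReal.toReal (two_pow_mul_dyad q)
          rw [this, mul_one]

/-- The maximal inequality for the difference of two consecutive dyadic sums. -/
lemma measure_dyadicSum_sub_le (h : IsBrownianFamily U P) (hf : IsWeight f f' F C) {i j : ι}
    (hij : i ≠ j) (hc : ∀ᵐ ω ∂P, Continuous fun t => U i t ω) (M p : ℕ) {ε : ℝ} (hε : 0 < ε) :
    P {ω | ∃ u ≤ (M : ℝ≥0), ε < |dyadicSum f (U j) (U i) (p + 1) (M * 2 ^ (p + 1)) u ω -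
      dyadicSum f (U j) (U i) p (M * 2 ^ p) u ω|} ≤ ENNReal.ofReal (C ^ 2 * dyad p * M / ε ^ 2) := by
  set D : ℝ≥0 → Ω → ℝ := fun u ω => dyadicSum f (U j) (U i) (p + 1) (M * 2 ^ (p + 1)) u ω -
      dyadicSum f (U j) (U i) p (M * 2 ^ p) u ω with hD
  set E : ℕ → Set Ω := fun q => {ω | ∃ k ≤ M * 2 ^ (p + 1 + q), ε ≤ |D (k * dyad (p + 1 + q)) ω|}
  have hE : Monotone E := by
    refine monotone_nat_of_le_succ fun q => ?_
    rintro ω ⟨k, hk, hle⟩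
    refine ⟨2 * k, by rw [show p + 1 + (q + 1) = p + 1 + q + 1 by ring, pow_succ, ← mul_assoc]; omega, ?_⟩
    have : dyad (p + 1 + q) = 2 * dyad (p + 1 + (q + 1)) := by
      rw [dyad_eq (show p + 1 + q ≤ p + 1 + (q + 1) by omega)]
      simp [show p + 1 + (q + 1) - (p + 1 + q) = 1 by omega]
    rw [this] at hle
    push_cast
    rw [mul_comm (2 : ℝ≥0), mul_assoc]
    exact hle
  have hEm : P (⋃ q, E q) ≤ ENNReal.ofReal (C ^ 2 * dyad p * M / ε ^ 2) := by
    refine le_of_tendsto (tendsto_measure_iUnion_atTop hE) (Eventually.of_forall fun q => ?_)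
    exact measure_dyadicSum_sub_grid_le h hf hij M p (p + 1 + q) (by omega) hε
  refine le_trans (measure_mono_ae ?_) hEm
  filter_upwards [hc] with ω hω
  rintro ⟨u, hu, hlt⟩
  have hDc : Continuous fun u => D u ω := (continuous_dyadicSum hω _ _).sub (continuous_dyadicSum hω _ _)
  set k : ℕ → ℕ := fun q => ⌊u * (2 ^ (p + 1 + q) : ℕ)⌋₊
  have hone : ∀ q, ((2 ^ (p + 1 + q) : ℕ) : ℝ) * dyad (p + 1 + q) = 1 := fun q => by
    exact_mod_cast congrArg NNReal.toReal (two_pow_mul_dyad (p + 1 + q))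
  have hkt : Tendsto (fun q => (k q : ℝ≥0) * dyad (p + 1 + q)) atTop (𝓝 u) := by
    rw [← NNReal.tendsto_coe]
    have hz : Tendsto (fun q => (u : ℝ) - dyad (p + 1 + q)) atTop (𝓝 u) := by
      have := (tendsto_add_atTop_iff_nat (p + 1)).2 tendsto_dyad
      have := this.const_sub (u : ℝ)
      simpa [add_comm] using this
    refine tendsto_of_tendsto_of_tendsto_of_le_of_le hz tendsto_const_nhds (fun q => ?_) (fun q => ?_)
    · have h1 : (u : ℝ) * (2 ^ (p + 1 + q) : ℕ) ≤ k q + 1 := by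
        exact_mod_cast (Nat.lt_floor_add_one (u * ((2 ^ (p + 1 + q) : ℕ) : ℝ≥0))).le
      have h2 := mul_le_mul_of_nonneg_right h1 (dyad (p + 1 + q)).coe_nonneg
      rw [mul_assoc, hone, mul_one, add_mul, one_mul] at h2
      simp only [NNReal.coe_mul, NNReal.coe_natCast]
      linarith
    · have h1 : (k q : ℝ) ≤ u * (2 ^ (p + 1 + q) : ℕ) := by
        exact_mod_cast Nat.floor_le (show 0 ≤ u * ((2 ^ (p + 1 + q) : ℕ) : ℝ≥0) from zero_le)
      have h2 := mul_le_mul_of_nonneg_right h1 (dyad (p + 1 + q)).coe_nonneg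
      rw [mul_assoc, hone, mul_one] at h2
      simpa using h2
  obtain ⟨q, hq⟩ := (((hDc.tendsto u).comp hkt).abs.eventually (lt_mem_nhds hlt)).exists
  refine Set.mem_iUnion.2 ⟨q, k q, ?_, hq.le⟩
  refine Nat.floor_le_of_le ?_
  push_cast
  gcongr

/-- `I` is a continuous version of the Wiener–Itô integral process of `f (x ·)` with respect to
`b` on a half-line, for which Riemann sums with arbitrary tags converge. -/
structure IsItoLimit (P : Measure Ω) (f : ℝ → ℝ) (x b I : ℝ≥0 → Ω → ℝ) : Prop where
  aemeasurable : ∀ u, AEMeasurable (I u) P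
  cont : ∀ᵐ ω ∂P, Continuous fun u => I u ω
  conv : ∀ u, ∀ ε > (0 : ℝ), ∀ η > (0 : ℝ), ∃ δ : ℝ≥0, 0 < δ ∧ ∀ t τ N, IsTagged u δ t τ N →
    P {ω | ε ≤ |riemannSum f x b t τ N ω - I u ω|} ≤ ENNReal.ofReal η
  measurable_of : ∀ m : MeasurableSpace Ω, (∀ t, Measurable[m] (x t)) → (∀ t, Measurable[m] (b t)) →
    ∀ u, Measurable[m] (I u)

omit [MeasurableSpace Ω] in
lemma dyadicSum_eq_riemannSum (x b : ℝ≥0 → Ω → ℝ) (p K : ℕ) (u : ℝ≥0) (ω : Ω) :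
    dyadicSum f x b p K u ω = riemannSum f x b (fun k => min ((k : ℝ≥0) * dyad p) u)
      (fun k => min ((k : ℝ≥0) * dyad p) u) K ω := by
  unfold dyadicSum riemannSum
  refine Finset.sum_congr rfl fun k _ => ?_
  simp only
  rcases le_total ((k : ℝ≥0) * dyad p) u with hk | hk
  · rw [min_eq_left hk]
  · rw [min_eq_right hk, min_eq_right (hk.trans (monotone_gridTime (dyad p) k.le_succ)), sub_self,
      mul_zero, mul_zero]

lemma isTagged_dyad {u δ : ℝ≥0} {p : ℕ} (hp : dyad p ≤ δ) :
    IsTagged u δ (fun k => min ((k : ℝ≥0) * dyad p) u) (fun k => min ((k : ℝ≥0) * dyad p) u)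
      (⌈u⌉₊ * 2 ^ p) where
  mono k l hkl := min_le_min_right _ (monotone_gridTime _ hkl)
  first := by simp
  last := by
    rw [Nat.cast_mul, mul_assoc, two_pow_mul_dyad, mul_one]
    exact min_eq_right (Nat.le_ceil u)
  le_tag k := le_rfl
  tag_le k := min_le_min_right _ (monotone_gridTime _ k.le_succ)
  mesh k := by
    have hp' : (dyad p : ℝ) ≤ δ := by exact_mod_cast hp
    refine le_trans ?_ hp'
    push_cast
    rcases min_cases ((k + 1 : ℝ) * dyad p) (u : ℝ) with ⟨e, _⟩ | ⟨e, _⟩ <;>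
    rcases min_cases ((k : ℝ) * dyad p) (u : ℝ) with ⟨e', _⟩ | ⟨e', _⟩ <;> rw [e, e'] <;>
    nlinarith [(dyad p).coe_nonneg]

theorem exists_isItoLimit (h : IsBrownianFamily U P) (hf : IsWeight f f' F C) {i j : ι}
    (hij : i ≠ j) (hc : ∀ᵐ ω ∂P, Continuous fun t => U i t ω) :
    ∃ I, IsItoLimit P f (U j) (U i) I := by
  set g : ℕ → ℝ≥0 → Ω → ℝ := fun p u => dyadicSum f (U j) (U i) p (⌈u⌉₊ * 2 ^ p) u with hg
  have hgM : ∀ p (M : ℕ) (u : ℝ≥0) ω, u ≤ M → g p u ω =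
      dyadicSum f (U j) (U i) p (M * 2 ^ p) u ω := fun p M u ω hu => by
    refine dyadicSum_eq_of_le (Nat.mul_le_mul_right _ (Nat.ceil_le.2 hu)) ?_ ω
    rw [Nat.cast_mul, mul_assoc, two_pow_mul_dyad, mul_one]
    exact Nat.le_ceil u
  have hgm : ∀ p u, Measurable (g p u) := fun p u =>
    Finset.measurable_sum _ fun k _ => (hf.cont.measurable.comp (h.measurable _ _)).mul
      ((h.measurable _ _).sub (h.measurable _ _))
  have hgood : ∀ᵐ ω ∂P, ∃ G : ℝ≥0 → ℝ, Continuous G ∧ ∀ u, Tendsto (fun p => g p u ω) atTop (𝓝 (G u)) := by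
    have hbc : ∀ M : ℕ, ∀ᵐ ω ∂P, ∀ᶠ p in atTop, ω ∉ {ω | ∃ u ≤ (M : ℝ≥0), (3 / 4 : ℝ) ^ p <
        |dyadicSum f (U j) (U i) (p + 1) (M * 2 ^ (p + 1)) u ω -
          dyadicSum f (U j) (U i) p (M * 2 ^ p) u ω|} := fun M => by
      refine ae_eventually_notMem ?_
      have hs : Summable fun p : ℕ => C ^ 2 * M * (8 / 9 : ℝ) ^ p :=
        (summable_geometric_of_lt_one (by norm_num) (by norm_num)).mul_left _
      refine ne_top_of_le_ne_top hs.tsum_ofReal_ne_top (ENNReal.tsum_le_tsum fun p => ?_)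
      refine (measure_dyadicSum_sub_le h hf hij hc M p (by positivity)).trans_eq ?_
      congr 1
      simp only [dyad, NNReal.coe_pow, NNReal.coe_inv, NNReal.coe_ofNat]
      rw [← pow_mul, mul_comm p 2, pow_mul, mul_right_comm, mul_div_assoc, ← div_pow]
      norm_num
    filter_upwards [ae_all_iff.2 hbc, hc] with ω hω hcω
    refine exists_continuous_limit (fun p M => ?_) fun M => ?_
    · refine (continuous_dyadicSum (f := f) (x := U j) hcω p (M * 2 ^ p)).continuousOn.congr
        fun u hu => hgM p M u ω hu
    · obtain ⟨p₀, hp₀⟩ := eventually_atTop.1 (hω M)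
      refine ⟨p₀, fun p hp u hu => ?_⟩
      have := hp₀ p hp
      simp only [not_exists, not_and, not_lt] at this
      rw [hgM _ M u ω hu, hgM _ M u ω hu]
      exact this u hu
  have hlim : ∀ᵐ ω ∂P, ∀ u, Tendsto (fun p => g p u ω) atTop
      (𝓝 (limsup (fun p => g p u ω) atTop)) := by
    filter_upwards [hgood] with ω ⟨G, _, hG⟩ u
    rw [(hG u).limsup_eq]; exact hG u
  refine ⟨fun u ω => limsup (fun p => g p u ω) atTop, fun u => ?_, ?_, fun u ε hε η hη => ?_,
    fun m hx hb u => ?_⟩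
  · exact aemeasurable_of_tendsto_metrizable_ae atTop (fun p => (hgm p u).aemeasurable)
      (hlim.mono fun ω hω => hω u)
  · filter_upwards [hgood] with ω ⟨G, hGc, hG⟩
    convert hGc using 2 with u
    exact (hG u).limsup_eq
  · set δ : ℝ≥0 := (η * ε ^ 2 / (2 * (8 * C ^ 2 * u + 1))).toNNReal with hδ
    have hδ' : (δ : ℝ) = η * ε ^ 2 / (2 * (8 * C ^ 2 * u + 1)) := Real.coe_toNNReal _ (by positivity)
    have hδpos : 0 < δ := Real.toNNReal_pos.2 (by positivity)
    refine ⟨δ, hδpos, fun t τ N ht => ?_⟩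
    have hmeas := tendstoInMeasure_of_tendsto_ae (fun p => (hgm p u).aestronglyMeasurable)
      (hlim.mono fun ω hω => hω u)
    rw [tendstoInMeasure_iff_norm] at hmeas
    have hev1 := (hmeas (ε / 2) (by positivity)).eventually
      (ge_mem_nhds (show (0 : ENNReal) < ENNReal.ofReal (η / 2) by simpa using hη))
    have hev2 := tendsto_dyad.eventually (ge_mem_nhds (show (0 : ℝ) < δ by exact_mod_cast hδpos))
    obtain ⟨p, hp1, hp2⟩ := (hev1.and hev2).exists
    have hp2 : dyad p ≤ δ := by exact_mod_cast hp2
    have hR := integral_sq_riemannSum_sub_le h hf hij ht (isTagged_dyad (u := u) hp2)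
    have hch := measure_le_of_integral_sq_le (ε := ε / 2) ((memLp_riemannSum h hf hij t τ N).sub
      (memLp_riemannSum h hf hij _ _ _)) (by positivity) hR
    have hle : ENNReal.ofReal (2 * C ^ 2 * δ * u / (ε / 2) ^ 2) ≤ ENNReal.ofReal (η / 2) := by
      refine ENNReal.ofReal_le_ofReal ?_
      rw [hδ']
      have : 2 * C ^ 2 * (η * ε ^ 2 / (2 * (8 * C ^ 2 * u + 1))) * u / (ε / 2) ^ 2 =
          η / 2 * (8 * C ^ 2 * u / (8 * C ^ 2 * u + 1)) := by
        field_simp; ring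
      rw [this]
      refine mul_le_of_le_one_right (by positivity) ?_
      rw [div_le_one (by positivity)]
      linarith
    have hsplit : {ω | ε ≤ |riemannSum f (U j) (U i) t τ N ω - limsup (fun p => g p u ω) atTop|} ⊆
        {ω | ε / 2 ≤ |riemannSum f (U j) (U i) t τ N ω - g p u ω|} ∪
        {ω | ε / 2 ≤ ‖g p u ω - limsup (fun p => g p u ω) atTop‖} := fun ω hω => by
      by_contra hcon
      simp only [Set.mem_union, Set.mem_ofPred_eq, not_or, not_le, Real.norm_eq_abs] at hcon hω
      have := abs_sub_le (riemannSum f (U j) (U i) t τ N ω) (g p u ω) (limsup (fun p => g p u ω) atTop)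
      linarith
    refine (measure_mono hsplit).trans ((measure_union_le _ _).trans ?_)
    have e : ENNReal.ofReal η = ENNReal.ofReal (η / 2) + ENNReal.ofReal (η / 2) := by
      rw [← ENNReal.ofReal_add (by positivity) (by positivity)]; congr 1; ring
    rw [e]
    refine add_le_add (le_trans (le_of_eq ?_) (hch.trans hle)) hp1
    simp only [hg, dyadicSum_eq_riemannSum]
    rfl
  · refine Measurable.limsup fun p => Finset.measurable_sum _ fun k _ => ?_
    exact (hf.cont.measurable.comp (hx _)).mul ((hb _).sub (hb _))

end Ito

end IteratedBM
namespace IteratedBM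

section Integrals

variable {Ω : Type*} [MeasurableSpace Ω] {P : Measure Ω} [IsProbabilityMeasure P]

lemma eq_zero_of_forall_le_ofReal {a : ENNReal} (h : ∀ η > (0 : ℝ), a ≤ ENNReal.ofReal η) : a = 0 := by
  refine le_antisymm (ENNReal.le_of_forall_pos_le_add fun η hη _ => ?_) zero_le
  rw [zero_add]
  simpa using h η (by exact_mod_cast hη)

/-- A partition with equal steps. -/
lemma exists_isPartition {a b δ : ℝ} (hab : a ≤ b) (hδ : 0 < δ) :
    ∃ (N : ℕ) (z : Fin (N + 1) → ℝ), IsPartition a b δ z := by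
  obtain ⟨N, hN⟩ := exists_nat_gt ((b - a) / δ)
  have hN0 : (0 : ℝ) < N := lt_of_le_of_lt (div_nonneg (sub_nonneg.2 hab) hδ.le) hN
  refine ⟨N, fun i => a + (b - a) * ((i : ℕ) / N), ?_, by simp, by simp [hN0.ne'], fun i => ?_⟩
  · intro i j hij
    have : ((i : ℕ) : ℝ) ≤ (j : ℕ) := by exact_mod_cast hij
    have := sub_nonneg.2 hab
    simp only
    gcongr
  · rw [div_lt_iff₀ hδ] at hN
    simp only [Fin.val_succ, Fin.val_castSucc]
    push_cast
    have : a + (b - a) * ((i + 1 : ℝ) / N) - (a + (b - a) * (i / N)) = (b - a) / N := by ring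
    rw [this, div_le_iff₀ hN0]
    linarith

omit [IsProbabilityMeasure P] in
lemma TendstoRiemann.ae_eq {G : ℝ → ℝ → Ω → ℝ} {a b : ℝ} (hab : a ≤ b) {L L' : Ω → ℝ}
    (h : TendstoRiemann P G a b L) (h' : TendstoRiemann P G a b L') : L =ᵐ[P] L' := by
  have key : ∀ ε > (0 : ℝ), P {ω | 2 * ε ≤ |L ω - L' ω|} = 0 := fun ε hε => by
    refine eq_zero_of_forall_le_ofReal fun η hη => ?_
    obtain ⟨δ, hδ, H⟩ := h ε hε (η / 2) (by positivity)
    obtain ⟨δ', hδ', H'⟩ := h' ε hε (η / 2) (by positivity)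
    obtain ⟨N, z, hz⟩ := exists_isPartition hab (lt_min hδ hδ')
    have h1 := H N z ⟨hz.mono, hz.first, hz.last, fun i => (hz.mesh i).trans (min_le_left _ _)⟩
    have h2 := H' N z ⟨hz.mono, hz.first, hz.last, fun i => (hz.mesh i).trans (min_le_right _ _)⟩
    have e : ENNReal.ofReal η = ENNReal.ofReal (η / 2) + ENNReal.ofReal (η / 2) := by
      rw [← ENNReal.ofReal_add (by positivity) (by positivity)]; congr 1; ring
    rw [e]
    refine (measure_mono ?_).trans ((measure_union_le _ _).trans (add_le_add h1 h2))
    intro ω hω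
    by_contra hcon
    simp only [Set.mem_union, Set.mem_ofPred_eq, not_or, not_le] at hcon hω
    have := abs_sub_le (L ω) (∑ i : Fin N, G (z i.castSucc) (z i.succ) ω) (L' ω)
    rw [abs_sub_comm (L ω) (∑ i : Fin N, G (z i.castSucc) (z i.succ) ω)] at this
    linarith
  have hall : ∀ᵐ ω ∂P, ∀ n : ℕ, |L ω - L' ω| < 2 * (1 / ((n : ℝ) + 1)) := by
    rw [ae_all_iff]
    intro n
    have := key (1 / ((n : ℝ) + 1)) (by positivity)
    rw [ae_iff]
    simpa using this
  filter_upwards [hall] with ω hω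
  by_contra hne
  obtain ⟨n, hn⟩ := exists_nat_one_div_lt (show 0 < |L ω - L' ω| / 2 by
    have := abs_pos.2 (sub_ne_zero.2 hne); linarith)
  have := hω n
  linarith

omit [IsProbabilityMeasure P] in
/-- Continuous versions of the integral process are indistinguishable. -/
lemma IsIntegralProcess.ae_eq {G : ℝ → ℝ → Ω → ℝ} {I I' : ℝ → Ω → ℝ}
    (h : IsIntegralProcess P G I) (h' : IsIntegralProcess P G I') :
    ∀ᵐ ω ∂P, ∀ u, I u ω = I' u ω := by
  have hu : ∀ u, I u =ᵐ[P] I' u := fun u => by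
    rcases le_total 0 u with h0 | h0
    · exact (h.of_nonneg u h0).ae_eq h0 (h'.of_nonneg u h0)
    · filter_upwards [(h.of_nonpos u h0).ae_eq h0 (h'.of_nonpos u h0)] with ω hω
      linarith
  have hq : ∀ᵐ ω ∂P, ∀ q : ℚ, I q ω = I' q ω := ae_all_iff.2 fun q => hu q
  filter_upwards [hq, h.cont, h'.cont] with ω hω hc hc'
  exact congrFun (Rat.isDenseEmbedding_coe_real.dense.equalizer hc hc' (funext hω))

/-- Passing from partitions indexed by `Fin (N + 1)` to sequences. -/
lemma IsPartition.exists_seq {a b δ : ℝ} {N : ℕ} {z : Fin (N + 1) → ℝ} (hδ : 0 ≤ δ)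
    (hz : IsPartition a b δ z) :
    ∃ y : ℕ → ℝ, Monotone y ∧ y 0 = a ∧ (∀ k, N ≤ k → y k = b) ∧ (∀ k, y (k + 1) - y k ≤ δ) ∧
      ∀ G : ℝ → ℝ → ℝ, ∑ i : Fin N, G (z i.castSucc) (z i.succ) =
        ∑ k ∈ Finset.range N, G (y k) (y (k + 1)) := by
  refine ⟨fun k => z ⟨min k N, by omega⟩, ?_, ?_, ?_, ?_, ?_⟩
  · intro k l hkl
    refine hz.mono ?_
    rw [Fin.mk_le_mk]
    omega
  · simp only [Nat.zero_min]; exact hz.first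
  · intro k hk
    simp only [min_eq_right hk]
    exact hz.last
  · intro k
    simp only
    rcases lt_or_ge k N with hk | hk
    · have := hz.mesh ⟨k, hk⟩
      convert! this using 3 <;> simp <;> omega
    · simp only [min_eq_right hk, min_eq_right (hk.trans k.le_succ), sub_self]
      exact hδ
  · intro G
    rw [Finset.sum_range]
    refine Finset.sum_congr rfl fun i _ => ?_
    congr 2 <;> ext <;> simp

variable {f f' F : ℝ → ℝ} {C : ℝ} {X B : ℝ → Ω → ℝ}

omit [IsProbabilityMeasure P] in
lemma IsTwoSidedBrownian.continuous (hX : IsTwoSidedBrownian X P) :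
    ∀ᵐ ω ∂P, Continuous fun t => X t ω := by
  filter_upwards [hX.pos.cont, hX.neg.cont] with ω h1 h2
  have e : (fun t => X t ω) = fun t : ℝ => if 0 ≤ t then X ((t.toNNReal : ℝ≥0) : ℝ) ω else
      X (-(((-t).toNNReal : ℝ≥0) : ℝ)) ω := by
    ext t
    split_ifs with h
    · rw [Real.coe_toNNReal _ h]
    · rw [Real.coe_toNNReal _ (by linarith), neg_neg]
  rw [e]
  refine Continuous.if_le (h1.comp continuous_real_toNNReal)
    (h2.comp (continuous_real_toNNReal.comp continuous_neg)) continuous_const continuous_id ?_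
  rintro t rfl
  simp

omit [IsProbabilityMeasure P] in
lemma integral_abs_increment_cube {Y : ℝ≥0 → Ω → ℝ} (hY : IsPreBrownianReal Y P) (s t : ℝ≥0) :
    Integrable (fun ω => |Y t ω - Y s ω| ^ 3) P ∧ ∫ ω, |Y t ω - Y s ω| ^ 3 ∂P =
      √|(t : ℝ) - s| ^ 3 * ∫ x, |x| ^ 3 ∂(gaussianReal 0 1) := by
  have h1 : HasLaw (Y t - Y s) (gaussianReal 0 (nndist (t : ℝ) s)) P := hY.hasLaw_sub t s
  have h2 : (gaussianReal 0 1).map (fun x => √|(t : ℝ) - s| * x) =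
      gaussianReal 0 (nndist (t : ℝ) s) := by
    rw [gaussianReal_map_const_mul]
    congr 1
    · simp
    · ext
      rw [mul_one, coe_nndist, Real.dist_eq]
      exact Real.sq_sqrt (abs_nonneg _)
  have g : PolyGrowth fun x => |x| ^ 3 := PolyGrowth.id.abs.pow 3
  have e : ∀ x : ℝ, |√|(t : ℝ) - s| * x| ^ 3 = √|(t : ℝ) - s| ^ 3 * |x| ^ 3 := fun x => by
    rw [abs_mul, abs_of_nonneg (Real.sqrt_nonneg _), mul_pow]
  constructor
  · have h3 : Integrable (fun x => |x| ^ 3) (gaussianReal 0 (nndist (t : ℝ) s)) := by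
      rw [← h2, integrable_map_measure (by fun_prop) (by fun_prop)]
      simp only [Function.comp_def, e]
      exact g.integrable.const_mul _
    rw [← h1.map_eq] at h3
    exact h3.comp_aemeasurable h1.aemeasurable
  · have := h1.integral_comp (f := fun x => |x| ^ 3) (by fun_prop)
    refine this.trans ?_
    rw [← h2, integral_map (by fun_prop) (by fun_prop)]
    simp only [e]
    rw [integral_const_mul]

lemma IsWeight.abs_trapezoid (h : IsWeight f f' F C) (x y : ℝ) :
    |(f x + f y) / 2 * (y - x) - (F y - F x)| ≤ 2 * C * |y - x| ^ 3 := by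
  have h1 := h.abs_taylor_two x y
  have h2 := h.abs_taylor_one x y
  have e : (f x + f y) / 2 * (y - x) - (F y - F x) = (f y - f x - f' x * (y - x)) * (y - x) / 2 -
      (F y - F x - f x * (y - x) - f' x / 2 * (y - x) ^ 2) := by ring
  rw [e]
  refine (abs_sub _ _).trans ?_
  rw [abs_div, abs_mul, abs_two]
  have h3 := mul_le_mul_of_nonneg_right h2 (abs_nonneg (y - x))
  have h4 : 0 ≤ C * |y - x| ^ 3 := mul_nonneg h.nonneg (by positivity)
  have h5 : C * |y - x| ^ 2 * |y - x| = C * |y - x| ^ 3 := by ring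
  linarith

/-- The trapezoidal rule. -/
lemma tendstoRiemann_trapezoid (hX : IsTwoSidedBrownian X P) (hf : IsWeight f f' F C) {a b : ℝ}
    (hab : a ≤ b) (h0 : 0 ≤ a ∨ b ≤ 0) :
    TendstoRiemann P (fun a b ω => (f (X a ω) + f (X b ω)) / 2 * (X b ω - X a ω)) a b
      (fun ω => F (X b ω) - F (X a ω)) := by
  have hC := hf.nonneg
  set w := ∫ x, |x| ^ 3 ∂(gaussianReal 0 1)
  have hw : 0 ≤ w := integral_nonneg fun _ => by positivity
  have hinc : ∀ s t, a ≤ s → s ≤ t → t ≤ b → Integrable (fun ω => |X t ω - X s ω| ^ 3) P ∧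
      ∫ ω, |X t ω - X s ω| ^ 3 ∂P = √(t - s) ^ 3 * w := by
    intro s t hs hst ht
    rcases h0 with h0 | h0
    · have := integral_abs_increment_cube hX.pos.toIsPreBrownianReal s.toNNReal t.toNNReal
      rw [Real.coe_toNNReal _ (by linarith), Real.coe_toNNReal _ (by linarith),
        abs_of_nonneg (by linarith)] at this
      exact this
    · have := integral_abs_increment_cube hX.neg.toIsPreBrownianReal (-s).toNNReal (-t).toNNReal
      rw [Real.coe_toNNReal _ (by linarith), Real.coe_toNNReal _ (by linarith), neg_neg, neg_neg,
        abs_of_nonpos (by linarith)] at this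
      rwa [show -(-t - -s) = t - s by ring] at this
  intro ε hε η hη
  obtain ⟨δ, hδ, hδη⟩ : ∃ δ > (0 : ℝ), 2 * C * w * (b - a) * √δ ≤ η * ε := by
    refine ⟨(η * ε / (2 * C * w * (b - a) + 1)) ^ 2, ?_, ?_⟩
    · have : 0 ≤ 2 * C * w * (b - a) := mul_nonneg (by positivity) (by linarith)
      positivity
    · have : 0 ≤ 2 * C * w * (b - a) := mul_nonneg (by positivity) (by linarith)
      rw [Real.sqrt_sq (by positivity), ← mul_div_assoc, div_le_iff₀ (by positivity)]
      nlinarith [mul_pos hη hε]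
  refine ⟨δ, hδ, fun N z hz => ?_⟩
  obtain ⟨y, hy, hya, hyb, hym, hysum⟩ := hz.exists_seq hδ.le
  have hyab : ∀ k, a ≤ y k ∧ y k ≤ b := fun k => by
    refine ⟨hya ▸ hy (Nat.zero_le k), ?_⟩
    rw [← hyb (max k N) (le_max_right _ _)]
    exact hy (le_max_left _ _)
  set D : Ω → ℝ := fun ω => ∑ k ∈ Finset.range N, 2 * C * |X (y (k + 1)) ω - X (y k) ω| ^ 3 with hD
  have hterm := fun k => hinc (y k) (y (k + 1)) (hyab k).1 (hy k.le_succ) (hyab (k + 1)).2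
  have hDi : Integrable D P := integrable_finsetSum _ fun k _ => (hterm k).1.const_mul _
  have hDint : ∫ ω, D ω ∂P ≤ η * ε := by
    rw [integral_finsetSum _ fun k _ => (hterm k).1.const_mul _]
    have hk : ∀ k, ∫ ω, 2 * C * |X (y (k + 1)) ω - X (y k) ω| ^ 3 ∂P ≤
        2 * C * w * √δ * (y (k + 1) - y k) := fun k => by
      have hnn : 0 ≤ y (k + 1) - y k := sub_nonneg.2 (hy k.le_succ)
      rw [integral_const_mul, (hterm k).2, pow_succ, Real.sq_sqrt hnn]
      have := Real.sqrt_le_sqrt (hym k)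
      calc 2 * C * ((y (k + 1) - y k) * √(y (k + 1) - y k) * w)
          ≤ 2 * C * ((y (k + 1) - y k) * √δ * w) := by gcongr
        _ = _ := by ring
    refine (Finset.sum_le_sum fun k _ => hk k).trans ?_
    rw [← Finset.mul_sum, Finset.sum_range_sub, hyb N le_rfl, hya]
    linarith
  have hle : ∀ ω, |∑ i : Fin N, (f (X (z i.castSucc) ω) + f (X (z i.succ) ω)) / 2 *
      (X (z i.succ) ω - X (z i.castSucc) ω) - (F (X b ω) - F (X a ω))| ≤ D ω := fun ω => by
    rw [hysum (fun s t => (f (X s ω) + f (X t ω)) / 2 * (X t ω - X s ω))]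
    have e : F (X b ω) - F (X a ω) = ∑ k ∈ Finset.range N, (F (X (y (k + 1)) ω) - F (X (y k) ω)) := by
      rw [Finset.sum_range_sub (fun k => F (X (y k) ω)), hyb N le_rfl, hya]
    rw [e, ← Finset.sum_sub_distrib]
    exact (Finset.abs_sum_le_sum_abs _ _).trans (Finset.sum_le_sum fun k _ => hf.abs_trapezoid _ _)
  have hmk := mul_meas_ge_le_integral_of_nonneg (μ := P) (f := D) (ae_of_all _ fun ω =>
    Finset.sum_nonneg fun k _ => by positivity) hDi ε
  refine (measure_mono (t := {ω | ε ≤ D ω}) fun ω hω => le_trans hω (hle ω)).trans ?_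
  rw [← ENNReal.ofReal_toReal (measure_ne_top P _)]
  refine ENNReal.ofReal_le_ofReal ?_
  have : ε * P.real {ω | ε ≤ D ω} ≤ η * ε := hmk.trans hDint
  rw [mul_comm η] at this
  exact le_of_mul_le_mul_left this hε

theorem isStratonovichIntegral (hX : IsTwoSidedBrownian X P) (hf : IsWeight f f' F C) :
    IsStratonovichIntegral P (fun z ω => f (X z ω)) X (fun u ω => F (X u ω) - F (X 0 ω)) where
  aemeasurable u := ((hf.contF.measurable.comp (hX.measurable u)).sub
    (hf.contF.measurable.comp (hX.measurable 0))).aemeasurable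
  cont := by
    filter_upwards [hX.continuous] with ω hω
    exact (hf.contF.comp hω).sub continuous_const
  of_nonneg u hu := tendstoRiemann_trapezoid hX hf hu (Or.inl le_rfl)
  of_nonpos u hu := by
    have := tendstoRiemann_trapezoid hX hf hu (Or.inr le_rfl)
    simpa using this

omit [IsProbabilityMeasure P] in
lemma IsItoLimit.ae_zero {x b I : ℝ≥0 → Ω → ℝ} (h : IsItoLimit P f x b I) : ∀ᵐ ω ∂P, I 0 ω = 0 := by
  have key : ∀ n : ℕ, P {ω | 1 / ((n : ℝ) + 1) ≤ |I 0 ω|} = 0 := fun n => by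
    refine eq_zero_of_forall_le_ofReal fun η hη => ?_
    obtain ⟨δ, hδ, H⟩ := h.conv 0 (1 / ((n : ℝ) + 1)) (by positivity) η hη
    have := H (fun _ => 0) (fun _ => 0) 0 ⟨monotone_const, rfl, rfl, fun _ => le_rfl, fun _ => le_rfl,
      fun _ => by simp⟩
    simpa [riemannSum] using this
  have hall : ∀ᵐ ω ∂P, ∀ n : ℕ, |I 0 ω| < 1 / ((n : ℝ) + 1) := by
    rw [ae_all_iff]
    intro n
    rw [ae_iff]
    simpa using key n
  filter_upwards [hall] with ω hω
  by_contra hne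
  obtain ⟨n, hn⟩ := exists_nat_one_div_lt (abs_pos.2 hne)
  exact absurd (hω n) (not_lt.2 hn.le)

omit [IsProbabilityMeasure P] in
/-- Gluing the Wiener–Itô integrals along the two half-lines. -/
theorem isItoIntegral {I : Bool → ℝ≥0 → Ω → ℝ}
    (hI : ∀ σ, IsItoLimit P f (halfLines X B (true, σ)) (halfLines X B (false, σ)) (I σ)) :
    IsItoIntegral P (fun z ω => f (X z ω)) B
      (fun u ω => I true u.toNNReal ω + I false (-u).toNNReal ω) where
  aemeasurable u := ((hI true).aemeasurable _).add ((hI false).aemeasurable _)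
  cont := by
    filter_upwards [(hI true).cont, (hI false).cont] with ω h1 h2
    exact (h1.comp continuous_real_toNNReal).add
      (h2.comp (continuous_real_toNNReal.comp continuous_neg))
  of_nonneg u hu := by
    intro ε hε η hη
    obtain ⟨δ, hδ, H⟩ := (hI true).conv u.toNNReal ε hε η hη
    refine ⟨δ, hδ, fun N z hz => ?_⟩
    obtain ⟨y, hy, hya, hyb, hym, hysum⟩ := hz.exists_seq δ.coe_nonneg
    have hy0 : ∀ k, 0 ≤ y k := fun k => hya ▸ hy (Nat.zero_le k)
    have := H (fun k => (y k).toNNReal) (fun k => (y k).toNNReal) N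
      ⟨fun k l hkl => Real.toNNReal_le_toNNReal (hy hkl), by simp [hya], by simp [hyb N le_rfl],
        fun k => le_rfl, fun k => Real.toNNReal_le_toNNReal (hy k.le_succ), fun k => by
        rw [Real.coe_toNNReal _ (hy0 _), Real.coe_toNNReal _ (hy0 _)]; exact hym k⟩
    refine le_trans (measure_mono_ae ?_) this
    filter_upwards [(hI false).ae_zero] with ω hω
    intro hle
    have hle : ε ≤ |_| := hle
    rw [hysum (fun s t => f (X s ω) * (B t ω - B s ω))] at hle
    change ε ≤ |_|
    convert! hle using 3
    · refine Finset.sum_congr rfl fun k _ => ?_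
      simp only [halfLines, cond_true, cond_false]
      rw [Real.coe_toNNReal _ (hy0 _), Real.coe_toNNReal _ (hy0 _)]
    · rw [Real.toNNReal_of_nonpos (neg_nonpos.2 hu), hω, add_zero]
  of_nonpos u hu := by
    intro ε hε η hη
    obtain ⟨δ, hδ, H⟩ := (hI false).conv (-u).toNNReal ε hε η hη
    refine ⟨δ, hδ, fun N z hz => ?_⟩
    obtain ⟨y, hy, hya, hyb, hym, hysum⟩ := hz.exists_seq δ.coe_nonneg
    have hy0 : ∀ k, 0 ≤ -y k := fun k => by
      have : y k ≤ y (max k N) := hy (le_max_left _ _)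
      rw [hyb _ (le_max_right _ _)] at this
      linarith
    set t : ℕ → ℝ≥0 := fun k => (-y (N - k)).toNNReal with ht
    have htm : Monotone t := fun k l hkl => Real.toNNReal_le_toNNReal
      (neg_le_neg (hy (Nat.sub_le_sub_left hkl N)))
    have := H t (fun k => t (k + 1)) N ⟨htm, by simp [ht, hyb N le_rfl], by simp [ht, hya],
        fun k => htm k.le_succ, fun k => le_rfl, fun k => by
        simp only [ht]
        rw [Real.coe_toNNReal _ (hy0 _), Real.coe_toNNReal _ (hy0 _)]
        rcases lt_or_ge k N with hk | hk
        · have := hym (N - (k + 1))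
          rw [show N - (k + 1) + 1 = N - k by omega] at this
          linarith
        · rw [show N - (k + 1) = N - k by omega]; simp⟩
    refine le_trans (measure_mono_ae ?_) this
    filter_upwards [(hI true).ae_zero] with ω hω
    intro hle
    have hle : ε ≤ |_| := hle
    rw [hysum (fun s t => f (X s ω) * (B t ω - B s ω)), ← Finset.sum_range_reflect] at hle
    change ε ≤ |_|
    rw [← abs_neg] at hle
    have e : riemannSum f (halfLines X B (true, false)) (halfLines X B (false, false)) t
        (fun k => t (k + 1)) N ω = -∑ j ∈ Finset.range N, f (X (y (N - 1 - j)) ω) *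
          (B (y (N - 1 - j + 1)) ω - B (y (N - 1 - j)) ω) := by
      unfold riemannSum
      rw [← Finset.sum_neg_distrib]
      refine Finset.sum_congr rfl fun k hk => ?_
      have hk := Finset.mem_range.1 hk
      simp only [halfLines, cond_true, cond_false, ht]
      rw [Real.coe_toNNReal _ (hy0 _), Real.coe_toNNReal _ (hy0 _), neg_neg, neg_neg,
        show N - (k + 1) = N - 1 - k by omega, show N - 1 - k + 1 = N - k by omega]
      ring
    convert! hle using 2
    rw [e, Real.toNNReal_of_nonpos hu, hω]
    ring

end Integrals

end IteratedBM
namespace IteratedBM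

section Approximation

variable {Ω : Type*} [MeasurableSpace Ω] {P : Measure Ω} [IsProbabilityMeasure P]

/-- Convergence in distribution tested on bounded Lipschitz functions. -/
lemma tendstoInDistribution_iff_lipschitz {E : Type*} [PseudoEMetricSpace E] [MeasurableSpace E]
    [BorelSpace E] {A : ℕ → Ω → E} {Z : Ω → E} :
    TendstoInDistribution A atTop Z (fun _ => P) P ↔
      (∀ n, AEMeasurable (A n) P) ∧ AEMeasurable Z P ∧
      ∀ g : E → ℝ, (∃ C : ℝ, ∀ x y, dist (g x) (g y) ≤ C) → (∃ L, LipschitzWith L g) →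
        Tendsto (fun n => ∫ ω, g (A n ω) ∂P) atTop (𝓝 (∫ ω, g (Z ω) ∂P)) := by
  have key : ∀ (g : E → ℝ) (L : ℝ≥0), LipschitzWith L g → ∀ W : Ω → E, AEMeasurable W P →
      ∫ x, g x ∂(P.map W) = ∫ ω, g (W ω) ∂P := fun g L hg W hW =>
    integral_map hW hg.continuous.measurable.aestronglyMeasurable
  constructor
  · intro h
    refine ⟨h.forall_aemeasurable, h.aemeasurable_limit, fun g hb ⟨L, hL⟩ => ?_⟩
    have := tendsto_iff_forall_lipschitz_integral_tendsto.1 h.tendsto g hb ⟨L, hL⟩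
    simp only [ProbabilityMeasure.coe_mk] at this
    rw [key g L hL _ h.aemeasurable_limit] at this
    exact this.congr fun n => key g L hL _ (h.forall_aemeasurable n)
  · rintro ⟨h1, h2, h3⟩
    refine ⟨h1, h2, tendsto_iff_forall_lipschitz_integral_tendsto.2 fun g hb ⟨L, hL⟩ => ?_⟩
    simp only [ProbabilityMeasure.coe_mk]
    rw [key g L hL _ h2]
    exact (h3 g hb ⟨L, hL⟩).congr fun n => (key g L hL _ (h1 n)).symm

lemma integrable_comp_of_bounded {E : Type*} [PseudoEMetricSpace E] [MeasurableSpace E]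
    [BorelSpace E] {g : E → ℝ} (hb : ∃ C : ℝ, ∀ x y, dist (g x) (g y) ≤ C) (hg : Continuous g)
    {W : Ω → E} (hW : AEMeasurable W P) : Integrable (fun ω => g (W ω)) P := by
  obtain ⟨C, hC⟩ := hb
  obtain ⟨ω₀⟩ : Nonempty Ω := P.nonempty_of_neZero
  refine Integrable.of_bound (hg.measurable.comp_aemeasurable hW).aestronglyMeasurable
    (C + |g (W ω₀)|) (ae_of_all _ fun ω => ?_)
  have := hC (W ω) (W ω₀)
  rw [Real.dist_eq] at this
  have h2 := abs_sub_abs_le_abs_sub (g (W ω)) (g (W ω₀))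
  rw [Real.norm_eq_abs]
  linarith

/-- Convergence in distribution by approximation: a double limit. -/
theorem tendstoInDistribution_of_approx {E : Type*} [PseudoMetricSpace E] [MeasurableSpace E]
    [BorelSpace E] {Y : ℕ → Ω → E} {A : ℕ → ℕ → Ω → E} {A' : ℕ → Ω → E} {Z : Ω → E}
    {e : ℕ → ℕ → ℝ} {e' : ℕ → ℝ} (hY : ∀ n, AEMeasurable (Y n) P)
    (hA : ∀ r, TendstoInDistribution (A r) atTop (A' r) (fun _ => P) P)
    (hA' : TendstoInDistribution A' atTop Z (fun _ => P) P)
    (hD : ∀ r n, ∃ D : Ω → ℝ, Integrable D P ∧ (∀ ω, dist (Y n ω) (A r n ω) ≤ D ω) ∧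
      ∫ ω, D ω ∂P ≤ e r n)
    (he : ∀ r, Tendsto (e r) atTop (𝓝 (e' r))) (he' : Tendsto e' atTop (𝓝 0)) :
    TendstoInDistribution Y atTop Z (fun _ => P) P := by
  refine tendstoInDistribution_iff_lipschitz.2 ⟨hY, hA'.aemeasurable_limit, fun g hb ⟨L, hL⟩ => ?_⟩
  have h1 : ∀ r n, |∫ ω, g (Y n ω) ∂P - ∫ ω, g (A r n ω) ∂P| ≤ L * e r n := fun r n => by
    obtain ⟨D, hDi, hDd, hDe⟩ := hD r n
    have hi1 := integrable_comp_of_bounded hb hL.continuous (hY n)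
    have hi2 := integrable_comp_of_bounded hb hL.continuous ((hA r).forall_aemeasurable n)
    rw [← integral_sub hi1 hi2]
    refine abs_integral_le_integral_abs.trans ?_
    calc ∫ ω, |g (Y n ω) - g (A r n ω)| ∂P ≤ ∫ ω, L * D ω ∂P := by
          refine integral_mono (hi1.sub hi2).abs (hDi.const_mul _) fun ω => ?_
          exact (hL.dist_le_mul _ _).trans (mul_le_mul_of_nonneg_left (hDd ω) L.coe_nonneg)
      _ ≤ L * e r n := by
          rw [integral_const_mul]
          exact mul_le_mul_of_nonneg_left hDe L.coe_nonneg
  rw [Metric.tendsto_atTop']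
  intro ε hε
  have hev1 : ∀ᶠ r in atTop, (L : ℝ) * e' r < ε / 3 := by
    have := he'.const_mul (L : ℝ)
    rw [mul_zero] at this
    exact this.eventually (gt_mem_nhds (by positivity))
  have hev2 := Metric.tendsto_nhds.1 ((tendstoInDistribution_iff_lipschitz.1 hA').2.2 g hb ⟨L, hL⟩)
    (ε / 3) (by positivity)
  obtain ⟨r, hr1, hr2⟩ := (hev1.and hev2).exists
  have hev3 := ((he r).const_mul (L : ℝ)).eventually (gt_mem_nhds hr1)
  have hev4 := Metric.tendsto_nhds.1
    ((tendstoInDistribution_iff_lipschitz.1 (hA r)).2.2 g hb ⟨L, hL⟩) (ε / 3) (by positivity)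
  obtain ⟨n₀, hn₀⟩ := eventually_atTop.1 (hev3.and hev4)
  refine ⟨n₀, fun n hn => ?_⟩
  obtain ⟨h3, h4⟩ := hn₀ n hn.le
  have h5 := (h1 r n).trans_lt h3
  rw [← Real.dist_eq] at h5
  have h6 := dist_triangle4 (∫ ω, g (Y n ω) ∂P) (∫ ω, g (A r n ω) ∂P) (∫ ω, g (A' r ω) ∂P)
    (∫ ω, g (Z ω) ∂P)
  linarith

omit [IsProbabilityMeasure P] in
lemma tendstoInMeasure_pi {J : Type*} [Fintype J] {A : ℕ → Ω → J → ℝ} {Z : Ω → J → ℝ}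
    (h : ∀ j, TendstoInMeasure P (fun n ω => A n ω j) atTop fun ω => Z ω j) :
    TendstoInMeasure P A atTop Z := by
  rw [tendstoInMeasure_iff_dist]
  intro ε hε
  have hs : Tendsto (fun n => ∑ j, P {ω | ε ≤ dist (A n ω j) (Z ω j)}) atTop (𝓝 0) := by
    have := tendsto_finsetSum Finset.univ fun j _ => tendstoInMeasure_iff_dist.1 (h j) ε hε
    simpa using this
  refine tendsto_of_tendsto_of_tendsto_of_le_of_le tendsto_const_nhds hs (fun _ => zero_le)
    fun n => ?_
  refine (measure_mono fun ω hω => ?_).trans (measure_iUnion_fintype_le P _)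
  by_contra hcon
  simp only [Set.mem_iUnion, Set.mem_ofPred_eq, not_exists, not_le] at hcon hω
  exact absurd ((dist_pi_lt_iff hε).2 hcon) (not_lt.2 hω)

end Approximation

section Walk

variable {Ω : Type*} [MeasurableSpace Ω] {P : Measure Ω} [IsProbabilityMeasure P]
  {f f' F : ℝ → ℝ} {C : ℝ}

/-- The normalized signed variation of `x` along the grid of step `δ`. -/
noncomputable def walkSum (κ : ℕ) (f : ℝ → ℝ) (x : ℝ≥0 → Ω → ℝ) (δ : ℝ≥0) (N : ℕ) (ω : Ω) : ℝ :=
  √(δ : ℝ) / √(δ : ℝ) ^ κ * gridSum κ f (fun k => x ((k : ℝ≥0) * δ) ω) N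

/-- The limit of the normalized signed variations on a half-line. -/
noncomputable def walkLimit (κ : ℕ) (F : ℝ → ℝ) (x I : ℝ≥0 → Ω → ℝ) (u : ℝ≥0) (ω : Ω) : ℝ :=
  linCoeff κ * (F (x u ω) - F (x 0 ω)) + √(residualVar κ) * I u ω

lemma exists_block_approx {ι : Type*} [DecidableEq ι] {U : ι → ℝ≥0 → Ω → ℝ}
    (h : IsBrownianFamily U P) (hf : IsWeight f f' F C) (κ : ℕ) (i : ι) :
    ∃ K, 0 ≤ K ∧ ∀ δ : ℝ≥0, 0 < δ → ∀ N r : ℕ, 0 < r → ∃ D : Ω → ℝ, Integrable D P ∧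
      (∀ ω, |walkSum κ f (U i) δ N ω
        - (linCoeff κ * (F (U i (((2 * N : ℕ) : ℝ≥0) * δ) ω) - F (U i 0 ω))
        + ∑ j ∈ Finset.range r, f (U i (((2 * N * j / r : ℕ) : ℝ≥0) * δ) ω) *
          (residualSum U κ i δ (2 * N * (j + 1) / r) ω - residualSum U κ i δ (2 * N * j / r) ω))|
        ≤ D ω) ∧
      ∫ ω, D ω ∂P ≤ K * (√(δ : ℝ) * (√(N * δ) + N * δ)) +
        C * √(residualVar κ) * ((2 * N : ℕ) * δ / √r) := by
  obtain ⟨K, hK, H⟩ := exists_gridSum_expansion h hf κ i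
  refine ⟨K, hK, fun δ hδ N r hr => ?_⟩
  obtain ⟨D₁, hi₁, hb₁, he₁⟩ := H δ hδ N
  obtain ⟨D₂, hi₂, hb₂, he₂⟩ := exists_coarse_sum h hf κ i hδ (2 * N) hr
  refine ⟨fun ω => D₁ ω + D₂ ω, hi₁.add hi₂, fun ω => ?_, ?_⟩
  · refine le_trans (le_of_eq ?_) ((abs_add_le _ _).trans (add_le_add (hb₁ ω) (hb₂ ω)))
    congr 1
    unfold walkSum
    ring
  · rw [integral_add hi₁ hi₂]
    exact add_le_add he₁ he₂

lemma measurable_walkSum {x : ℝ≥0 → Ω → ℝ} (h : ∀ t, Measurable (x t)) (hf : Continuous f)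
    (κ : ℕ) (δ : ℝ≥0) (N : ℕ) : Measurable (walkSum κ f x δ N) := by
  refine Measurable.const_mul (Finset.measurable_sum _ fun l _ => ?_) _
  have := hf.measurable
  exact (this.comp (h _)).mul ((((h _).sub (h _)).pow_const _).add
    ((((h _).sub (h _)).pow_const _).const_mul _))

lemma IsBrownianFamily.integral_abs_increment_le {ι : Type*} [DecidableEq ι] {U : ι → ℝ≥0 → Ω → ℝ}
    (h : IsBrownianFamily U P) (i : ι) {s t : ℝ≥0} (hst : s ≤ t) :
    ∫ ω, |U i t ω - U i s ω| ∂P ≤ √((t : ℝ) - s) := by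
  refine integral_abs_le_sqrt ((h.memLp_eval i t 2).sub (h.memLp_eval i s 2)) ?_
  have := integral_sub_sq_of_preBrownian (h.isPreBrownian i) hst
  exact this.le

lemma tendsto_floor_div_mul {δ : ℕ → ℝ≥0} (hδ : ∀ n, 0 < δ n) (hδ0 : Tendsto δ atTop (𝓝 0))
    (p : ℝ≥0) : Tendsto (fun n => (⌊p / δ n⌋₊ : ℝ) * δ n) atTop (𝓝 p) := by
  have hδ0' : Tendsto (fun n => (δ n : ℝ)) atTop (𝓝 0) := by
    have := NNReal.tendsto_coe.2 hδ0
    rwa [NNReal.coe_zero] at this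
  have hl : Tendsto (fun n => (p : ℝ) - δ n) atTop (𝓝 p) := by
    simpa using hδ0'.const_sub (p : ℝ)
  refine tendsto_of_tendsto_of_tendsto_of_le_of_le hl tendsto_const_nhds (fun n => ?_) fun n => ?_
  · have h1 : p / δ n ≤ (⌊p / δ n⌋₊ : ℝ≥0) + 1 := (Nat.lt_floor_add_one _).le
    rw [div_le_iff₀ (hδ n), add_mul, one_mul] at h1
    have h2 : (p : ℝ) ≤ (⌊p / δ n⌋₊ : ℝ) * δ n + δ n := by exact_mod_cast h1
    simp only
    linarith
  · have h1 : (⌊p / δ n⌋₊ : ℝ≥0) ≤ p / δ n := Nat.floor_le zero_le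
    rw [le_div_iff₀ (hδ n)] at h1
    exact_mod_cast h1

end Walk

end IteratedBM
namespace IteratedBM

section WalkLimit

variable {Ω : Type*} [MeasurableSpace Ω] {P : Measure Ω} [IsProbabilityMeasure P]
  {f f' F : ℝ → ℝ} {C : ℝ} {U : Bool × Bool → ℝ≥0 → Ω → ℝ} {I : Bool → ℝ≥0 → Ω → ℝ}

lemma tendsto_floor_mul_div {δ : ℕ → ℝ≥0} (hδ0 : Tendsto δ atTop (𝓝 0)) {N : ℕ → ℕ} {y : ℝ≥0}
    (hN : Tendsto (fun n => ((2 * N n : ℕ) : ℝ) * δ n) atTop (𝓝 y)) (l : ℕ) {r : ℕ} (hr : 0 < r) :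
    Tendsto (fun n => ((2 * N n * l / r : ℕ) : ℝ) * δ n) atTop (𝓝 (y * l / r : ℝ≥0)) := by
  have hr' : (0 : ℝ) < r := by exact_mod_cast hr
  have hδ0' : Tendsto (fun n => (δ n : ℝ)) atTop (𝓝 0) := by
    have := NNReal.tendsto_coe.2 hδ0
    rwa [NNReal.coe_zero] at this
  have hu : Tendsto (fun n => ((2 * N n : ℕ) : ℝ) * δ n * l / r) atTop (𝓝 (y * l / r : ℝ≥0)) := by
    push_cast at hN ⊢
    exact (hN.mul_const _).div_const _
  have hl : Tendsto (fun n => ((2 * N n : ℕ) : ℝ) * δ n * l / r - δ n) atTop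
      (𝓝 (y * l / r : ℝ≥0)) := by simpa using hu.sub hδ0'
  refine tendsto_of_tendsto_of_tendsto_of_le_of_le hl hu (fun n => ?_) fun n => ?_
  · have h1 : 2 * N n * l ≤ (2 * N n * l / r + 1) * r := by
      have := Nat.lt_div_mul_add (a := 2 * N n * l) hr
      rw [add_mul, one_mul]; exact this.le
    have h2 : ((2 * N n : ℕ) : ℝ) * l ≤ ((2 * N n * l / r : ℕ) + 1) * r := by exact_mod_cast h1
    have h3 : ((2 * N n : ℕ) : ℝ) * l / r ≤ (2 * N n * l / r : ℕ) + 1 := (div_le_iff₀ hr').2 h2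
    have h4 := mul_le_mul_of_nonneg_right h3 (δ n).coe_nonneg
    have e : ((2 * N n : ℕ) : ℝ) * δ n * l / r = ((2 * N n : ℕ) : ℝ) * l / r * δ n := by ring
    simp only [e]
    linarith
  · have h3 : ((2 * N n * l / r : ℕ) : ℝ) ≤ ((2 * N n : ℕ) : ℝ) * l / r := by
      have := @Nat.cast_div_le ℝ _ _ _ (2 * N n * l) r
      exact_mod_cast this
    have e : ((2 * N n : ℕ) : ℝ) * δ n * l / r = ((2 * N n : ℕ) : ℝ) * l / r * δ n := by ring
    simp only [e]
    exact mul_le_mul_of_nonneg_right h3 (δ n).coe_nonneg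

lemma isTagged_uniform (y : ℝ≥0) {r : ℕ} (hr : 0 < r) {η : ℝ≥0} (hη : y / r ≤ η) :
    IsTagged y η (fun l : ℕ => y * l / r) (fun l : ℕ => y * l / r) r where
  mono := fun a b hab => by simp only; gcongr
  first := by simp
  last := mul_div_cancel_right₀ _ (by exact_mod_cast hr.ne')
  le_tag := fun _ => le_rfl
  tag_le := fun k => by gcongr; simp
  mesh := fun k => by
    have : (y / r : ℝ) ≤ η := by exact_mod_cast hη
    push_cast
    refine le_trans (le_of_eq ?_) this
    ring

/-- Joint convergence of the values of `X` and of the normalized signed variations along the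
half-lines. -/
theorem tendstoInDistribution_walkSum (h : IsBrownianFamily U P) (hf : IsWeight f f' F C) (κ : ℕ)
    (hI : ∀ σ, IsItoLimit P f (U (true, σ)) (U (false, σ)) (I σ)) {δ : ℕ → ℝ≥0}
    (hδ : ∀ n, 0 < δ n) (hδ0 : Tendsto δ atTop (𝓝 0)) {J₁ J₂ : Type*} [Fintype J₁] [Fintype J₂]
    (s : J₁ → Bool) (p : J₁ → ℝ≥0) (σ : J₂ → Bool) (y : J₂ → ℝ≥0) (N : ℕ → J₂ → ℕ)
    (hN : ∀ j, Tendsto (fun n => ((2 * N n j : ℕ) : ℝ) * δ n) atTop (𝓝 (y j))) :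
    TendstoInDistribution (fun n ω => Sum.elim (fun a => U (true, s a) (p a) ω)
        fun b => walkSum κ f (U (true, σ b)) (δ n) (N n b) ω) atTop
      (fun ω => Sum.elim (fun a => U (true, s a) (p a) ω)
        fun b => walkLimit κ F (U (true, σ b)) (I (σ b)) (y b) ω) (fun _ => P) P := by
  have hFc : Continuous F := hf.contF
  have hδ0' : Tendsto (fun n => (δ n : ℝ)) atTop (𝓝 0) := by
    have := NNReal.tendsto_coe.2 hδ0
    rwa [NNReal.coe_zero] at this
  set c := linCoeff κ with hc
  -- the approximation with `r + 1` blocks as a function of a random vector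
  let g : ∀ r : ℕ, (J₁ ⊕ (Bool × (J₂ × Fin (r + 2))) → ℝ) → (J₁ ⊕ J₂ → ℝ) := fun r v =>
    Sum.elim (fun a => v (.inl a)) fun b =>
      c * (F (v (.inr (true, b, Fin.last _))) - F (v (.inr (true, b, 0)))) +
      ∑ l : Fin (r + 1), f (v (.inr (true, b, l.castSucc))) *
        (v (.inr (false, b, l.succ)) - v (.inr (false, b, l.castSucc)))
  have hg : ∀ r, Continuous (g r) := fun r => by
    refine continuous_pi fun j => ?_
    rcases j with a | b
    · exact continuous_apply _
    · refine Continuous.add (continuous_const.mul ((hFc.comp (continuous_apply _)).sub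
        (hFc.comp (continuous_apply _)))) (continuous_finsetSum _ fun l _ => ?_)
      exact (hf.cont.comp (continuous_apply _)).mul ((continuous_apply _).sub (continuous_apply _))
  let τ : ∀ r : ℕ, J₁ ⊕ (Bool × (J₂ × Fin (r + 2))) → Bool := fun r => Sum.elim (fun _ => true) fun q => q.1
  let s' : ∀ r : ℕ, J₁ ⊕ (Bool × (J₂ × Fin (r + 2))) → Bool := fun r => Sum.elim s fun q => σ q.2.1
  let m : ∀ r : ℕ, ℕ → J₁ ⊕ (Bool × (J₂ × Fin (r + 2))) → ℕ := fun r n =>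
    Sum.elim (fun a => ⌊p a / δ n⌋₊) fun q => 2 * N n q.2.1 * (q.2.2 : ℕ) / (r + 1)
  let p' : ∀ r : ℕ, J₁ ⊕ (Bool × (J₂ × Fin (r + 2))) → ℝ≥0 := fun r =>
    Sum.elim p fun q => y q.2.1 * ((q.2.2 : ℕ) : ℝ≥0) / ((r + 1 : ℕ) : ℝ≥0)
  have hCLT := fun r => (tendstoInDistribution_residualSum h κ hδ hδ0 (τ r) (s' r) (m r) (p' r) (by
    rintro (a | q)
    · exact tendsto_floor_div_mul hδ hδ0 (p a)
    · exact tendsto_floor_mul_div hδ0 (hN q.2.1) _ r.succ_pos)).continuous_comp (hg r)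
  choose K hK HK using fun σ => exists_block_approx h hf κ (true, σ)
  refine tendstoInDistribution_of_approx (e := fun r n => ∑ _a : J₁, √(δ n : ℝ) +
    ∑ b : J₂, (K (σ b) * (√(δ n : ℝ) * (√(N n b * δ n) + N n b * δ n)) +
      C * √(residualVar κ) * ((2 * N n b : ℕ) * δ n / √(r + 1 : ℕ))))
    (e' := fun r => ∑ b : J₂, C * √(residualVar κ) * (y b / √(r + 1 : ℕ))) (fun n => ?_) hCLT ?_ ?_ ?_ ?_
  · refine (measurable_pi_lambda _ fun j => ?_).aemeasurable
    rcases j with a | b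
    · exact h.measurable _ _
    · exact measurable_walkSum (fun t => h.measurable _ t) hf.cont κ _ _
  · refine TendstoInMeasure.tendstoInDistribution (tendstoInMeasure_pi fun j => ?_)
      fun r => (hCLT r).aemeasurable_limit
    rcases j with a | b
    · rw [tendstoInMeasure_iff_dist]
      intro ε hε
      have : ∀ r : ℕ, {ω | ε ≤ dist ((g r ∘ fun ω j => cond (τ r j) (U (true, s' r j) (p' r j) ω)
          (√(residualVar κ) * U (false, s' r j) (p' r j) ω)) ω (.inl a))
          (U (true, s a) (p a) ω)} = ∅ := fun r => by
        ext ω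
        simp only [Set.mem_ofPred_eq, Set.mem_empty_iff_false, iff_false, not_le]
        change dist (U (true, s a) (p a) ω) (U (true, s a) (p a) ω) < ε
        rwa [dist_self]
      simp only [Sum.elim_inl]
      simp only [this, measure_empty]
      exact tendsto_const_nhds
    · have e : ∀ (r : ℕ) ω, (g r ∘ fun ω j => cond (τ r j) (U (true, s' r j) (p' r j) ω)
          (√(residualVar κ) * U (false, s' r j) (p' r j) ω)) ω (.inr b) =
          c * (F (U (true, σ b) (y b) ω) - F (U (true, σ b) 0 ω)) + √(residualVar κ) *
          riemannSum f (U (true, σ b)) (U (false, σ b)) (fun l : ℕ => y b * l / ((r + 1 : ℕ) : ℝ≥0))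
            (fun l : ℕ => y b * l / ((r + 1 : ℕ) : ℝ≥0)) (r + 1) ω := fun r ω => by
        have e1 : y b * (((Fin.last (r + 1) : Fin (r + 2)) : ℕ) : ℝ≥0) / ((r + 1 : ℕ) : ℝ≥0) = y b := by
          rw [Fin.val_last]
          exact mul_div_cancel_right₀ _ (by positivity)
        have e0 : y b * (((0 : Fin (r + 2)) : ℕ) : ℝ≥0) / ((r + 1 : ℕ) : ℝ≥0) = 0 := by simp
        simp only [g, Function.comp, Sum.elim_inr, τ, s', p', cond_true, cond_false, e1, e0]
        rw [riemannSum, Finset.mul_sum, Finset.sum_range]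
        congr 1
        refine Finset.sum_congr rfl fun l _ => ?_
        simp only [Fin.val_castSucc, Fin.val_succ]
        ring
      rw [tendstoInMeasure_iff_dist]
      intro ε hε
      simp only [e, Sum.elim_inr, walkLimit]
      rw [ENNReal.tendsto_nhds_zero]
      intro η hη
      rcases eq_or_ne η ⊤ with rfl | hη'
      · exact Eventually.of_forall fun _ => le_top
      have hη0 : 0 < η.toReal := ENNReal.toReal_pos hη.ne' hη'
      obtain ⟨d, hd, H⟩ := (hI (σ b)).conv (y b) (ε / (√(residualVar κ) + 1)) (by positivity)
        η.toReal hη0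
      rw [ENNReal.ofReal_toReal hη'] at H
      have hmesh : ∀ᶠ r : ℕ in atTop, y b / ((r + 1 : ℕ) : ℝ≥0) ≤ d := by
        obtain ⟨r₀, hr₀⟩ := exists_nat_ge (y b / d)
        filter_upwards [eventually_ge_atTop r₀] with r hr
        rw [div_le_iff₀ (by positivity)]
        rw [div_le_iff₀ hd] at hr₀
        refine hr₀.trans ?_
        rw [mul_comm]
        gcongr
        exact_mod_cast hr.trans (Nat.le_succ r)
      filter_upwards [hmesh] with r hr
      refine (measure_mono fun ω hω => ?_).trans (H _ _ _ (isTagged_uniform (y b) r.succ_pos hr))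
      simp only [Set.mem_ofPred_eq] at hω ⊢
      rw [div_le_iff₀ (by positivity)]
      rw [Real.dist_eq, add_sub_add_left_eq_sub, ← mul_sub, abs_mul,
        abs_of_nonneg (Real.sqrt_nonneg _)] at hω
      refine hω.trans ?_
      rw [mul_comm]
      exact mul_le_mul_of_nonneg_left (by linarith) (abs_nonneg _)
  · intro r n
    choose D hDi hDb hDe using fun b => HK (σ b) (δ n) (hδ n) (N n b) (r + 1) r.succ_pos
    have hfl : ∀ a, (⌊p a / δ n⌋₊ : ℝ≥0) * δ n ≤ p a := fun a => by
      have h1 : (⌊p a / δ n⌋₊ : ℝ≥0) ≤ p a / δ n := Nat.floor_le zero_le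
      rwa [le_div_iff₀ (hδ n)] at h1
    have hfl' : ∀ a, (p a : ℝ) - ((⌊p a / δ n⌋₊ : ℝ≥0) * δ n : ℝ≥0) ≤ δ n := fun a => by
      have h1 : p a / δ n ≤ (⌊p a / δ n⌋₊ : ℝ≥0) + 1 := (Nat.lt_floor_add_one _).le
      rw [div_le_iff₀ (hδ n), add_mul, one_mul] at h1
      have h2 : (p a : ℝ) ≤ ((⌊p a / δ n⌋₊ : ℝ≥0) * δ n : ℝ≥0) + δ n := by exact_mod_cast h1
      linarith
    have hXi : ∀ a, Integrable (fun ω => |U (true, s a) (p a) ω -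
        U (true, s a) ((⌊p a / δ n⌋₊ : ℝ≥0) * δ n) ω|) P := fun a =>
      (((h.memLp_eval _ _ 2).sub (h.memLp_eval _ _ 2)).integrable (by norm_num)).abs
    have hS1 : Integrable (fun ω => ∑ a, |U (true, s a) (p a) ω -
        U (true, s a) ((⌊p a / δ n⌋₊ : ℝ≥0) * δ n) ω|) P := integrable_finsetSum _ fun a _ => hXi a
    have hS2 : Integrable (fun ω => ∑ b, D b ω) P := integrable_finsetSum _ fun b _ => hDi b
    have hD0 : ∀ b ω, 0 ≤ D b ω := fun b ω => (abs_nonneg _).trans (hDb b ω)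
    have n1 : ∀ ω, 0 ≤ ∑ a, |U (true, s a) (p a) ω -
        U (true, s a) ((⌊p a / δ n⌋₊ : ℝ≥0) * δ n) ω| := fun ω =>
      Finset.sum_nonneg fun _ _ => abs_nonneg _
    have n2 : ∀ ω, 0 ≤ ∑ b, D b ω := fun ω => Finset.sum_nonneg fun b _ => hD0 b ω
    refine ⟨fun ω => (∑ a, |U (true, s a) (p a) ω -
        U (true, s a) ((⌊p a / δ n⌋₊ : ℝ≥0) * δ n) ω|) + ∑ b, D b ω, hS1.add hS2, fun ω => ?_, ?_⟩
    · refine (dist_pi_le_iff (add_nonneg (n1 ω) (n2 ω))).2 ?_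
      rintro (a | b)
      · refine le_trans ?_ (le_add_of_nonneg_right (n2 ω))
        exact Finset.single_le_sum (f := fun a => |U (true, s a) (p a) ω -
          U (true, s a) ((⌊p a / δ n⌋₊ : ℝ≥0) * δ n) ω|) (fun _ _ => abs_nonneg _) (Finset.mem_univ a)
      · refine le_trans ?_ (le_add_of_nonneg_left (n1 ω))
        refine le_trans ?_ (Finset.single_le_sum (f := fun b => D b ω) (fun b _ => hD0 b ω)
          (Finset.mem_univ b))
        refine le_trans (le_of_eq ?_) (hDb b ω)
        have e1 : 2 * N n b * ((Fin.last (r + 1) : Fin (r + 2)) : ℕ) / (r + 1) = 2 * N n b := by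
          rw [Fin.val_last]
          exact Nat.mul_div_cancel _ r.succ_pos
        have e0 : 2 * N n b * ((0 : Fin (r + 2)) : ℕ) / (r + 1) = 0 := by simp
        rw [Real.dist_eq]
        simp only [g, Function.comp, Sum.elim_inr, τ, s', m, cond_true, cond_false, e1, e0,
          Finset.sum_range, Fin.val_castSucc, Fin.val_succ, Nat.cast_zero, zero_mul]
        rfl
    · rw [integral_add hS1 hS2, integral_finsetSum _ fun a _ => hXi a,
        integral_finsetSum _ fun b _ => hDi b]
      refine add_le_add (Finset.sum_le_sum fun a _ => ?_) (Finset.sum_le_sum fun b _ => hDe b)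
      exact (h.integral_abs_increment_le _ (hfl a)).trans (Real.sqrt_le_sqrt (hfl' a))
  · intro r
    have hsq : Tendsto (fun n => √(δ n : ℝ)) atTop (𝓝 0) := by
      have := (Real.continuous_sqrt.tendsto 0).comp hδ0'
      rwa [Real.sqrt_zero] at this
    have t1 : Tendsto (fun n => ∑ _a : J₁, √(δ n : ℝ)) atTop (𝓝 0) := by
      have := tendsto_finsetSum (Finset.univ : Finset J₁) fun _ _ => hsq
      simpa using this
    have hNr : ∀ b, Tendsto (fun n => (N n b : ℝ) * δ n) atTop (𝓝 (y b / 2)) := fun b => by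
      refine ((hN b).div_const 2).congr fun n => ?_
      push_cast; ring
    have t2 := tendsto_finsetSum (Finset.univ : Finset J₂) fun b _ =>
      ((hsq.mul (((Real.continuous_sqrt.tendsto _).comp (hNr b)).add (hNr b))).const_mul
        (K (σ b))).add (((hN b).div_const (√(r + 1 : ℕ))).const_mul (C * √(residualVar κ)))
    have := t1.add t2
    simpa using this
  · have hr : Tendsto (fun r : ℕ => √((r + 1 : ℕ) : ℝ)) atTop atTop :=
      Real.tendsto_sqrt_atTop.comp (tendsto_natCast_atTop_atTop.comp (tendsto_add_atTop_nat 1))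
    have := tendsto_finsetSum (Finset.univ : Finset J₂) fun b _ =>
      ((tendsto_const_nhds (x := (y b : ℝ))).div_atTop hr).const_mul (C * √(residualVar κ))
    simpa using this

end WalkLimit

end IteratedBM
namespace IteratedBM

section Mixing

variable {Ω : Type*} {m : MeasurableSpace Ω} [mΩ : MeasurableSpace Ω] {P : Measure Ω} [IsProbabilityMeasure P]

lemma tendsto_integral_of_tendstoInDistribution {E : Type*} [TopologicalSpace E]
    [MeasurableSpace E] [BorelSpace E] {A : ℕ → Ω → E} {Z : Ω → E}
    (h : TendstoInDistribution A atTop Z (fun _ => P) P) {g : E → ℝ} (hg : Continuous g) {C : ℝ}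
    (hb : ∀ x, |g x| ≤ C) :
    Tendsto (fun n => ∫ ω, g (A n ω) ∂P) atTop (𝓝 (∫ ω, g (Z ω) ∂P)) := by
  have := ProbabilityMeasure.tendsto_iff_forall_integral_tendsto.1 h.tendsto
    (BoundedContinuousFunction.ofNormedAddCommGroup g hg C hb)
  simp only [ProbabilityMeasure.coe_mk, BoundedContinuousFunction.coe_ofNormedAddCommGroup] at this
  rw [integral_map h.aemeasurable_limit hg.measurable.aestronglyMeasurable] at this
  exact this.congr fun n =>
    integral_map (h.forall_aemeasurable n) hg.measurable.aestronglyMeasurable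

lemma measurable_eval_of_countable {D E : Type*} [Countable D] [MeasurableSpace D]
    [MeasurableSingletonClass D] [MeasurableSpace E] {Z : Ω → D} (hZ : Measurable Z)
    {G : D → Ω → E} (hG : ∀ d, Measurable (G d)) : Measurable fun ω => G (Z ω) ω := by
  have : Measurable (fun p : Ω × D => G p.2 p.1) := measurable_from_prod_countable_left fun d => hG d
  exact this.comp (measurable_id.prodMk hZ)

/-- Integrating a random function at an independent random index with countably many values. -/
lemma integral_eval_of_indep {D : Type*} [Countable D] [MeasurableSpace D]
    [MeasurableSingletonClass D] (hm : m ≤ mΩ) {Z : Ω → D}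
    (hZ : Measurable Z) (hi : Indep m (MeasurableSpace.comap Z inferInstance) P) {G : D → Ω → ℝ}
    (hG : ∀ d, Measurable[m] (G d)) {C : ℝ} (hb : ∀ d ω, |G d ω| ≤ C) :
    ∫ ω, G (Z ω) ω ∂P = ∫ ω, (∫ ω', G (Z ω) ω' ∂P) ∂P := by
  have hGm : ∀ d, Measurable (G d) := fun d => (hG d).mono hm le_rfl
  have hs : ∀ d, MeasurableSet (Z ⁻¹' {d}) := fun d => hZ (measurableSet_singleton d)
  have hdis : Pairwise (Function.onFun Disjoint fun d => Z ⁻¹' {d}) := fun a b hab => by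
    refine Set.disjoint_left.2 fun ω h1 h2 => hab ?_
    rw [← show Z ω = a from h1, show Z ω = b from h2]
  have hun : (⋃ d, Z ⁻¹' {d}) = Set.univ := Set.eq_univ_of_forall fun ω =>
    Set.mem_iUnion.2 ⟨Z ω, rfl⟩
  have hint1 : Integrable (fun ω => G (Z ω) ω) P :=
    Integrable.of_bound (measurable_eval_of_countable hZ hGm).aestronglyMeasurable C
      (ae_of_all _ fun ω => hb _ _)
  have hbI : ∀ d, |∫ ω', G d ω' ∂P| ≤ C := fun d => by
    have := norm_integral_le_of_norm_le_const (μ := P) (f := G d) (ae_of_all _ fun ω => hb d ω)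
    simpa using this
  have hint2 : Integrable (fun ω => ∫ ω', G (Z ω) ω' ∂P) P :=
    Integrable.of_bound ((measurable_of_countable fun d => ∫ ω', G d ω' ∂P).comp
      hZ).aestronglyMeasurable C (ae_of_all _ fun ω => hbI _)
  rw [← setIntegral_univ (μ := P) (f := fun ω => G (Z ω) ω),
    ← setIntegral_univ (μ := P) (f := fun ω => ∫ ω', G (Z ω) ω' ∂P), ← hun,
    integral_iUnion hs hdis hint1.integrableOn, integral_iUnion hs hdis hint2.integrableOn]
  refine tsum_congr fun d => ?_
  have e1 : ∫ ω in Z ⁻¹' {d}, G (Z ω) ω ∂P = ∫ ω in Z ⁻¹' {d}, G d ω ∂P :=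
    setIntegral_congr_fun (hs d) fun ω hω => by
      rw [show Z ω = d from hω]
  have e2 : ∫ ω in Z ⁻¹' {d}, (∫ ω', G (Z ω) ω' ∂P) ∂P =
      ∫ ω in Z ⁻¹' {d}, (∫ ω', G d ω' ∂P) ∂P :=
    setIntegral_congr_fun (hs d) fun ω hω => by
      rw [show Z ω = d from hω]
  rw [e1, e2, setIntegral_const, ← integral_indicator (hs d)]
  have hid : IndepFun (G d) Z P := indep_of_indep_of_le_left hi (hG d).comap_le
  have hmi : Measurable (Set.indicator ({d} : Set D) (fun _ => (1 : ℝ))) :=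
    measurable_const.indicator (measurableSet_singleton d)
  have hprod := (hid.comp measurable_id hmi).integral_fun_mul_eq_mul_integral
    (hGm d).aestronglyMeasurable (hmi.comp hZ).aestronglyMeasurable
  have e3 : (fun ω => Set.indicator (Z ⁻¹' {d}) (G d) ω) = fun ω => (id ∘ G d) ω *
      (Set.indicator ({d} : Set D) (fun _ => (1 : ℝ)) ∘ Z) ω := by
    ext ω
    by_cases hω : Z ω = d
    · simp [Set.indicator, hω]
    · simp [Set.indicator, hω]
  have e4 : (Set.indicator ({d} : Set D) (fun _ => (1 : ℝ)) ∘ Z) =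
      Set.indicator (Z ⁻¹' {d}) (fun _ => (1 : ℝ)) := by
    ext ω; rfl
  rw [e3, hprod, e4, integral_indicator_const _ (hs d)]
  simp [mul_comm]

/-- If the processes `T n` converge continuously in distribution to `T∞`, then they may be
evaluated at independent random points that converge in distribution. -/
theorem tendstoInDistribution_eval {J E : Type*} [Fintype J] [PseudoMetricSpace E]
    [MeasurableSpace E] [BorelSpace E] (hm : m ≤ mΩ)
    {T : ℕ → (J → ℝ) → Ω → E} {T' : (J → ℝ) → Ω → E} (hT : ∀ n y, Measurable[m] (T n y))
    (hT' : ∀ y, Measurable[m] (T' y)) (hc : ∀ᵐ ω ∂P, Continuous fun y => T' y ω)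
    (hconv : ∀ φ : ℕ → ℕ, StrictMono φ → ∀ (y : ℕ → J → ℝ) (y₀ : J → ℝ), Tendsto y atTop (𝓝 y₀) →
      TendstoInDistribution (fun n => T (φ n) (y n)) atTop (T' y₀) (fun _ => P) P)
    {Z : ℕ → Ω → J → ℤ} (hZ : ∀ n, Measurable (Z n)) {h : ℕ → ℝ} {Y : Ω → J → ℝ}
    (hY : Measurable Y)
    (hZY : TendstoInDistribution (fun n ω j => (Z n ω j : ℝ) * h n) atTop Y (fun _ => P) P)
    (hiZ : ∀ n, Indep m (MeasurableSpace.comap (Z n) inferInstance) P)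
    (hiY : Indep m (MeasurableSpace.comap Y inferInstance) P) :
    TendstoInDistribution (fun n ω => T n (fun j => (Z n ω j : ℝ) * h n) ω) atTop
      (fun ω => T' (Y ω) ω) (fun _ => P) P := by
  have hTm : ∀ n y, Measurable (T n y) := fun n y => (hT n y).mono hm le_rfl
  have hTm' : ∀ y, Measurable (T' y) := fun y => (hT' y).mono hm le_rfl
  -- discretisations of `Y`
  let W : ℕ → Ω → J → ℤ := fun q ω j => ⌊Y ω j * (q + 1)⌋
  have hfl : ∀ q, Measurable fun (v : J → ℝ) (j : J) => ⌊v j * ((q : ℝ) + 1)⌋ := fun q =>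
    measurable_pi_lambda _ fun j => Int.measurable_floor.comp ((measurable_pi_apply j).mul_const _)
  have hW : ∀ q, Measurable (W q) := fun q => (hfl q).comp hY
  have hiW : ∀ q, Indep m (MeasurableSpace.comap (W q) inferInstance) P := fun q => by
    refine indep_of_indep_of_le_right hiY ?_
    have : W q = (fun (v : J → ℝ) (j : J) => ⌊v j * ((q : ℝ) + 1)⌋) ∘ Y := rfl
    rw [this, ← MeasurableSpace.comap_comp]
    exact MeasurableSpace.comap_mono (hfl q).comap_le
  let d : ℕ → (J → ℤ) → J → ℝ := fun q z j => (z j : ℝ) / (q + 1)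
  have hWlim : ∀ ω, Tendsto (fun q => d q (W q ω)) atTop (𝓝 (Y ω)) := fun ω => by
    refine tendsto_pi_nhds.2 fun j => ?_
    have hq : Tendsto (fun q : ℕ => (1 : ℝ) / ((q : ℝ) + 1)) atTop (𝓝 0) :=
      tendsto_one_div_add_atTop_nhds_zero_nat
    have hl : Tendsto (fun q : ℕ => Y ω j - (1 : ℝ) / ((q : ℝ) + 1)) atTop (𝓝 (Y ω j)) := by
      simpa using hq.const_sub (Y ω j)
    refine tendsto_of_tendsto_of_tendsto_of_le_of_le hl tendsto_const_nhds (fun q => ?_) fun q => ?_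
    · have h1 := (Int.lt_floor_add_one (Y ω j * ((q : ℝ) + 1))).le
      have h2 : (0 : ℝ) < (q : ℝ) + 1 := by positivity
      simp only [d, W]
      rw [sub_le_iff_le_add, ← add_div, le_div_iff₀ h2]
      exact h1
    · have h2 : (0 : ℝ) < (q : ℝ) + 1 := by positivity
      simp only [d, W]
      rw [div_le_iff₀ h2]
      exact Int.floor_le _
  have hTW : ∀ q, Measurable fun ω => T' (d q (W q ω)) ω := fun q =>
    measurable_eval_of_countable (hW q) fun z => hTm' (d q z)
  have hTWlim : ∀ᵐ ω ∂P, Tendsto (fun q => T' (d q (W q ω)) ω) atTop (𝓝 (T' (Y ω) ω)) := by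
    filter_upwards [hc] with ω hω
    exact (hω.tendsto (Y ω)).comp (hWlim ω)
  have hTn : ∀ n, Measurable fun ω => T n (fun j => (Z n ω j : ℝ) * h n) ω := fun n =>
    measurable_eval_of_countable (hZ n) fun z => hTm n (fun j => (z j : ℝ) * h n)
  have hlimm : AEMeasurable (fun ω => T' (Y ω) ω) P :=
    aemeasurable_of_tendsto_metrizable_ae atTop (fun q => (hTW q).aemeasurable) hTWlim
  refine tendstoInDistribution_iff_lipschitz.2 ⟨fun n => (hTn n).aemeasurable, hlimm,
    fun g ⟨C₀, hC₀⟩ ⟨L, hL⟩ => ?_⟩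
  obtain ⟨ω₀⟩ : Nonempty Ω := P.nonempty_of_neZero
  obtain ⟨C, hC⟩ : ∃ C, ∀ x, |g x| ≤ C := by
    refine ⟨C₀ + |g (T 0 0 ω₀)|, fun x => ?_⟩
    have := hC₀ x (T 0 0 ω₀)
    rw [Real.dist_eq] at this
    linarith [abs_sub_abs_le_abs_sub (g x) (g (T 0 0 ω₀))]
  have hgc := hL.continuous
  have hgm := hgc.measurable
  set Φ : ℕ → (J → ℝ) → ℝ := fun n y => ∫ ω, g (T n y ω) ∂P with hΦ
  set Φ' : (J → ℝ) → ℝ := fun y => ∫ ω, g (T' y ω) ∂P with hΦ'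
  have bound : ∀ A : Ω → E, |∫ ω, g (A ω) ∂P| ≤ C := fun A => by
    have := norm_integral_le_of_norm_le_const (μ := P) (f := fun ω => g (A ω)) (ae_of_all _ fun ω => hC (A ω))
    simpa using this
  have hΦc : Continuous Φ' := by
    refine continuous_of_dominated (bound := fun _ => C)
      (fun y => (hgm.comp (hTm' y)).aestronglyMeasurable) (fun y => ae_of_all _ fun ω => hC _)
      (integrable_const _) ?_
    filter_upwards [hc] with ω hω
    exact hgc.comp hω
  have step1 : ∀ n, ∫ ω, g (T n (fun j => (Z n ω j : ℝ) * h n) ω) ∂P =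
      ∫ ω, Φ n (fun j => (Z n ω j : ℝ) * h n) ∂P := fun n =>
    integral_eval_of_indep hm (hZ n) (hiZ n)
      (G := fun z ω => g (T n (fun j => (z j : ℝ) * h n) ω))
      (fun z => hgm.comp (hT n _)) (fun z ω => hC _)
  have step2 : ∫ ω, g (T' (Y ω) ω) ∂P = ∫ ω, Φ' (Y ω) ∂P := by
    have e : ∀ q, ∫ ω, g (T' (d q (W q ω)) ω) ∂P = ∫ ω, Φ' (d q (W q ω)) ∂P := fun q =>
      integral_eval_of_indep hm (hW q) (hiW q) (G := fun z ω => g (T' (d q z) ω))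
        (fun z => hgm.comp (hT' _)) (fun z ω => hC _)
    have l1 : Tendsto (fun q => ∫ ω, g (T' (d q (W q ω)) ω) ∂P) atTop
        (𝓝 (∫ ω, g (T' (Y ω) ω) ∂P)) := by
      refine tendsto_integral_of_dominated_convergence (fun _ => C)
        (fun q => (hgm.comp (hTW q)).aestronglyMeasurable) (integrable_const _)
        (fun q => ae_of_all _ fun ω => hC _) ?_
      filter_upwards [hTWlim] with ω hω
      exact (hgc.tendsto _).comp hω
    have l2 : Tendsto (fun q => ∫ ω, Φ' (d q (W q ω)) ∂P) atTop (𝓝 (∫ ω, Φ' (Y ω) ∂P)) := by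
      refine tendsto_integral_of_dominated_convergence (fun _ => C)
        (fun q => ((measurable_of_countable fun z => Φ' (d q z)).comp (hW q)).aestronglyMeasurable)
        (integrable_const _) (fun q => ae_of_all _ fun ω => bound _) (ae_of_all _ fun ω => ?_)
      exact (hΦc.tendsto _).comp (hWlim ω)
    simp only [e] at l1
    exact tendsto_nhds_unique l1 l2
  have unif : ∀ (R ε : ℝ), 0 < ε → ∀ᶠ n in atTop, ∀ y ∈ Metric.closedBall (0 : J → ℝ) R,
      |Φ n y - Φ' y| ≤ ε := by
    intro R ε hε
    by_contra hcon
    obtain ⟨φ, hφ, hφ'⟩ := extraction_of_frequently_atTop (not_eventually.1 hcon)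
    push Not at hφ'
    choose y hyR hy using hφ'
    obtain ⟨a, -, ψ, hψ, ha⟩ := (isCompact_closedBall (0 : J → ℝ) R).tendsto_subseq hyR
    have t1 := tendsto_integral_of_tendstoInDistribution
      (hconv (φ ∘ ψ) (hφ.comp hψ) (y ∘ ψ) a ha) hgc hC
    have t2 := (hΦc.tendsto a).comp ha
    have t3 := (t1.sub t2).abs
    rw [sub_self, abs_zero] at t3
    obtain ⟨k, hk⟩ := (t3.eventually (gt_mem_nhds hε)).exists
    exact absurd hk (not_lt.2 (hy (ψ k)).le)
  have step3 := tendsto_integral_of_tendstoInDistribution hZY hΦc (C := C) (fun y => bound _)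
  rw [step2]
  simp only [step1]
  -- the cutoff at level `R`
  let χ : ℝ → (J → ℝ) → ℝ := fun R y => min 1 (max 0 (‖y‖ - R))
  have hχc : ∀ R, Continuous (χ R) := fun R => by simp only [χ]; fun_prop
  have hχ0 : ∀ R y, 0 ≤ χ R y := fun R y => le_min zero_le_one (le_max_left _ _)
  have hχ1 : ∀ R y, |χ R y| ≤ 1 := fun R y => by
    rw [abs_of_nonneg (hχ0 R y)]; exact min_le_left _ _
  have hχlim : Tendsto (fun R : ℕ => ∫ ω, χ R (Y ω) ∂P) atTop (𝓝 0) := by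
    have : Tendsto (fun R : ℕ => ∫ ω, χ R (Y ω) ∂P) atTop (𝓝 (∫ _ω, (0 : ℝ) ∂P)) := by
      refine tendsto_integral_of_dominated_convergence (fun _ => 1)
        (fun R => ((hχc R).measurable.comp hY).aestronglyMeasurable) (integrable_const _)
        (fun R => ae_of_all _ fun ω => hχ1 _ _) (ae_of_all _ fun ω => ?_)
      refine tendsto_const_nhds.congr' ?_
      obtain ⟨R₀, hR₀⟩ := exists_nat_ge ‖Y ω‖
      filter_upwards [eventually_ge_atTop R₀] with R hR
      have : ‖Y ω‖ - R ≤ 0 := by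
        have : (R₀ : ℝ) ≤ R := by exact_mod_cast hR
        linarith
      simp only [χ]
      rw [max_eq_left this, min_eq_right zero_le_one]
    simpa using this
  have hdiff : Tendsto (fun n => ∫ ω, Φ n (fun j => (Z n ω j : ℝ) * h n) ∂P -
      ∫ ω, Φ' (fun j => (Z n ω j : ℝ) * h n) ∂P) atTop (𝓝 0) := by
    rw [Metric.tendsto_nhds]
    intro ε hε
    have hC0 : 0 ≤ C := (abs_nonneg _).trans (hC (T 0 0 ω₀))
    obtain ⟨R, hR⟩ := (hχlim.eventually
      (gt_mem_nhds (show (0 : ℝ) < ε / (4 * (C + 1)) by positivity))).exists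
    have hR' := (tendsto_integral_of_tendstoInDistribution hZY (hχc R) (hχ1 R)).eventually
      (gt_mem_nhds hR)
    filter_upwards [hR', unif (R + 1) (ε / 4) (by positivity)] with n hn1 hn2
    have hpt : ∀ y, |Φ n y - Φ' y| ≤ ε / 4 + 2 * C * χ R y := fun y => by
      rcases le_or_gt ‖y‖ (R + 1) with hy | hy
      · refine (hn2 y (by simpa using hy)).trans (le_add_of_nonneg_right ?_)
        exact mul_nonneg (by positivity) (hχ0 _ _)
      · have : χ R y = 1 := by
          simp only [χ]
          exact min_eq_left (le_max_of_le_right (by linarith))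
        rw [this]
        have h1 := abs_sub (Φ n y) (Φ' y)
        have h2 : |Φ n y| ≤ C := bound _
        have h3 : |Φ' y| ≤ C := bound _
        linarith
    have i1 : Integrable (fun ω => Φ n (fun j => (Z n ω j : ℝ) * h n)) P :=
      Integrable.of_bound ((measurable_of_countable fun z : J → ℤ =>
        Φ n (fun j => (z j : ℝ) * h n)).comp (hZ n)).aestronglyMeasurable C
        (ae_of_all _ fun ω => bound _)
    have i2 : Integrable (fun ω => Φ' (fun j => (Z n ω j : ℝ) * h n)) P :=
      Integrable.of_bound ((measurable_of_countable fun z : J → ℤ =>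
        Φ' (fun j => (z j : ℝ) * h n)).comp (hZ n)).aestronglyMeasurable C
        (ae_of_all _ fun ω => bound _)
    have i3 : Integrable (fun ω => χ R (fun j => (Z n ω j : ℝ) * h n)) P :=
      Integrable.of_bound ((measurable_of_countable fun z : J → ℤ =>
        χ R (fun j => (z j : ℝ) * h n)).comp (hZ n)).aestronglyMeasurable 1
        (ae_of_all _ fun ω => hχ1 _ _)
    rw [Real.dist_eq, sub_zero, ← integral_sub i1 i2]
    calc |∫ ω, (Φ n (fun j => (Z n ω j : ℝ) * h n) - Φ' (fun j => (Z n ω j : ℝ) * h n)) ∂P|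
        ≤ ∫ ω, |Φ n (fun j => (Z n ω j : ℝ) * h n) - Φ' (fun j => (Z n ω j : ℝ) * h n)| ∂P :=
          abs_integral_le_integral_abs
      _ ≤ ∫ ω, (ε / 4 + 2 * C * χ R (fun j => (Z n ω j : ℝ) * h n)) ∂P :=
          integral_mono (i1.sub i2).abs ((integrable_const _).add (i3.const_mul _)) fun ω => hpt _
      _ = ε / 4 + 2 * C * ∫ ω, χ R (fun j => (Z n ω j : ℝ) * h n) ∂P := by
          rw [integral_add (integrable_const _) (i3.const_mul _), integral_const_mul]
          simp
      _ ≤ ε / 4 + 2 * C * (ε / (4 * (C + 1))) := by gcongr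
      _ < ε := by
          have : 2 * C * (ε / (4 * (C + 1))) = ε / 2 * (C / (C + 1)) := by field_simp; ring
          rw [this]
          have h1 : C / (C + 1) ≤ 1 := by rw [div_le_one (by positivity)]; linarith
          nlinarith
  have := hdiff.add step3
  simpa using this

end Mixing

end IteratedBM
namespace IteratedBM

section Evaluation

variable {Ω : Type*} {m : MeasurableSpace Ω} [mΩ : MeasurableSpace Ω] {P : Measure Ω}
  [IsProbabilityMeasure P] {f f' F : ℝ → ℝ} {C : ℝ}

/-- The normalized signed variation, along the grid of step `δ`, of a two-sided process given by
its two halves between `0` and (the grid point next to) `y`. -/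
noncomputable def signedWalk (κ : ℕ) (f : ℝ → ℝ) (x : Bool → ℝ≥0 → Ω → ℝ) (δ : ℝ≥0) (y : ℝ)
    (ω : Ω) : ℝ :=
  ∑ σ, walkSum κ f (x σ) δ ⌊(cond σ y (-y)).toNNReal / (2 * δ)⌋₊ ω

/-- The limit of `signedWalk`. -/
noncomputable def signedLimit (κ : ℕ) (F : ℝ → ℝ) (x I : Bool → ℝ≥0 → Ω → ℝ) (y : ℝ) (ω : Ω) : ℝ :=
  ∑ σ, walkLimit κ F (x σ) (I σ) (cond σ y (-y)).toNNReal ω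

lemma tendsto_floor_toNNReal_div {δ : ℕ → ℝ≥0} (hδ : ∀ n, 0 < δ n)
    (hδ0 : Tendsto δ atTop (𝓝 0)) {z : ℕ → ℝ≥0} {z₀ : ℝ≥0} (hz : Tendsto z atTop (𝓝 z₀)) :
    Tendsto (fun n => ((2 * ⌊z n / (2 * δ n)⌋₊ : ℕ) : ℝ) * δ n) atTop (𝓝 z₀) := by
  have hδ0' : Tendsto (fun n => (δ n : ℝ)) atTop (𝓝 0) := by
    have := NNReal.tendsto_coe.2 hδ0
    rwa [NNReal.coe_zero] at this
  have hz' := NNReal.tendsto_coe.2 hz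
  have hl : Tendsto (fun n => (z n : ℝ) - 2 * δ n) atTop (𝓝 z₀) := by
    simpa using hz'.sub (hδ0'.const_mul 2)
  refine tendsto_of_tendsto_of_tendsto_of_le_of_le hl hz' (fun n => ?_) fun n => ?_
  · have h0 : 0 < 2 * δ n := mul_pos two_pos (hδ n)
    have h1 : z n / (2 * δ n) ≤ (⌊z n / (2 * δ n)⌋₊ : ℝ≥0) + 1 := (Nat.lt_floor_add_one _).le
    rw [div_le_iff₀ h0, add_mul, one_mul] at h1
    have h2 : (z n : ℝ) ≤ (⌊z n / (2 * δ n)⌋₊ : ℝ) * (2 * δ n) + 2 * δ n := by exact_mod_cast h1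
    push_cast
    linarith
  · have h0 : 0 < 2 * δ n := mul_pos two_pos (hδ n)
    have h1 : (⌊z n / (2 * δ n)⌋₊ : ℝ≥0) ≤ z n / (2 * δ n) := Nat.floor_le zero_le
    rw [le_div_iff₀ h0] at h1
    have h2 : (⌊z n / (2 * δ n)⌋₊ : ℝ) * (2 * δ n) ≤ z n := by exact_mod_cast h1
    push_cast
    linarith

lemma floor_intCast_mul_div {δ : ℝ≥0} (hδ : 0 < δ) (l : ℤ) :
    ⌊(((2 * l : ℤ) : ℝ) * δ).toNNReal / (2 * δ)⌋₊ = l.toNat := by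
  rcases le_total 0 l with hl | hl
  · obtain ⟨k, rfl⟩ := Int.eq_ofNat_of_zero_le hl
    have : ((((2 * (k : ℤ) : ℤ) : ℝ) * δ).toNNReal) = (k : ℝ≥0) * (2 * δ) := by
      apply NNReal.coe_injective
      rw [Real.coe_toNNReal _ (by positivity)]
      push_cast
      ring
    rw [this, mul_div_cancel_right₀ _ (by positivity)]
    simp
  · have : (((2 * l : ℤ) : ℝ) * δ).toNNReal = 0 := by
      rw [Real.toNNReal_eq_zero]
      refine mul_nonpos_of_nonpos_of_nonneg ?_ δ.coe_nonneg
      exact_mod_cast (by omega : 2 * l ≤ 0)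
    rw [this, zero_div, Nat.floor_zero, Int.toNat_of_nonpos hl]

/-- Joint convergence of `X` and of its signed variation up to convergent levels. -/
theorem tendstoInDistribution_signedWalk {U : Bool × Bool → ℝ≥0 → Ω → ℝ}
    {I : Bool → ℝ≥0 → Ω → ℝ} (h : IsBrownianFamily U P) (hf : IsWeight f f' F C) (κ : ℕ)
    (hI : ∀ σ, IsItoLimit P f (U (true, σ)) (U (false, σ)) (I σ)) {δ : ℕ → ℝ≥0}
    (hδ : ∀ n, 0 < δ n) (hδ0 : Tendsto δ atTop (𝓝 0)) {J : Type*} [Fintype J]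
    (s : J → Bool) (p : J → ℝ≥0) (y : ℕ → J → ℝ) (y₀ : J → ℝ) (hy : Tendsto y atTop (𝓝 y₀)) :
    TendstoInDistribution (fun n ω j => (U (true, s j) (p j) ω,
        signedWalk κ f (fun σ => U (true, σ)) (δ n) (y n j) ω)) atTop
      (fun ω j => (U (true, s j) (p j) ω, signedLimit κ F (fun σ => U (true, σ)) I (y₀ j) ω))
      (fun _ => P) P := by
  have hz : ∀ (σ : Bool) j, Tendsto (fun n => (cond σ (y n j) (-(y n j))).toNNReal) atTop
      (𝓝 (cond σ (y₀ j) (-(y₀ j))).toNNReal) := fun σ j => by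
    have hj := tendsto_pi_nhds.1 hy j
    refine (continuous_real_toNNReal.tendsto _).comp ?_
    cases σ
    · exact hj.neg
    · exact hj
  have key := tendstoInDistribution_walkSum h hf κ hI hδ hδ0 s p (J₂ := Bool × J) (fun q => q.1)
    (fun q => (cond q.1 (y₀ q.2) (-(y₀ q.2))).toNNReal)
    (fun n q => ⌊(cond q.1 (y n q.2) (-(y n q.2))).toNNReal / (2 * δ n)⌋₊)
    (fun q => tendsto_floor_toNNReal_div hδ hδ0 (hz q.1 q.2))
  have hg : Continuous fun (v : J ⊕ (Bool × J) → ℝ) (j : J) =>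
      (v (.inl j), ∑ σ, v (.inr (σ, j))) := by fun_prop
  exact key.continuous_comp hg

omit mΩ in
/-- The signed variation of an iterated process, as a function of the independent position of the
skeleton. -/
lemma signedVariation_eq_signedWalk {X B : ℝ → Ω → ℝ} {Y : ℝ≥0 → Ω → ℝ} {ω : Ω}
    (hy : IsExcursive fun t => Y t ω) (κ : ℕ) (f : ℝ → ℝ) (n : ℕ) (t : ℝ≥0) :
    (2 : ℝ) ^ (((κ : ℝ) - 1) * (n : ℝ) / 4) * signedVariation X Y κ f n t ω =
      signedWalk κ f (fun σ => halfLines X B (true, σ)) (mesh n).toNNReal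
        ((skeletonPos Y n (2 * (⌊((2 : ℝ) ^ n * (t : ℝ) - 1) / 2⌋ + 1).toNat) ω : ℝ) * mesh n) ω := by
  obtain ⟨⟨l, hl⟩, hS⟩ := signedVariation_eq X hy κ f n t
  have hm := mesh_pos n
  have hm' : ((mesh n).toNNReal : ℝ) = mesh n := Real.coe_toNNReal _ hm.le
  have hmp : 0 < (mesh n).toNNReal := Real.toNNReal_pos.2 hm
  have hscale : √(mesh n) / √(mesh n) ^ κ = (2 : ℝ) ^ (((κ : ℝ) - 1) * (n : ℝ) / 4) := by
    have : √(mesh n) = (2 : ℝ) ^ (-(n : ℝ) / 4) := by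
      rw [Real.sqrt_eq_rpow, mesh, ← Real.rpow_mul zero_le_two]
      congr 1; ring
    rw [this, ← Real.rpow_natCast, ← Real.rpow_mul zero_le_two, ← Real.rpow_sub two_pos]
    congr 1; ring
  rw [hS, hl, Int.mul_ediv_cancel_left _ two_ne_zero, signedWalk, Fintype.sum_bool]
  have e1 := floor_intCast_mul_div hmp l
  have e2 := floor_intCast_mul_div hmp (-l)
  rw [hm'] at e1 e2
  have e3 : (((2 * -l : ℤ) : ℝ) * mesh n) = -(((2 * l : ℤ) : ℝ) * mesh n) := by push_cast; ring
  rw [e3] at e2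
  simp only [cond_true, cond_false, e1, e2, walkSum, hm', hscale, mul_add, halfLines, NNReal.coe_mul,
    NNReal.coe_natCast]

omit mΩ in
lemma measurable_signedWalk {x : Bool → ℝ≥0 → Ω → ℝ} (h : ∀ σ t, Measurable[m] (x σ t))
    (hf : Continuous f) (κ : ℕ) (δ : ℝ≥0) (y : ℝ) : Measurable[m] (signedWalk κ f x δ y) :=
  Finset.measurable_sum _ fun b _ => measurable_walkSum (h b) hf κ _ _

omit mΩ in
lemma measurable_signedLimit {x I : Bool → ℝ≥0 → Ω → ℝ} (h : ∀ σ t, Measurable[m] (x σ t))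
    (hI : ∀ σ t, Measurable[m] (I σ t)) (hF : Continuous F) (κ : ℕ) (y : ℝ) :
    Measurable[m] (signedLimit κ F x I y) :=
  Finset.measurable_sum _ fun σ _ => (((hF.measurable.comp (h _ _)).sub
    (hF.measurable.comp (h _ _))).const_mul _).add ((hI _ _).const_mul _)

lemma tendsto_skeleton_time (t : ℝ≥0) :
    Tendsto (fun n => ((2 * (⌊((2 : ℝ) ^ n * (t : ℝ) - 1) / 2⌋ + 1).toNat : ℕ) : ℝ) *
      (mesh n * mesh n)) atTop (𝓝 t) := by
  have hp : Tendsto (fun n : ℕ => ((2 : ℝ) ^ n)⁻¹) atTop (𝓝 0) := by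
    simpa using tendsto_pow_atTop_nhds_zero_of_lt_one (r := (2 : ℝ)⁻¹) (by norm_num) (by norm_num)
  have hl : Tendsto (fun n : ℕ => (t : ℝ) - ((2 : ℝ) ^ n)⁻¹) atTop (𝓝 t) := by
    simpa using hp.const_sub (t : ℝ)
  have hu : Tendsto (fun n : ℕ => (t : ℝ) + ((2 : ℝ) ^ n)⁻¹) atTop (𝓝 t) := by
    simpa using hp.const_add (t : ℝ)
  have key : ∀ n : ℕ, (t : ℝ) * 2 ^ n - 1 ≤
      ((2 * (⌊((2 : ℝ) ^ n * (t : ℝ) - 1) / 2⌋ + 1).toNat : ℕ) : ℝ) ∧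
      ((2 * (⌊((2 : ℝ) ^ n * (t : ℝ) - 1) / 2⌋ + 1).toNat : ℕ) : ℝ) ≤ (t : ℝ) * 2 ^ n + 1 := fun n => by
    set a : ℝ := ((2 : ℝ) ^ n * (t : ℝ) - 1) / 2 with ha
    have h0 : -1 ≤ ⌊a⌋ := by
      refine Int.le_floor.2 ?_
      have : 0 ≤ (2 : ℝ) ^ n * (t : ℝ) := by positivity
      push_cast
      linarith
    have h1 : (((⌊a⌋ + 1).toNat : ℕ) : ℝ) = (⌊a⌋ : ℝ) + 1 := by
      have : (((⌊a⌋ + 1).toNat : ℤ) : ℝ) = ((⌊a⌋ + 1 : ℤ) : ℝ) := by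
        rw [Int.toNat_of_nonneg (by omega)]
      push_cast at this
      exact_mod_cast this
    have h2 := Int.lt_floor_add_one a
    have h3 := Int.floor_le a
    push_cast
    rw [h1]
    constructor <;> linarith
  refine tendsto_of_tendsto_of_tendsto_of_le_of_le hl hu (fun n => ?_) fun n => ?_
  · have h2 : (0 : ℝ) < ((2 : ℝ) ^ n)⁻¹ := by positivity
    have := mul_le_mul_of_nonneg_right (key n).1 h2.le
    rw [sub_mul, mul_assoc, mul_inv_cancel₀ (by positivity), mul_one, one_mul] at this
    simp only [mesh_mul_self]
    exact this
  · have h2 : (0 : ℝ) < ((2 : ℝ) ^ n)⁻¹ := by positivity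
    have := mul_le_mul_of_nonneg_right (key n).2 h2.le
    rw [add_mul, mul_assoc, mul_inv_cancel₀ (by positivity), mul_one, one_mul] at this
    simp only [mesh_mul_self]
    exact this

/-- Convergence of the normalized signed variation, for a Brownian motion `Y` all of whose paths
are continuous and unbounded. -/
theorem tendstoInDistribution_signedVariation {X B : ℝ → Ω → ℝ} {Y : ℝ≥0 → Ω → ℝ}
    (hX : IsTwoSidedBrownian X P) (hB : IsTwoSidedBrownian B P)
    (hXB : IndepFun (fun ω t => X t ω) (fun ω t => B t ω) P) (hYm : ∀ t, Measurable (Y t))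
    (hex : ∀ ω, IsExcursive fun t => Y t ω) (hY : IsPreBrownianReal Y P)
    (hm : m ≤ mΩ) (hXm : ∀ u, Measurable[m] (X u)) (hBm : ∀ u, Measurable[m] (B u))
    (hind : Indep m (MeasurableSpace.comap (fun ω t => Y t ω) inferInstance) P)
    (hf : IsWeight f f' F C) (κ : ℕ) {I : Bool → ℝ≥0 → Ω → ℝ}
    (hI : ∀ σ, IsItoLimit P f (halfLines X B (true, σ)) (halfLines X B (false, σ)) (I σ))
    {J : Type*} [Fintype J] (x : J → ℝ) (t : J → ℝ≥0) :
    TendstoInDistribution (fun (n : ℕ) ω j => (X (x j) ω,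
        (2 : ℝ) ^ (((κ : ℝ) - 1) * (n : ℝ) / 4) * signedVariation X Y κ f n (t j) ω)) atTop
      (fun ω j => (X (x j) ω,
        signedLimit κ F (fun σ => halfLines X B (true, σ)) I (Y (t j) ω) ω)) (fun _ => P) P := by
  have hHX : ∀ σ u, Measurable[m] (halfLines X B (true, σ) u) := fun σ u => hXm _
  have hHB : ∀ σ u, Measurable[m] (halfLines X B (false, σ) u) := fun σ u => hBm _
  let k : ℕ → J → ℕ := fun n j => 2 * (⌊((2 : ℝ) ^ n * (t j : ℝ) - 1) / 2⌋ + 1).toNat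
  let Z : ℕ → Ω → J → ℤ := fun n ω j => skeletonPos Y n (k n j) ω
  have hZ : ∀ n, Measurable (Z n) := fun n =>
    measurable_pi_lambda _ fun j => measurable_skeletonPos hYm hex n _
  have hYt : Measurable fun ω j => Y (t j) ω := measurable_pi_lambda _ fun j => hYm _
  have hpast : ∀ {D : Type _} [MeasurableSpace D] (V : Ω → D),
      Measurable[MeasurableSpace.comap (fun ω t => Y t ω) inferInstance] V →
      Indep m (MeasurableSpace.comap V inferInstance) P := fun V hV =>
    indep_of_indep_of_le_right hind hV.comap_le
  have hYc : ∀ u, Measurable[MeasurableSpace.comap (fun ω t => Y t ω) inferInstance] (Y u) := fun u =>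
    (measurable_pi_apply u).comp (comap_measurable fun ω t => Y t ω)
  have key := tendstoInDistribution_eval (m := m) (P := P) hm
    (T := fun n (y : J → ℝ) ω j => (X (x j) ω, signedWalk κ f (fun σ => halfLines X B (true, σ))
      (mesh n).toNNReal (y j) ω))
    (T' := fun y ω j => (X (x j) ω, signedLimit κ F (fun σ => halfLines X B (true, σ)) I (y j) ω))
    (fun n y => @measurable_pi_lambda _ _ _ m _ _ fun j =>
      (hXm _).prodMk (measurable_signedWalk hHX hf.cont κ _ _))
    (fun y => @measurable_pi_lambda _ _ _ m _ _ fun j =>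
      (hXm _).prodMk (measurable_signedLimit hHX
        (fun σ u => (hI σ).measurable_of m (hHX σ) (hHB σ) u) hf.contF κ _)) ?_ ?_ hZ
    (h := mesh) hYt (tendstoInDistribution_skeleton hYm hex hY t k fun j => tendsto_skeleton_time (t j))
    (fun n => hpast _ ?_) (hpast _ ?_)
  · refine key.congr (fun n => ae_of_all _ fun ω => ?_) EventuallyEq.rfl
    ext j : 1
    simp only [Z, k, signedVariation_eq_signedWalk (B := B) (hex ω)]
  · filter_upwards [hX.continuous, (hI true).cont, (hI false).cont] with ω hω h1 h2
    refine continuous_pi fun j => continuous_const.prodMk (continuous_finsetSum _ fun σ _ => ?_)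
    have hz : Continuous fun y : J → ℝ => (cond σ (y j) (-(y j))).toNNReal := by
      cases σ
      · exact continuous_real_toNNReal.comp (continuous_apply j).neg
      · exact continuous_real_toNNReal.comp (continuous_apply j)
    have hx : Continuous fun u => halfLines X B (true, σ) u ω := by
      cases σ
      · exact hω.comp NNReal.continuous_coe.neg
      · exact hω.comp NNReal.continuous_coe
    have hIc : Continuous fun u => I σ u ω := by
      cases σ
      · exact h2
      · exact h1
    have : Continuous fun u => walkLimit κ F (halfLines X B (true, σ)) (I σ) u ω :=
      (continuous_const.mul ((hf.contF.comp hx).sub continuous_const)).add (continuous_const.mul hIc)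
    exact this.comp hz
  · intro φ hφ y y₀ hy
    have hδ0 : Tendsto (fun n => (mesh (φ n)).toNNReal) atTop (𝓝 0) := by
      have := (continuous_real_toNNReal.tendsto 0).comp (tendsto_mesh.comp hφ.tendsto_atTop)
      rwa [Real.toNNReal_zero] at this
    have := tendstoInDistribution_signedWalk (isBrownianFamily_halfLines hX hB hXB) hf κ hI
      (fun n => Real.toNNReal_pos.2 (mesh_pos (φ n))) hδ0 (fun j => decide (0 ≤ x j))
      (fun j => Real.nnabs (x j)) y y₀ hy
    have e : ∀ ω j, halfLines X B (true, decide (0 ≤ x j)) (Real.nnabs (x j)) ω = X (x j) ω := fun ω j => by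
      rcases le_or_gt 0 (x j) with hx | hx
      · simp [halfLines, hx]
      · simp [halfLines, not_le.2 hx, abs_of_neg hx]
    simpa only [e] using this
  · exact @measurable_pi_lambda _ _ _ (MeasurableSpace.comap (fun ω t => Y t ω) inferInstance) _ _
      fun j => @measurable_skeletonPos _ (MeasurableSpace.comap (fun ω t => Y t ω) inferInstance) _
        hYc hex n _
  · exact @measurable_pi_lambda _ _ _ (MeasurableSpace.comap (fun ω t => Y t ω) inferInstance) _ _
      fun j => hYc _

end Evaluation

end IteratedBM
namespace IteratedBM

section Version

variable {Ω : Type*} [MeasurableSpace Ω] {P : Measure Ω}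

lemma gaussianReal_abs_le_le {v : ℝ≥0} (hv : v ≠ 0) (R : ℝ) :
    gaussianReal 0 v {x | |x| ≤ R} ≤ ENNReal.ofReal (2 * R / √v) := by
  have hv' : (0 : ℝ) < v := by exact_mod_cast pos_iff_ne_zero.2 hv
  have hs : {x : ℝ | |x| ≤ R} = Set.Icc (-R) R := by ext x; simp [abs_le]
  have hd : ∀ x, gaussianPDF 0 v x ≤ ENNReal.ofReal (√v)⁻¹ := fun x => by
    refine ENNReal.ofReal_le_ofReal ?_
    unfold gaussianPDFReal
    have h1 : (√(2 * Real.pi * v))⁻¹ ≤ (√v)⁻¹ := by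
      refine inv_anti₀ (Real.sqrt_pos.2 hv') (Real.sqrt_le_sqrt ?_)
      nlinarith [Real.pi_gt_three]
    have h2 : Real.exp (-(x - 0) ^ 2 / (2 * v)) ≤ 1 := by
      rw [Real.exp_le_one_iff, neg_div]
      exact neg_nonpos.2 (by positivity)
    calc _ ≤ (√(2 * Real.pi * v))⁻¹ * 1 := mul_le_mul_of_nonneg_left h2 (by positivity)
      _ ≤ _ := by rwa [mul_one]
  rw [hs, gaussianReal_apply _ hv]
  refine (lintegral_mono hd).trans (le_of_eq ?_)
  rw [lintegral_const, Measure.restrict_apply MeasurableSet.univ, Set.univ_inter, Real.volume_Icc,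
    ← ENNReal.ofReal_mul (by positivity)]
  congr 1
  ring

lemma ae_unbounded_of_preBrownian {Y : ℝ≥0 → Ω → ℝ} (hY : IsPreBrownianReal Y P) :
    ∀ᵐ ω ∂P, ∀ R : ℝ, ∃ s, R < |Y s ω| := by
  have h1 : ∀ R : ℕ, ∀ᵐ ω ∂P, ∃ s, (R : ℝ) < |Y s ω| := fun R => by
    have hle : ∀ k : ℕ, P {ω | ¬ ∃ s, (R : ℝ) < |Y s ω|} ≤ ENNReal.ofReal (2 * R / √(k + 1 : ℕ)) :=
      fun k => by
        have hl := hY.hasLaw_eval (k + 1 : ℕ)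
        have := gaussianReal_abs_le_le (v := ((k + 1 : ℕ) : ℝ≥0)) (by positivity) R
        rw [← hl.map_eq, Measure.map_apply_of_aemeasurable hl.aemeasurable
          (measurableSet_le (by fun_prop) (by fun_prop))] at this
        refine (measure_mono fun ω hω => ?_).trans this
        simp only [not_exists, not_lt, Set.mem_ofPred_eq] at hω
        exact hω _
    have hlim : Tendsto (fun k : ℕ => ENNReal.ofReal (2 * R / √(k + 1 : ℕ))) atTop (𝓝 0) := by
      rw [← ENNReal.ofReal_zero]
      exact ENNReal.tendsto_ofReal (tendsto_const_nhds.div_atTop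
        (Real.tendsto_sqrt_atTop.comp (tendsto_natCast_atTop_atTop.comp (tendsto_add_atTop_nat 1))))
    exact le_antisymm (ge_of_tendsto' hlim hle) zero_le
  filter_upwards [ae_all_iff.2 h1] with ω hω R
  obtain ⟨k, hk⟩ := exists_nat_ge R
  obtain ⟨s, hs⟩ := hω k
  exact ⟨s, hk.trans_lt hs⟩

/-- A Brownian motion has an indistinguishable version all of whose paths are continuous, start at
`0` and are unbounded. -/
lemma exists_isExcursive_version {Y : ℝ≥0 → Ω → ℝ} (hYm : ∀ t, Measurable (Y t))
    (hY : IsBrownianReal Y P) :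
    ∃ Y' : ℝ≥0 → Ω → ℝ, (∀ t, Measurable (Y' t)) ∧ (∀ ω, IsExcursive fun t => Y' t ω) ∧
      ∀ᵐ ω ∂P, ∀ t, Y' t ω = Y t ω := by
  have hae : ∀ᵐ ω ∂P, IsExcursive fun t => Y t ω := by
    filter_upwards [hY.cont, hY.toIsPreBrownianReal.eval_zero_ae_eq_zero,
      ae_unbounded_of_preBrownian hY.toIsPreBrownianReal] with ω h1 h2 h3
    exact ⟨h1, h2, h3⟩
  set A := toMeasurable P {ω | ¬ IsExcursive fun t => Y t ω} with hA
  have hAm : MeasurableSet A := measurableSet_toMeasurable _ _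
  have hA0 : P A = 0 := (measure_toMeasurable _).trans hae
  classical
  refine ⟨fun t => A.piecewise (fun _ => (t : ℝ)) (Y t),
    fun t => Measurable.piecewise hAm measurable_const (hYm t), fun ω => ?_, ?_⟩
  · by_cases hω : ω ∈ A
    · simp only [Set.piecewise_eq_of_mem _ _ _ hω]
      refine ⟨NNReal.continuous_coe, rfl, fun R => ⟨Real.nnabs R + 1, ?_⟩⟩
      have := le_abs_self R
      push_cast
      rw [abs_of_nonneg (by positivity)]
      linarith
    · simp only [Set.piecewise_eq_of_notMem _ _ _ hω]
      by_contra hcon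
      exact hω (subset_toMeasurable P _ hcon)
  · filter_upwards [measure_eq_zero_iff_ae_notMem.1 hA0] with ω hω t
    exact Set.piecewise_eq_of_notMem _ _ _ hω

omit [MeasurableSpace Ω] in
lemma skeletonTime_congr {Y Y' : ℝ≥0 → Ω → ℝ} {ω : Ω} (h : ∀ t, Y' t ω = Y t ω) (n k : ℕ) :
    skeletonTime Y' n k ω = skeletonTime Y n k ω := by
  induction k with
  | zero => rfl
  | succ k ih => simp only [skeletonTime, ih, h]

omit [MeasurableSpace Ω] in
lemma signedVariation_congr {X : ℝ → Ω → ℝ} {Y Y' : ℝ≥0 → Ω → ℝ} {ω : Ω}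
    (h : ∀ t, Y' t ω = Y t ω) (κ : ℕ) (f : ℝ → ℝ) (n : ℕ) (t : ℝ≥0) :
    signedVariation X Y' κ f n t ω = signedVariation X Y κ f n t ω := by
  simp only [signedVariation, ibm, skeletonTime_congr h, h]

/-- Regrouping three mutually independent random variables. -/
lemma indepFun_prodMk_of_indepFun [IsProbabilityMeasure P] {α β γ : Type*} [MeasurableSpace α]
    [MeasurableSpace β] [MeasurableSpace γ] {X : Ω → α} {Y : Ω → β} {B : Ω → γ}
    (hX : Measurable X) (hY : Measurable Y) (hB : Measurable B)
    (hXYB : IndepFun X (fun ω => (Y ω, B ω)) P) (hYB : IndepFun Y B P) :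
    IndepFun (fun ω => (X ω, B ω)) Y P := by
  refine IndepFun.symm ((indepFun_iff_map_prod_eq_prod_map_map hY.aemeasurable
    (hX.prodMk hB).aemeasurable).2 ?_)
  have := Measure.isProbabilityMeasure_map (μ := P) (hY.prodMk (hX.prodMk hB)).aemeasurable
  refine Measure.ext_prod₃ fun {s t u} hs ht hu => ?_
  have hXB : IndepFun X B P := hXYB.comp measurable_id measurable_snd
  rw [Measure.map_apply (hY.prodMk (hX.prodMk hB)) (hs.prod (ht.prod hu)), Measure.prod_prod,
    Measure.map_apply hY hs, Measure.map_apply (hX.prodMk hB) (ht.prod hu)]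
  have e1 : (fun ω => (Y ω, X ω, B ω)) ⁻¹' (s ×ˢ t ×ˢ u) =
      X ⁻¹' t ∩ (fun ω => (Y ω, B ω)) ⁻¹' (s ×ˢ u) := by
    ext ω; simp only [Set.mem_preimage, Set.mem_prod, Set.mem_inter_iff]; tauto
  have e2 : (fun ω => (Y ω, B ω)) ⁻¹' (s ×ˢ u) = Y ⁻¹' s ∩ B ⁻¹' u := rfl
  have e3 : (fun ω => (X ω, B ω)) ⁻¹' (t ×ˢ u) = X ⁻¹' t ∩ B ⁻¹' u := rfl
  rw [e1, hXYB.measure_inter_preimage_eq_mul _ _ ht (hs.prod hu), e2, e3,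
    hYB.measure_inter_preimage_eq_mul _ _ hs hu, hXB.measure_inter_preimage_eq_mul _ _ ht hu]
  ring

end Version

section Main

variable {Ω : Type*} [MeasurableSpace Ω] {P : Measure Ω} [IsProbabilityMeasure P]
  {f f' F : ℝ → ℝ} {C : ℝ} {X B : ℝ → Ω → ℝ} {Y : ℝ≥0 → Ω → ℝ}

omit [MeasurableSpace Ω] in
lemma signedLimit_halfLines (κ : ℕ) (F : ℝ → ℝ) (I : Bool → ℝ≥0 → Ω → ℝ) (y : ℝ) (ω : Ω) :
    signedLimit κ F (fun σ => halfLines X B (true, σ)) I y ω =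
      linCoeff κ * (F (X y ω) - F (X 0 ω)) +
        √(residualVar κ) * (I true y.toNNReal ω + I false (-y).toNNReal ω) := by
  simp only [signedLimit, Fintype.sum_bool, walkLimit, halfLines, cond_true, cond_false]
  rcases le_total 0 y with hy | hy
  · rw [Real.coe_toNNReal _ hy, Real.toNNReal_of_nonpos (neg_nonpos.2 hy)]
    simp
    ring
  · rw [Real.coe_toNNReal _ (neg_nonneg.2 hy), Real.toNNReal_of_nonpos hy]
    simp
    ring

lemma exists_isItoLimit_halfLines (hX : IsTwoSidedBrownian X P) (hB : IsTwoSidedBrownian B P)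
    (hXB : IndepFun (fun ω t => X t ω) (fun ω t => B t ω) P) (hf : IsWeight f f' F C) :
    ∃ I : Bool → ℝ≥0 → Ω → ℝ,
      ∀ σ, IsItoLimit P f (halfLines X B (true, σ)) (halfLines X B (false, σ)) (I σ) := by
  have h := isBrownianFamily_halfLines hX hB hXB
  have : ∀ σ, ∃ I, IsItoLimit P f (halfLines X B (true, σ)) (halfLines X B (false, σ)) I := fun σ => by
    refine exists_isItoLimit h hf (i := (false, σ)) (j := (true, σ)) (by simp) ?_
    filter_upwards [hB.continuous] with ω hω
    cases σ
    · exact hω.comp NNReal.continuous_coe.neg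
    · exact hω.comp NNReal.continuous_coe
  choose I hI using this
  exact ⟨I, hI⟩

/-- Convergence of the signed variation for all powers at once. -/
theorem tendstoFDD_signedVariation (hX : IsTwoSidedBrownian X P) (hB : IsTwoSidedBrownian B P)
    (hYm : ∀ t, Measurable (Y t)) (hY : IsBrownianReal Y P)
    (hXYB : IndepFun (fun ω t => X t ω) (fun ω => ((fun t => Y t ω), (fun t => B t ω))) P)
    (hYB : IndepFun (fun ω t => Y t ω) (fun ω t => B t ω) P) (hf : IsWeight f f' F C) (κ : ℕ)
    {I J : ℝ → Ω → ℝ} (hI : IsItoIntegral P (fun z ω => f (X z ω)) B I)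
    (hJ : IsStratonovichIntegral P (fun z ω => f (X z ω)) X J) :
    TendstoFDD P (fun (n : ℕ) (p : ℝ × Set.Icc (0 : ℝ≥0) 1) ω => (X p.1 ω,
        (2 : ℝ) ^ (((κ : ℝ) - 1) * (n : ℝ) / 4) * signedVariation X Y κ f n p.2 ω))
      (fun p ω => (X p.1 ω, linCoeff κ * J (Y p.2 ω) ω + √(residualVar κ) * I (Y p.2 ω) ω)) := by
  intro S
  have hXB : IndepFun (fun ω t => X t ω) (fun ω t => B t ω) P :=
    hXYB.comp measurable_id measurable_snd
  have hXp : Measurable fun ω t => X t ω := measurable_pi_lambda _ hX.measurable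
  have hBp : Measurable fun ω t => B t ω := measurable_pi_lambda _ hB.measurable
  have hYp : Measurable fun ω t => Y t ω := measurable_pi_lambda _ hYm
  obtain ⟨I', hI'⟩ := exists_isItoLimit_halfLines hX hB hXB hf
  obtain ⟨Y', hYm', hex, hYY⟩ := exists_isExcursive_version hYm hY
  have hpath : (fun ω t => Y t ω) =ᵐ[P] fun ω t => Y' t ω := hYY.mono fun ω hω =>
    funext fun t => (hω t).symm
  have hY' : IsPreBrownianReal Y' P := hY.toIsPreBrownianReal.congr fun t =>
    hYY.mono fun ω hω => (hω t).symm
  have hind := (indepFun_prodMk_of_indepFun hXp hYp hBp hXYB hYB).congr EventuallyEq.rfl hpath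
  have hc := comap_measurable (m := inferInstance) fun ω => ((fun t => X t ω), (fun t => B t ω))
  have key := tendstoInDistribution_signedVariation hX hB hXB hYm' hex hY'
    (hXp.prodMk hBp).comap_le
    (fun u => ((measurable_pi_apply u).comp measurable_fst).comp hc)
    (fun u => ((measurable_pi_apply u).comp measurable_snd).comp hc) hind hf κ hI'
    (fun j : S => j.1.1) (fun j : S => (j.1.2 : ℝ≥0))
  refine key.congr (fun n => ?_) ?_
  · filter_upwards [hYY] with ω hω
    ext j : 1
    simp only [signedVariation_congr hω]
  · filter_upwards [hYY, hI.ae_eq (isItoIntegral hI'), hJ.ae_eq (isStratonovichIntegral hX hf)]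
      with ω hω hIω hJω
    ext j : 1
    simp only [signedLimit_halfLines, hω, hIω, hJω]

end Main

end IteratedBM
theorem theorem1p4 {Ω : Type*} [MeasurableSpace Ω] (P : Measure Ω) [IsProbabilityMeasure P]
    (X B : ℝ → Ω → ℝ) (Y : ℝ≥0 → Ω → ℝ)
    (hX : IteratedBM.IsTwoSidedBrownian X P)
    (hB : IteratedBM.IsTwoSidedBrownian B P)
    (hYm : ∀ t, Measurable (Y t)) (hY : IsBrownianReal Y P)
    -- the three processes are mutually independent
    (hXYB : IndepFun (fun ω t => X t ω) (fun ω => ((fun t => Y t ω), (fun t => B t ω))) P)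
    (hYB : IndepFun (fun ω t => Y t ω) (fun ω t => B t ω) P)
    (f : ℝ → ℝ) (hf : ContDiff ℝ 2 f)
    (hf' : ∃ C, ∀ x, |deriv f x| ≤ C) (hf'' : ∃ C, ∀ x, |deriv (deriv f) x| ≤ C)
    (κ : ℕ) (hκ : 2 ≤ κ) :
    -- the two integral processes exist
    (∃ I, IteratedBM.IsItoIntegral P (fun z ω => f (X z ω)) B I) ∧
    (∃ J, IteratedBM.IsStratonovichIntegral P (fun z ω => f (X z ω)) X J) ∧
    -- and the convergence holds for all their continuous versions
    ∀ I J : ℝ → Ω → ℝ,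
      IteratedBM.IsItoIntegral P (fun z ω => f (X z ω)) B I →
      IteratedBM.IsStratonovichIntegral P (fun z ω => f (X z ω)) X J →
      (Even κ →
        IteratedBM.TendstoFDD P
          (fun (n : ℕ) (p : ℝ × Set.Icc (0 : ℝ≥0) 1) ω =>
            (X p.1 ω, (2 : ℝ) ^ (((κ : ℝ) - 1) * (n : ℝ) / 4) *
              IteratedBM.signedVariation X Y κ f n p.2 ω))
          (fun p ω =>
            (X p.1 ω,
              √(IteratedBM.gaussMoment (2 * κ) - IteratedBM.gaussMoment κ ^ 2) *
                I (Y p.2 ω) ω))) ∧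
      (Odd κ →
        IteratedBM.TendstoFDD P
          (fun (n : ℕ) (p : ℝ × Set.Icc (0 : ℝ≥0) 1) ω =>
            (X p.1 ω, (2 : ℝ) ^ (((κ : ℝ) - 1) * (n : ℝ) / 4) *
              IteratedBM.signedVariation X Y κ f n p.2 ω))
          (fun p ω =>
            (X p.1 ω,
              IteratedBM.gaussMoment (κ + 1) * J (Y p.2 ω) ω +
                √(IteratedBM.gaussMoment (2 * κ) - IteratedBM.gaussMoment (κ + 1) ^ 2) *
                  I (Y p.2 ω) ω))) := by
  obtain ⟨C, hw⟩ := IteratedBM.IsWeight.exists_of_contDiff hf hf' hf''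
  have hXB : IndepFun (fun ω t => X t ω) (fun ω t => B t ω) P :=
    hXYB.comp measurable_id measurable_snd
  obtain ⟨I₀, hI₀⟩ := IteratedBM.exists_isItoLimit_halfLines hX hB hXB hw
  refine ⟨⟨_, IteratedBM.isItoIntegral hI₀⟩, ⟨_, IteratedBM.isStratonovichIntegral hX hw⟩,
    fun I J hI hJ => ⟨fun hκe => ?_, fun hκo => ?_⟩⟩
  · have key := IteratedBM.tendstoFDD_signedVariation hX hB hYm hY hXYB hYB hw κ hI hJ
    have hc : IteratedBM.linCoeff κ = 0 := if_neg (Nat.not_odd_iff_even.2 hκe)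
    rw [IteratedBM.residualVar_eq, hc] at key
    simpa using key
  · have key := IteratedBM.tendstoFDD_signedVariation hX hB hYm hY hXYB hYB hw κ hI hJ
    have hc : IteratedBM.linCoeff κ = IteratedBM.gaussMoment (κ + 1) := if_pos hκo
    rw [IteratedBM.residualVar_eq, hc, IteratedBM.gaussMoment_odd hκo] at key
    simpa using key
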